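/- **Setting.** Let $\|\cdot\|_{\rm op},\|\cdot\|_{\rm F},\|\cdot\|_*$ be the operator, Frobenius and nuclear norms, $\langle M,N\rangle=\mathrm{Tr}(M^\top N)$, $\sigma(x)=1/(1+e^{-x})$ (applied entrywise to matrices), $1_n$ the all-ones vector and $J=I_n-\frac1n1_n1_n^\top$. Let $k\ge 1$, $M_1\ge M_2\ge 0$, and let $b_G,b_\alpha,b_\beta\ge 0$ satisfy $b_G+2b_\alpha+b_\beta\le M_1$ (so that $|\Theta_{ij}|\le M_1$ for all parameters below). Let $X\in\mathbb R^{n\times n}$ be a symmetric covariate matrix with zero diagonal; $X=0$ (no covariate; then take $b_\beta=0$) is allowed. The true parameter is $$\Theta_\star=\alpha_\star1_n^\top+1_n\alpha_\star^\top+\beta_\star X+G_\star,\qquad G_\star\succeq0,\ JG_\star=G_\star,$$ with $\max_iG_{\star,ii}\le b_G$, $\|\alpha_\star\|_\infty\le b_\alpha$, $|\beta_\star|\max_{i<j}|X_{ij}|\le b_\beta$ and $\max_{i\ne j}\Theta_{\star,ij}\le -M_2$. The adjacency matrix $A$ is symmetric with zero diagonal, and its entries $A_{ij}$, $i<j$,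 are independent with $A_{ij}\sim\mathrm{Bernoulli}(\sigma(\Theta_{\star,ij}))$. Let $U_kD_kU_k^\top$ consist of the top $k$ eigen-components of $G_\star$, $Z_\star=U_kD_k^{1/2}\in\mathbb R^{n\times k}$, $\bar G_k=G_\star-Z_\star Z_\star^\top$. Assume that the smallest ($k$-th) singular value of $Z_\star$ is positive, and let $\kappa$ be the ratio of the largest to the smallest singular value of $Z_\star$. Put $\phi_n^2=e^{2M_1}nk\max\{e^{-M_2},\frac{\log n}{n}\}$. **Algorithm.** Let $\mathcal C_G=\{G\succeq0: JG=G,\ \max_{i,j}|G_{ij}|\le b_G\}$, $\mathcal C_\alpha=\{\alpha:\|\alpha\|_\infty\le b_\alpha\}$, $\mathcal C_\beta=\{\beta:|\beta|\max_{i,j}|X_{ij}|\le b_\beta\}$, and let $\mathcal P_{\mathcal C}$ be the Euclidean (for matrices: Frobenius) projection onto $\mathcal C$. Start at $(G^0,\alpha^0,\beta^0)=(0,0,0)$ and, with $\Theta^t=\alpha^t1_n^\top+1_n(\alpha^t)^\top+\beta^tX+G^t$ and $R^t=A-\sigma(\Theta^t)$, iterate $$G^{t+1}=\mathcal P_{\mathcal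 C_G}\big(G^t+\eta(R^t-\lambda_nI_n-\gamma_nG^t)\big),\qquad \alpha^{t+1}=\mathcal P_{\mathcal C_\alpha}\big(\alpha^t+\eta(sR^t1_n/n-r\gamma_n\alpha^t)\big),$$ $$\beta^{t+1}=\mathcal P_{\mathcal C_\beta}\big(\beta^t+\eta(\langle R^t,X\rangle/\|X\|_{\rm F}^2-\gamma_n\beta^t)\big),$$ where the update of $\beta$ is skipped if $X=0$, and where the normalisation $(s,r)$ of the $\alpha$-step is any one of $(\frac12,1),(1,1),(2,2)$. After $T$ steps let $Z^T=U D^{1/2}\in\mathbb R^{n\times k}$, where $UDU^\top$ consists of the top $k$ eigen-components of $G^T$. The error is $$e_T=\|Z_\star\|_{\rm op}^2\min_{R\in O(k)}\|Z^T-Z_\star R\|_{\rm F}^2+2\|(\alpha^T-\alpha_\star)1_n^\top\|_{\rm F}^2+\|(\beta^T-\beta_\star)X\|_{\rm F}^2 .$$ **Theorem 4.5.** There is an absolute constant $M_0>0$, for every $K>0$ there are constants $C_0,\delta,c,C_1>0$ depending only on $K$, and for every $c_1>0$ there are constants $c_0,C>0$ depending only on $K$ and $c_1$, such that the following holds for all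 $n,k,M_1,M_2,b_G,b_\alpha,b_\beta,X$ and all true parameters as above. Suppose that * if $X\neq0$, then $\|X\|_{\rm F}^2/\|X\|_{\rm op}^2\ge M_0k$; * $\|\alpha_\star1_n^\top\|_{\rm F}\le K\|G_\star\|_{\rm F}$ and $\|\beta_\star X\|_{\rm F}\le K\|G_\star\|_{\rm F}$; * $C_0\sqrt{\max\{ne^{-M_2},\log n\}}\le\lambda_n\le c_0\|G_\star\|_{\rm op}/(e^{2M_1}\sqrt k\,\kappa^3)$, $\ 0<\gamma_n\le\delta\lambda_n/\|G_\star\|_{\rm op}$, $\ 0<\eta\le 2/9$; * $\|G_\star\|_{\rm op}^2\ge C\kappa^6e^{2M_1}\max\{\phi_n^2,\ \|\bar G_k\|_*^2/k,\ \|\bar G_k\|_{\rm F}^2\}$. Then, with probability at least $1-n^{-c}$, $$e_T\le c_1^2e^{-2M_1}\|Z_\star\|_{\rm op}^4/\kappa^4\qquad\text{for all integers } T\ge T_0:=\log\Big(\frac{C_1e^{2M_1}k\kappa^6}{c_1^2}\Big)\Big(\log\frac1{1-\gamma_n\eta}\Big)^{-1}.$$ -/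

import Mathlib

open MeasureTheory ProbabilityTheory

noncomputable section

namespace LatentSpace

/-! ### Matrix norms and spectral quantities -/

/-- Frobenius norm of a real matrix. -/
def frob {m n : ℕ} (M : Matrix (Fin m) (Fin n) ℝ) : ℝ :=
  √(∑ i, ∑ j, M i j ^ 2)

/-- Euclidean norm of a vector. -/
def vecNorm {n : ℕ} (v : Fin n → ℝ) : ℝ :=
  √(∑ i, v i ^ 2)

/-- Trace inner product `Tr(MᵀN)`. -/
def frobInner {m n : ℕ} (M N : Matrix (Fin m) (Fin n) ℝ) : ℝ :=
  ∑ i, ∑ j, M i j * N i j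

open scoped Matrix.Norms.L2Operator in
/-- Operator norm (largest singular value), i.e. the norm induced by the Euclidean norms. -/
def opNorm {m n : ℕ} (M : Matrix (Fin m) (Fin n) ℝ) : ℝ :=
  ‖M‖

/-- Singular values, in decreasing order; the index starts at `0`. -/
def singVal {m n : ℕ} (M : Matrix (Fin m) (Fin n) ℝ) (i : ℕ) : ℝ :=
  (Matrix.toEuclideanLin M).singularValues i

/-- Nuclear norm: the sum of the singular values. -/
def nuclearNorm {m n : ℕ} (M : Matrix (Fin m) (Fin n) ℝ) : ℝ :=
  ∑ i ∈ Finset.range n, singVal M i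

/-- Condition number of an `n × k` matrix: ratio of its largest to its smallest (that is, `k`-th)
singular value. It is used only when the latter is positive. -/
def condNum {n k : ℕ} (Z : Matrix (Fin n) (Fin k) ℝ) : ℝ :=
  opNorm Z / singVal Z (k - 1)

/-- The matrix `v 1ᵀ`. -/
def outerOne {n : ℕ} (v : Fin n → ℝ) : Matrix (Fin n) (Fin n) ℝ :=
  Matrix.vecMulVec v (fun _ => 1)

/-- The centering matrix `J = I - (1/n) 1 1ᵀ`. -/
def centering (n : ℕ) : Matrix (Fin n) (Fin n) ℝ :=
  1 - (1 / (n : ℝ)) • Matrix.of (fun _ _ => (1 : ℝ))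

/-- `Z = U_k D_k^{1/2}`, where `U_k D_k U_kᵀ` consists of the top `k` eigen-components of `G`:
`u` is an orthonormal eigenbasis of `G` with eigenvalues `d` in decreasing order, and the `a`-th
column of `Z` is `√(d a) • u a`. (Ties and signs may be resolved in any way.) -/
def IsTopFactor {n : ℕ} (k : ℕ) (G : Matrix (Fin n) (Fin n) ℝ)
    (Z : Matrix (Fin n) (Fin k) ℝ) : Prop :=
  ∃ (hk : k ≤ n) (u : OrthonormalBasis (Fin n) ℝ (EuclideanSpace ℝ (Fin n))) (d : Fin n → ℝ),
    Antitone d ∧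
    (∀ i, Matrix.toEuclideanLin G (u i) = d i • u i) ∧
    ∀ i a, Z i a = √(d (Fin.castLE hk a)) * u (Fin.castLE hk a) i

/-- Distance of two `n × k` matrices modulo right multiplication by an orthogonal matrix. -/
def procrustes {n k : ℕ} (Z₁ Z₂ : Matrix (Fin n) (Fin k) ℝ) : ℝ :=
  ⨅ R : Matrix.orthogonalGroup (Fin k) ℝ,
    frob (Z₁ - Z₂ * (R : Matrix (Fin k) (Fin k) ℝ))

/-! ### The model -/

/-- `Θ = α 1ᵀ + 1 αᵀ + β X + G`. -/
def thetaMat {n : ℕ} (X G : Matrix (Fin n) (Fin n) ℝ) (α : Fin n → ℝ) (β : ℝ) :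
    Matrix (Fin n) (Fin n) ℝ :=
  Matrix.of fun i j => α i + α j + β * X i j + G i j

/-- Constraint set for `G`: positive semidefinite, centered, entries bounded by `b`. -/
def setG (n : ℕ) (b : ℝ) : Set (Matrix (Fin n) (Fin n) ℝ) :=
  {G | G.PosSemidef ∧ centering n * G = G ∧ ∀ i j, |G i j| ≤ b}

/-- Constraint set for `α`: sup-norm at most `b`. -/
def setAlpha (n : ℕ) (b : ℝ) : Set (Fin n → ℝ) :=
  {α | ∀ i, |α i| ≤ b}

/-- Constraint set for `β`: `|β| * max |X i j|` at most `b`. -/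
def setBeta {n : ℕ} (X : Matrix (Fin n) (Fin n) ℝ) (b : ℝ) : Set ℝ :=
  {β | ∀ i j, |β| * |X i j| ≤ b}

/-- The parameter space: bounded, centered, positive semidefinite `G` (its diagonal is bounded by
`bG`), bounded `α` and `β X`, and off-diagonal entries of `Θ` at most `-M₂`. -/
structure InParamSpace {n : ℕ} (X : Matrix (Fin n) (Fin n) ℝ) (bG bα bβ M₂ : ℝ)
    (G : Matrix (Fin n) (Fin n) ℝ) (α : Fin n → ℝ) (β : ℝ) : Prop where
  psd : G.PosSemidef
  centered : centering n * G = G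
  diag_le : ∀ i, G i i ≤ bG
  alpha_le : ∀ i, |α i| ≤ bα
  beta_le : ∀ i j, i < j → |β| * |X i j| ≤ bβ
  theta_le : ∀ i j, i ≠ j → thetaMat X G α β i j ≤ -M₂

/-- `A` is the random adjacency matrix of a simple undirected graph whose edges are independent,
edge `{i, j}` being present with probability `sigmoid (Θ i j)`. -/
structure IsNetwork {Ω : Type*} [MeasurableSpace Ω] (μ : Measure Ω) {n : ℕ}
    (Θ : Matrix (Fin n) (Fin n) ℝ) (A : Ω → Matrix (Fin n) (Fin n) ℝ) : Prop where
  meas : ∀ i j, Measurable fun ω => A ω i j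
  symm : ∀ ω i j, A ω i j = A ω j i
  diag : ∀ ω i, A ω i i = 0
  zero_or_one : ∀ ω i j, A ω i j = 0 ∨ A ω i j = 1
  prob : ∀ i j, i < j → μ.real {ω | A ω i j = 1} = Real.sigmoid (Θ i j)
  indep : iIndepFun (fun (p : {p : Fin n × Fin n // p.1 < p.2}) ω => A ω p.1.1 p.1.2) μ

/-! ### The algorithm: projected gradient descent in the lifted space -/

/-- Projection of `y` onto `C` with respect to the norm `N`: a point of `C` nearest to `y`. (For
the closed, convex, nonempty sets and Euclidean norms used below it exists and is unique.) -/
def nearestPoint {V : Type*} [AddGroup V] (N : V → ℝ) (C : Set V) (y : V) : V :=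
  Classical.epsilon fun w => w ∈ C ∧ ∀ v ∈ C, N (w - y) ≤ N (v - y)

/-- The current iterate `(G, α, β)`. -/
structure Iterate (n : ℕ) where
  G : Matrix (Fin n) (Fin n) ℝ
  α : Fin n → ℝ
  β : ℝ

/-- `A - σ(Θ)` at the current iterate. -/
def residual {n : ℕ} (A X : Matrix (Fin n) (Fin n) ℝ) (x : Iterate n) :
    Matrix (Fin n) (Fin n) ℝ :=
  A - (thetaMat X x.G x.α x.β).map Real.sigmoid

/-- One projected gradient step. The numbers `s` and `r` normalise the two parts of the `α`-step;
the update of `β` is skipped when there is no covariate, i.e. `X = 0`. -/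
def step {n : ℕ} (A X : Matrix (Fin n) (Fin n) ℝ) (bG bα bβ lam gam η s r : ℝ)
    (x : Iterate n) : Iterate n where
  G := nearestPoint frob (setG n bG)
    (x.G + η • (residual A X x - lam • (1 : Matrix (Fin n) (Fin n) ℝ) - gam • x.G))
  α := nearestPoint vecNorm (setAlpha n bα) fun i =>
    x.α i + η * (s * (∑ j, residual A X x i j) / n - r * gam * x.α i)
  β := by
    classical
    exact if X = 0 then x.β else
      nearestPoint (fun b : ℝ => |b|) (setBeta X bβ)
        (x.β + η * (frobInner (residual A X x) X / frob X ^ 2 - gam * x.β))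

/-- The iterates, started at `(0, 0, 0)`. -/
def iter {n : ℕ} (A X : Matrix (Fin n) (Fin n) ℝ) (bG bα bβ lam gam η s r : ℝ) :
    ℕ → Iterate n
  | 0 => ⟨0, 0, 0⟩
  | t + 1 => step A X bG bα bβ lam gam η s r (iter A X bG bα bβ lam gam η s r t)

/-- The error metric
`‖Z⋆‖_op² dist(Z, Z⋆)² + 2 ‖(α - α⋆) 1ᵀ‖_F² + ‖(β - β⋆) X‖_F²`. -/
def errMetric {n k : ℕ} (X : Matrix (Fin n) (Fin n) ℝ)
    (Zs : Matrix (Fin n) (Fin k) ℝ) (αs : Fin n → ℝ) (βs : ℝ)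
    (Z : Matrix (Fin n) (Fin k) ℝ) (α : Fin n → ℝ) (β : ℝ) : ℝ :=
  opNorm Zs ^ 2 * procrustes Z Zs ^ 2 + 2 * frob (outerOne (α - αs)) ^ 2
    + frob ((β - βs) • X) ^ 2

/-- The squared statistical rate `e^{2M₁} n k max{e^{-M₂}, log n / n}`. -/
def rateSq (n k : ℕ) (M₁ M₂ : ℝ) : ℝ :=
  Real.exp (2 * M₁) * n * k * max (Real.exp (-M₂)) (Real.log n / n)

end LatentSpace

end

/-! The algorithm is projected gradient descent for a convex problem: the logistic likelihood with
the penalty `lam * trace G` (the nuclear norm, since `G` is positive semidefinite) and a small ridge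
of size `gam`. The proof separates optimisation from statistics by comparing the iterates with a
fixed point of the step and the fixed point with the truth.

Optimisation. The sigmoid is monotone and 1/4-Lipschitz, hence co-coercive, so in the weighted
distance `sqDist` the gradient step without ridge does not expand, and the ridge makes it a
contraction with factor `1 - gam * η` (`sqDist_step_le`). The data and the penalty cancel in
differences. Hence the iterates converge linearly to a fixed point (`exists_fixedPoint`), and the
number of steps in the theorem makes the remaining distance negligible.

Statistics. A fixed point satisfies a variational inequality which is tested at the truth
(`variational_ineq`). Strong monotonicity of the sigmoid on `[-M, M]`, with constant `exp (-M) / 4`,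
turns it into a quadratic bound. Noise of operator norm at most `lam / 4` is dominated by the trace
penalty outside the leading `k`-dimensional eigenspace and costs a factor `√k` on it. The condition
on `X` makes `β X` nearly orthogonal to the other components, so the error of `Θ` controls the
errors of `G`, `α` and `β` separately (`fixedPoint_error`).

Noise. `‖A - σ(Θ)‖ ≲ √d`, with `d` the larger of the degree scale and `log n`, is proved in the
manner of Kahn–Szemerédi and Feige–Ofek (`IsNetwork.opNorm_tail`). On a net of integer vectors the
bilinear form splits into light entries, handled by Bernstein and a union bound, and heavy entries,
handled by bounded degrees and a discrepancy estimate between dyadic level sets. In the single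
direction `X` Chebyshev suffices.

Factors. Eckart–Young and a Procrustes inequality pass from `G` to its top factor without an
eigengap (`errMetric_le`); `errMetric_iter_le` collects the deterministic part. -/

namespace LatentSpace

/-! ### Tail bounds for weighted sums of independent Bernoulli variables -/

/-- Index set of the potential edges of a graph on `Fin n`. -/
abbrev EdgeIdx (n : ℕ) := {p : Fin n × Fin n // p.1 < p.2}

lemma sum_sum_eq_sum_edges {n : ℕ} (f : Fin n → Fin n → ℝ) (hf : ∀ i, f i i = 0) :
    ∑ i, ∑ j, f i j = ∑ e : EdgeIdx n, (f e.1.1 e.1.2 + f e.1.2 e.1.1) := by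
  have h1 : ∑ e : EdgeIdx n, (f e.1.1 e.1.2 + f e.1.2 e.1.1)
      = ∑ p : Fin n × Fin n, if p.1 < p.2 then (f p.1 p.2 + f p.2 p.1) else 0 := by
    rw [← Finset.sum_filter]
    exact (Finset.sum_subtype (Finset.univ.filter fun p : Fin n × Fin n => p.1 < p.2)
      (by simp) (fun p : Fin n × Fin n => f p.1 p.2 + f p.2 p.1)).symm
  have h2 : ∀ i j : Fin n, f i j = (if i < j then f i j else 0) + (if j < i then f i j else 0) := by
    intro i j
    rcases lt_trichotomy i j with h | h | h
    · simp [h, h.le]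
    · subst h; simp [hf]
    · simp [h, h.le]
  rw [h1, Fintype.sum_prod_type]
  calc ∑ i, ∑ j, f i j
      = ∑ i, ∑ j, (if i < j then f i j else 0) + ∑ i, ∑ j, (if j < i then f i j else 0) := by
        rw [← Finset.sum_add_distrib]
        refine Finset.sum_congr rfl fun i _ => ?_
        rw [← Finset.sum_add_distrib]
        exact Finset.sum_congr rfl fun j _ => h2 i j
    _ = ∑ i, ∑ j, (if i < j then f i j else 0) + ∑ i, ∑ j, (if i < j then f j i else 0) := by
        congr 1
        exact Finset.sum_comm
    _ = _ := by
        rw [← Finset.sum_add_distrib]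
        refine Finset.sum_congr rfl fun i _ => ?_
        rw [← Finset.sum_add_distrib]
        refine Finset.sum_congr rfl fun j _ => ?_
        split_ifs <;> simp

section Bernoulli

variable {Ω : Type*} [MeasurableSpace Ω] {μ : Measure Ω}

lemma integral_of_zero_or_one {X : Ω → ℝ} (hX : Measurable X)
    (h01 : ∀ ω, X ω = 0 ∨ X ω = 1) : ∫ ω, X ω ∂μ = μ.real {ω | X ω = 1} := by
  have : X = Set.indicator {ω | X ω = 1} 1 := by
    funext ω
    by_cases h : X ω = 1
    · simp [h]
    · have h0 : X ω = 0 := (h01 ω).resolve_right h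
      simp [h0]
  conv_lhs => rw [this]
  exact integral_indicator_one (hX (measurableSet_singleton 1))

variable [IsProbabilityMeasure μ]

lemma integrable_of_zero_or_one {X : Ω → ℝ} (hX : Measurable X)
    (h01 : ∀ ω, X ω = 0 ∨ X ω = 1) : Integrable X μ := by
  refine Integrable.of_bound hX.aestronglyMeasurable 1 (Filter.Eventually.of_forall fun ω => ?_)
  rcases h01 ω with h | h <;> simp [h]

lemma mgf_bernoulli_le {X : Ω → ℝ} (hX : Measurable X)
    (h01 : ∀ ω, X ω = 0 ∨ X ω = 1) (z : ℝ) :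
    mgf (fun ω => z * X ω) μ 1 ≤ Real.exp (μ.real {ω | X ω = 1} * (Real.exp z - 1)) := by
  have h : ∀ ω, Real.exp (1 * (z * X ω)) = 1 + (Real.exp z - 1) * X ω := by
    intro ω
    rcases h01 ω with h | h <;> simp [h]
  unfold mgf
  simp_rw [h]
  rw [integral_add (integrable_const _) ((integrable_of_zero_or_one hX h01).const_mul _),
    integral_const_mul, integral_of_zero_or_one hX h01]
  simp only [integral_const, probReal_univ, smul_eq_mul, mul_one]
  nlinarith [Real.add_one_le_exp (μ.real {ω | X ω = 1} * (Real.exp z - 1))]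

/-- Chernoff's bound at the fixed exponent 1: optimising over the exponent is left to the choice of
the weights `z`. -/
lemma bernoulli_sum_tail {ι : Type*} [Fintype ι] {X : ι → Ω → ℝ} (hX : ∀ e, Measurable (X e))
    (h01 : ∀ e ω, X e ω = 0 ∨ X e ω = 1) (hind : iIndepFun X μ) (z : ι → ℝ) (t : ℝ) :
    μ.real {ω | t ≤ ∑ e, z e * X e ω} ≤
      Real.exp (∑ e, μ.real {ω | X e ω = 1} * (Real.exp (z e) - 1) - t) := by
  have hmeas : ∀ e, Measurable (fun ω => z e * X e ω) := fun e => (hX e).const_mul _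
  have hind' : iIndepFun (fun e ω => z e * X e ω) μ :=
    hind.comp (fun e x => z e * x) (fun e => measurable_const_mul _)
  have hint : Integrable (fun ω => Real.exp (1 * (∑ e, fun ω => z e * X e ω) ω)) μ := by
    refine Integrable.of_bound (C := Real.exp (∑ e, |z e|)) ?_
      (Filter.Eventually.of_forall fun ω => ?_)
    · simp only [Finset.sum_apply]
      exact (Real.measurable_exp.comp (Measurable.const_mul
        (Finset.measurable_sum _ fun e _ => hmeas e) 1)).aestronglyMeasurable
    · rw [Real.norm_eq_abs, Real.abs_exp, one_mul, Finset.sum_apply]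
      refine Real.exp_le_exp.2 (Finset.sum_le_sum fun e _ => ?_)
      rcases h01 e ω with h | h
      · simp [h]
      · simpa [h] using le_abs_self _
  have h := measure_ge_le_exp_mul_mgf (μ := μ) (X := ∑ e, fun ω => z e * X e ω) t zero_le_one hint
  rw [hind'.mgf_sum hmeas] at h
  have h2 : ∏ e, mgf (fun ω => z e * X e ω) μ 1 ≤
      Real.exp (∑ e, μ.real {ω | X e ω = 1} * (Real.exp (z e) - 1)) := by
    rw [Real.exp_sum]
    exact Finset.prod_le_prod (fun e _ => mgf_nonneg) fun e _ => mgf_bernoulli_le (hX e) (h01 e) _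
  simp only [Finset.sum_apply] at h
  refine h.trans ?_
  rw [show ∑ e, μ.real {ω | X e ω = 1} * (Real.exp (z e) - 1) - t
    = -1 * t + ∑ e, μ.real {ω | X e ω = 1} * (Real.exp (z e) - 1) by ring, Real.exp_add]
  exact mul_le_mul_of_nonneg_left h2 (Real.exp_pos _).le

end Bernoulli

section Network

variable {Ω : Type*} [MeasurableSpace Ω] {μ : Measure Ω} [IsProbabilityMeasure μ] {n : ℕ}
  {Θ : Matrix (Fin n) (Fin n) ℝ} {A : Ω → Matrix (Fin n) (Fin n) ℝ}

/-- Exponential tail bound for a linear statistic of the adjacency matrix. -/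
lemma IsNetwork.tail (hA : IsNetwork μ Θ A) (hΘ : ∀ i j, Θ i j = Θ j i)
    (B : Fin n → Fin n → ℝ) (t : ℝ) :
    μ.real {ω | t ≤ ∑ i, ∑ j, B i j * A ω i j} ≤
      Real.exp ((∑ i, ∑ j, if i = j then 0 else
        Real.sigmoid (Θ i j) * (Real.exp (2 * B i j) - 1)) / 2 - t) := by
  have h := bernoulli_sum_tail (μ := μ) (X := fun (e : EdgeIdx n) ω => A ω e.1.1 e.1.2)
    (fun e => hA.meas _ _) (fun e ω => hA.zero_or_one ω _ _) hA.indep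
    (fun e => B e.1.1 e.1.2 + B e.1.2 e.1.1) t
  have hs : ∀ ω, ∑ i, ∑ j, B i j * A ω i j
      = ∑ e : EdgeIdx n, (B e.1.1 e.1.2 + B e.1.2 e.1.1) * A ω e.1.1 e.1.2 := by
    intro ω
    rw [sum_sum_eq_sum_edges _ (fun i => by simp [hA.diag])]
    refine Finset.sum_congr rfl fun e _ => ?_
    rw [hA.symm ω e.1.2 e.1.1]; ring
  simp_rw [hs]
  refine h.trans (Real.exp_le_exp.2 (sub_le_sub_right ?_ _))
  rw [sum_sum_eq_sum_edges _ (fun i => by simp), Finset.sum_div]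
  refine Finset.sum_le_sum fun e _ => ?_
  have hlt := e.2
  rw [hA.prob _ _ e.2, if_neg hlt.ne, if_neg hlt.ne', hΘ e.1.2 e.1.1, ← mul_add, mul_div_assoc]
  refine mul_le_mul_of_nonneg_left ?_ (Real.sigmoid_nonneg _)
  -- AM–GM, `exp (a + b) ≤ (exp (2 * a) + exp (2 * b)) / 2`, turns the weight of an edge into a sum
  -- over its two orientations. Thus `B` need not be symmetric, at the price of doubled exponents.
  have h1 : Real.exp (2 * B e.1.1 e.1.2) = Real.exp (B e.1.1 e.1.2) ^ 2 := by
    rw [← Real.exp_nat_mul]; norm_num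
  have h2 : Real.exp (2 * B e.1.2 e.1.1) = Real.exp (B e.1.2 e.1.1) ^ 2 := by
    rw [← Real.exp_nat_mul]; norm_num
  rw [h1, h2, Real.exp_add]
  nlinarith [sq_nonneg (Real.exp (B e.1.1 e.1.2) - Real.exp (B e.1.2 e.1.1))]

/-- Bernstein-type tail bound for a centered linear statistic of the adjacency matrix. -/
lemma IsNetwork.centered_tail (hA : IsNetwork μ Θ A) (hΘ : ∀ i j, Θ i j = Θ j i)
    (B : Fin n → Fin n → ℝ) (hB : ∀ i j, |2 * B i j| ≤ 1) (t : ℝ) :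
    μ.real {ω | t ≤ ∑ i, ∑ j, if i = j then 0 else B i j * (A ω i j - Real.sigmoid (Θ i j))} ≤
      Real.exp (2 * (∑ i, ∑ j, if i = j then 0 else
        Real.sigmoid (Θ i j) * B i j ^ 2) - t) := by
  have h := hA.tail hΘ B (t + ∑ i, ∑ j, if i = j then 0 else B i j * Real.sigmoid (Θ i j))
  have hs : ∀ ω, (t ≤ ∑ i, ∑ j, if i = j then 0 else B i j * (A ω i j - Real.sigmoid (Θ i j))) ↔
      (t + ∑ i, ∑ j, if i = j then 0 else B i j * Real.sigmoid (Θ i j)) ≤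
        ∑ i, ∑ j, B i j * A ω i j := by
    intro ω
    have : ∑ i, ∑ j, B i j * A ω i j =
        (∑ i, ∑ j, if i = j then 0 else B i j * (A ω i j - Real.sigmoid (Θ i j)))
        + ∑ i, ∑ j, if i = j then 0 else B i j * Real.sigmoid (Θ i j) := by
      simp_rw [← Finset.sum_add_distrib]
      refine Finset.sum_congr rfl fun i _ => Finset.sum_congr rfl fun j _ => ?_
      by_cases hij : i = j
      · simp [hij, hA.diag]
      · simp only [hij, if_false]; ring
    rw [this, add_le_add_iff_right]
  simp_rw [hs]
  refine h.trans (Real.exp_le_exp.2 ?_)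
  have : (∑ i, ∑ j, if i = j then 0 else
        Real.sigmoid (Θ i j) * (Real.exp (2 * B i j) - 1)) / 2
      - (∑ i, ∑ j, if i = j then 0 else B i j * Real.sigmoid (Θ i j)) ≤
      2 * (∑ i, ∑ j, if i = j then 0 else Real.sigmoid (Θ i j) * B i j ^ 2) := by
    rw [Finset.sum_div, Finset.mul_sum, ← Finset.sum_sub_distrib]
    refine Finset.sum_le_sum fun i _ => ?_
    rw [Finset.sum_div, Finset.mul_sum, ← Finset.sum_sub_distrib]
    refine Finset.sum_le_sum fun j _ => ?_
    by_cases hij : i = j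
    · simp [hij]
    · simp only [hij, if_false]
      -- `exp x - 1 - x ≤ x ^ 2` for `|x| ≤ 1`, with `x = 2 * B i j`.
      have h1 := (le_abs_self _).trans (Real.abs_exp_sub_one_sub_id_le (hB i j))
      nlinarith [Real.sigmoid_nonneg (Θ i j)]
  linarith

/-- Chebyshev bound for a centered linear statistic of the adjacency matrix. -/
lemma IsNetwork.chebyshev (hA : IsNetwork μ Θ A)
    {p : ℝ} (hp : ∀ i j, i ≠ j → Real.sigmoid (Θ i j) ≤ p)
    (X : Matrix (Fin n) (Fin n) ℝ) (hX : X.IsSymm) (hX0 : ∀ i, X i i = 0)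
    (hΘ : ∀ i j, Θ i j = Θ j i) {t : ℝ} (ht : 0 < t) :
    μ.real {ω | t ≤ |frobInner (A ω - Θ.map Real.sigmoid) X|} ≤
      2 * p * (∑ i, ∑ j, X i j ^ 2) / t ^ 2 := by
  -- By symmetry each edge counts twice. Its variance is then at most `4 * X i j ^ 2 * p`, which is
  -- `2 * p` times its share of the double sum of squares.
  set Y : EdgeIdx n → Ω → ℝ := fun e ω => 2 * X e.1.1 e.1.2 * A ω e.1.1 e.1.2 with hY
  have hbd : ∀ e ω, |A ω (e : EdgeIdx n).1.1 e.1.2| ≤ 1 := by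
    intro e ω; rcases hA.zero_or_one ω e.1.1 e.1.2 with h | h <;> simp [h]
  have hAL : ∀ e : EdgeIdx n, MemLp (fun ω => A ω e.1.1 e.1.2) 2 μ := fun e =>
    MemLp.of_bound (hA.meas _ _).aestronglyMeasurable 1 (Filter.Eventually.of_forall (hbd e))
  have hYL : ∀ e, MemLp (Y e) 2 μ := fun e => (hAL e).const_mul _
  have hYind : iIndepFun Y μ :=
    hA.indep.comp (fun e x => 2 * X e.1.1 e.1.2 * x) (fun e => measurable_const_mul _)
  have hvar : variance (∑ e, Y e) μ = ∑ e, variance (Y e) μ :=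
    IndepFun.variance_sum (fun e _ => hYL e) fun e _ e' _ hne => hYind.indepFun hne
  have hEA : ∀ e : EdgeIdx n, ∫ ω, A ω e.1.1 e.1.2 ∂μ = Real.sigmoid (Θ e.1.1 e.1.2) := fun e => by
    rw [integral_of_zero_or_one (hA.meas _ _) (fun ω => hA.zero_or_one ω _ _), hA.prob _ _ e.2]
  have hYvar : ∀ e, variance (Y e) μ ≤ 4 * X e.1.1 e.1.2 ^ 2 * p := by
    intro e
    have h1 : variance (fun ω => A ω e.1.1 e.1.2) μ ≤ p := by
      refine (variance_le_expectation_sq (hA.meas _ _).aestronglyMeasurable).trans ?_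
      have : ∀ ω, A ω e.1.1 e.1.2 ^ 2 = A ω e.1.1 e.1.2 := fun ω => by
        rcases hA.zero_or_one ω e.1.1 e.1.2 with h | h <;> simp [h]
      simp only [Pi.pow_apply, this]
      rw [hEA]
      exact hp _ _ e.2.ne
    rw [hY, variance_const_mul]
    nlinarith [sq_nonneg (X e.1.1 e.1.2)]
  have hint : ∫ ω, (∑ e, Y e) ω ∂μ = ∑ e : EdgeIdx n, 2 * X e.1.1 e.1.2 * Real.sigmoid (Θ e.1.1 e.1.2) := by
    simp only [Finset.sum_apply]
    rw [integral_finsetSum _ fun e _ => (hYL e).integrable (by norm_num)]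
    refine Finset.sum_congr rfl fun e _ => ?_
    simp only [hY]
    rw [integral_const_mul, hEA]
  have hstat : ∀ ω, frobInner (A ω - Θ.map Real.sigmoid) X
      = (∑ e, Y e) ω - ∫ ω, (∑ e, Y e) ω ∂μ := by
    intro ω
    rw [hint, Finset.sum_apply, frobInner, sum_sum_eq_sum_edges _ (fun i => by simp [hX0]),
      ← Finset.sum_sub_distrib]
    refine Finset.sum_congr rfl fun e _ => ?_
    simp only [Matrix.sub_apply, Matrix.map_apply, hY]
    rw [hA.symm ω e.1.2 e.1.1, hΘ e.1.2 e.1.1, hX.apply e.1.1 e.1.2]; ring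
  have hmem : MemLp (∑ e, Y e) 2 μ := memLp_finsetSum' _ fun e _ => hYL e
  have h := meas_ge_le_variance_div_sq hmem ht
  simp_rw [hstat]
  have hv0 : variance (∑ e, Y e) μ ≤ 2 * p * (∑ i, ∑ j, X i j ^ 2) := by
    rw [hvar, sum_sum_eq_sum_edges _ (fun i => by simp [hX0]), Finset.mul_sum]
    refine Finset.sum_le_sum fun e _ => ?_
    rw [hX.apply e.1.1 e.1.2]
    linarith [hYvar e]
  refine (ENNReal.toReal_mono ENNReal.ofReal_ne_top h).trans ?_
  rw [ENNReal.toReal_ofReal (div_nonneg (variance_nonneg _ _) (sq_nonneg _))]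
  exact div_le_div_of_nonneg_right hv0 (sq_nonneg _)

end Network

/-! ### Summation over dyadic scales -/

/-- A geometric sum is at most `ρ / (ρ - 1)` times its largest term, and this ratio is at most 4
once `4 / 3 ≤ ρ`; the threshold admits both ratios used below, `2` and `√2`. -/
lemma sum_pow_filter_le {ρ : ℝ} (hρ : 4 / 3 ≤ ρ) (s : Finset ℕ) {Y : ℝ} (hY : 0 ≤ Y) :
    ∑ b ∈ s with ρ ^ b ≤ Y, ρ ^ b ≤ 4 * Y := by
  rcases (s.filter fun b => ρ ^ b ≤ Y).eq_empty_or_nonempty with h | h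
  · rw [h]; simpa using hY
  · set k := (s.filter fun b => ρ ^ b ≤ Y).max' h
    have hk : ρ ^ k ≤ Y := (Finset.mem_filter.1 (Finset.max'_mem _ h)).2
    have hsub : (s.filter fun b => ρ ^ b ≤ Y) ⊆ Finset.range (k + 1) := fun b hb =>
      Finset.mem_range.2 (Nat.lt_succ_of_le (Finset.le_max' _ _ hb))
    have h1 : ∑ b ∈ s with ρ ^ b ≤ Y, ρ ^ b ≤ ∑ b ∈ Finset.range (k + 1), ρ ^ b :=
      Finset.sum_le_sum_of_subset_of_nonneg hsub fun b _ _ => by positivity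
    have h2 := geom_sum_mul ρ (k + 1)
    have h3 : 0 ≤ ∑ b ∈ Finset.range (k + 1), ρ ^ b := Finset.sum_nonneg fun b _ => by positivity
    have h4 : 0 < ρ ^ k := by positivity
    rw [pow_succ] at h2
    nlinarith

lemma one_add_log_le_two_sqrt {x : ℝ} (hx : 0 < x) : 1 + Real.log x ≤ 2 * √x := by
  have h := Real.log_le_sub_one_of_pos (Real.sqrt_pos.2 hx)
  rw [Real.log_sqrt hx.le] at h
  linarith

/-- `w / (1 + log w)` is dominated by its value at a larger point, with a gain of `√(w / W)`. -/
lemma div_one_add_log_le {w W : ℝ} (hw : 1 ≤ w) (hW : w ≤ W) :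
    w / (1 + Real.log w) ≤ 2 * √w * √W / (1 + Real.log W) := by
  have hw0 : 0 < w := by linarith
  have hW0 : 0 < W := by linarith
  have h1 : 0 ≤ Real.log w := Real.log_nonneg hw
  have h2 : 0 ≤ Real.log (W / w) := Real.log_nonneg ((one_le_div hw0).2 hW)
  have h3 : Real.log W = Real.log w + Real.log (W / w) := by
    rw [Real.log_div hW0.ne' hw0.ne']; ring
  have h4 := one_add_log_le_two_sqrt (div_pos hW0 hw0)
  have h5 : 1 + Real.log W ≤ (1 + Real.log w) * (2 * √(W / w)) := by
    rw [h3]; nlinarith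
  rw [div_le_div_iff₀ (by linarith) (by linarith)]
  have h6 : w * √(W / w) = √w * √W := by
    rw [Real.sqrt_div hW0.le]
    have := Real.mul_self_sqrt hw0.le
    field_simp
    nlinarith [Real.sqrt_nonneg W]
  calc w * (1 + Real.log W) ≤ w * ((1 + Real.log w) * (2 * √(W / w))) := by gcongr
    _ = 2 * (w * √(W / w)) * (1 + Real.log w) := by ring
    _ = 2 * √w * √W * (1 + Real.log w) := by rw [h6]; ring

/-- Entropy penalty attached to a set of `s` indices at scale `u`. -/
noncomputable def scalePenalty (n u s : ℝ) : ℝ := s * (1 + 4 * Real.log u) + n / u ^ 4 + 3 * Real.log n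

lemma scalePenalty_nonneg {n u s : ℝ} (hn : 1 ≤ n) (hu : 1 ≤ u) (hs : 0 ≤ s) :
    0 ≤ scalePenalty n u s := by
  have := Real.log_nonneg hn
  have := Real.log_nonneg hu
  unfold scalePenalty; positivity

/-- The dyadic scales up to `√N`. -/
def scales (N : ℕ) : Finset ℕ := (Finset.range (N + 1)).filter fun a => 4 ^ a ≤ N

lemma mem_scales {N a : ℕ} : a ∈ scales N ↔ 4 ^ a ≤ N := by
  unfold scales
  rw [Finset.mem_filter, Finset.mem_range]
  refine ⟨fun h => h.2, fun h => ⟨?_, h⟩⟩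
  have : a < 4 ^ a := Nat.lt_pow_self (by norm_num)
  omega

lemma two_pow_sq (a : ℕ) : ((2 : ℝ) ^ a) ^ 2 = 4 ^ a := by
  rw [← pow_mul, mul_comm, pow_mul]; norm_num

lemma sqrt_two_pow (a : ℕ) : √((2 : ℝ) ^ a) = √2 ^ a := by
  rw [Real.sqrt_eq_iff_mul_self_eq (by positivity) (by positivity), ← mul_pow]
  simp

/-- The three summands of the penalty give `32 n`, `2 n` and `384 n`. For the first the two
logarithms cancel, for the second the powers of `4 ^ a` leave a convergent geometric series. The
third needs the logarithm in the denominator: by `div_one_add_log_le` the sum is dominated by the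
top scale `4 ^ a ≈ 16 n`, where that logarithm compensates `log n`. -/
lemma sum_penalty_le {n : ℕ} (hn : 1 ≤ n) (σ : ℕ → ℝ) (hσ : ∀ a, 0 ≤ σ a)
    (hσs : ∑ a ∈ scales (16 * n), 4 ^ a * σ a ≤ 16 * n) :
    ∑ a ∈ scales (16 * n), (2 : ℝ) ^ a * 2 ^ a *
        scalePenalty n (2 ^ a) (σ a) / (1 + 2 * Real.log (2 ^ a)) ≤ 418 * n := by
  have hn' : (1 : ℝ) ≤ n := by exact_mod_cast hn
  have hlogn : 0 ≤ Real.log n := Real.log_nonneg hn'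
  have hlog : ∀ a : ℕ, 0 ≤ Real.log ((2 : ℝ) ^ a) := fun a =>
    Real.log_nonneg (one_le_pow₀ (by norm_num))
  have key : ∀ a ∈ scales (16 * n), (2 : ℝ) ^ a * 2 ^ a *
        scalePenalty n (2 ^ a) (σ a) / (1 + 2 * Real.log (2 ^ a)) ≤
      2 * (4 ^ a * σ a) + n * (1 / 4) ^ a
        + 3 * Real.log n * (2 * 2 ^ a * √(16 * n) / (1 + Real.log (16 * n))) := by
    intro a ha
    have h4 : (4 : ℝ) ^ a ≤ 16 * n := by exact_mod_cast mem_scales.1 ha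
    have hL := hlog a
    have h1 : (2 : ℝ) ^ a * 2 ^ a = 4 ^ a := by rw [← two_pow_sq]; ring
    have hd := div_one_add_log_le (w := 4 ^ a) (W := 16 * n) (one_le_pow₀ (by norm_num)) h4
    rw [← two_pow_sq, Real.sqrt_sq (by positivity), Real.log_pow, two_pow_sq] at hd
    push_cast at hd
    have e1 : (2 : ℝ) ^ a * 2 ^ a * scalePenalty n (2 ^ a) (σ a) / (1 + 2 * Real.log (2 ^ a))
        = 4 ^ a * σ a * ((1 + 4 * Real.log (2 ^ a)) / (1 + 2 * Real.log (2 ^ a)))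
          + n * (4 ^ a / (2 ^ a) ^ 4) / (1 + 2 * Real.log (2 ^ a))
          + 3 * Real.log n * (4 ^ a / (1 + 2 * Real.log (2 ^ a))) := by
      rw [h1, scalePenalty]; ring
    have e2 : (1 + 4 * Real.log ((2 : ℝ) ^ a)) / (1 + 2 * Real.log (2 ^ a)) ≤ 2 := by
      rw [div_le_iff₀ (by linarith)]; linarith
    have e3 : (4 : ℝ) ^ a / (2 ^ a) ^ 4 = (1 / 4) ^ a := by
      rw [show ((2 : ℝ) ^ a) ^ 4 = 4 ^ a * 4 ^ a by rw [← two_pow_sq]; ring, one_div, inv_pow]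
      field_simp
    rw [e1, e3]
    have hσa := hσ a
    refine add_le_add (add_le_add ?_ ?_) ?_
    · rw [mul_comm (2 : ℝ) (4 ^ a * σ a)]
      exact mul_le_mul_of_nonneg_left e2 (by positivity)
    · exact div_le_self (by positivity) (by linarith)
    · exact mul_le_mul_of_nonneg_left hd (mul_nonneg (by norm_num) hlogn)
  refine (Finset.sum_le_sum key).trans ?_
  rw [Finset.sum_add_distrib, Finset.sum_add_distrib, ← Finset.mul_sum, ← Finset.mul_sum,
    ← Finset.mul_sum]
  have hg : ∑ a ∈ scales (16 * n), (1 / 4 : ℝ) ^ a ≤ 2 := by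
    refine (Finset.sum_le_sum_of_subset_of_nonneg (Finset.filter_subset _ _)
      fun b _ _ => by positivity).trans ?_
    have := geom_sum_mul (1 / 4 : ℝ) (16 * n + 1)
    have h0 : (0 : ℝ) ≤ (1 / 4) ^ (16 * n + 1) := by positivity
    nlinarith
  have hs : ∑ a ∈ scales (16 * n), (2 : ℝ) ^ a ≤ 4 * √(16 * n) := by
    have h := sum_pow_filter_le (ρ := 2) (by norm_num) (scales (16 * n)) (Real.sqrt_nonneg (16 * n))
    rwa [Finset.filter_true_of_mem] at h
    intro a ha
    refine Real.le_sqrt_of_sq_le ?_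
    rw [two_pow_sq]
    exact_mod_cast mem_scales.1 ha
  have hlog16 : Real.log n ≤ 1 + Real.log (16 * n) := by
    have := Real.log_le_log (by linarith) (show (n : ℝ) ≤ 16 * n by linarith)
    linarith
  have hlast : 3 * Real.log n * ∑ a ∈ scales (16 * n),
      (2 * 2 ^ a * √(16 * n) / (1 + Real.log (16 * n))) ≤ 384 * n := by
    have e : ∑ a ∈ scales (16 * n), (2 * 2 ^ a * √(16 * n) / (1 + Real.log (16 * n)))
        = (∑ a ∈ scales (16 * n), (2 : ℝ) ^ a) * (2 * √(16 * n) / (1 + Real.log (16 * n))) := by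
      rw [Finset.sum_mul]
      exact Finset.sum_congr rfl fun a _ => by ring
    have hpos : 0 < 1 + Real.log (16 * n) := by
      have := Real.log_nonneg (show (1 : ℝ) ≤ 16 * n by linarith)
      linarith
    rw [e]
    calc 3 * Real.log n * ((∑ a ∈ scales (16 * n), (2 : ℝ) ^ a)
          * (2 * √(16 * n) / (1 + Real.log (16 * n))))
        ≤ 3 * Real.log n * ((4 * √(16 * n)) * (2 * √(16 * n) / (1 + Real.log (16 * n)))) := by
          gcongr
      _ = 24 * (√(16 * n) * √(16 * n)) * (Real.log n / (1 + Real.log (16 * n))) := by ring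
      _ ≤ 24 * (√(16 * n) * √(16 * n)) * 1 := by
          gcongr
          exact (div_le_one hpos).2 hlog16
      _ = 384 * n := by rw [Real.mul_self_sqrt (by positivity)]; ring
  nlinarith

/-- Apply `div_one_add_log_le` with `w = 2 ^ a * 2 ^ b / r` and `W = (2 ^ a) ^ 2`, which the
condition `2 ^ b ≤ 2 ^ a * r` permits. What remains is geometric in `√2 ^ b`, so the largest
admissible `b` dominates. -/
lemma sum_div_one_add_log_le {r : ℝ} (hr : 0 < r) (a : ℕ) (s : Finset ℕ) :
    ∑ b ∈ s with r < 2 ^ a * 2 ^ b ∧ (2 : ℝ) ^ b ≤ 2 ^ a * r,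
      (2 : ℝ) ^ b / (1 + Real.log (2 ^ a * 2 ^ b / r)) ≤
    8 * r * 2 ^ a / (1 + 2 * Real.log (2 ^ a)) := by
  set u : ℝ := 2 ^ a with hu
  have hu1 : 1 ≤ u := one_le_pow₀ (by norm_num)
  have hu0 : 0 < u := by linarith
  have hL : 0 ≤ Real.log u := Real.log_nonneg hu1
  have key : ∀ b ∈ s.filter (fun b => r < u * 2 ^ b ∧ (2 : ℝ) ^ b ≤ u * r),
      (2 : ℝ) ^ b / (1 + Real.log (u * 2 ^ b / r)) ≤
        √2 ^ b * (2 * √(r * u) / (1 + 2 * Real.log u)) := by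
    intro b hb
    obtain ⟨-, hb1, hb2⟩ := Finset.mem_filter.1 hb
    have hd := div_one_add_log_le (w := u * 2 ^ b / r) (W := u ^ 2) ((one_le_div hr).2 hb1.le)
      ((div_le_iff₀ hr).2 (by nlinarith))
    rw [Real.sqrt_sq hu0.le, Real.log_pow] at hd
    push_cast at hd
    have e1 : (2 : ℝ) ^ b / (1 + Real.log (u * 2 ^ b / r))
        = r / u * (u * 2 ^ b / r / (1 + Real.log (u * 2 ^ b / r))) := by
      field_simp
    have e2 : √(u * 2 ^ b / r) = √2 ^ b * √u / √r := by
      rw [Real.sqrt_div (by positivity), Real.sqrt_mul hu0.le, sqrt_two_pow b]; ring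
    rw [e1]
    refine (mul_le_mul_of_nonneg_left hd (by positivity)).trans (le_of_eq ?_)
    rw [e2, Real.sqrt_mul hr.le]
    have hsr : √r ≠ 0 := (Real.sqrt_pos.2 hr).ne'
    have h2 : r = √r * √r := (Real.mul_self_sqrt hr.le).symm
    field_simp
    nlinarith
  refine (Finset.sum_le_sum key).trans ?_
  rw [← Finset.sum_mul]
  have hs : ∑ b ∈ s with r < u * 2 ^ b ∧ (2 : ℝ) ^ b ≤ u * r, √2 ^ b ≤ 4 * √(u * r) := by
    refine le_trans (Finset.sum_le_sum_of_subset_of_nonneg ?_ fun b _ _ => by positivity)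
      (sum_pow_filter_le (ρ := √2) ?_ s (Real.sqrt_nonneg (u * r)))
    · intro b hb
      obtain ⟨h0, -, hb2⟩ := Finset.mem_filter.1 hb
      refine Finset.mem_filter.2 ⟨h0, ?_⟩
      rw [← sqrt_two_pow]
      exact Real.sqrt_le_sqrt hb2
    · refine Real.le_sqrt_of_sq_le (by norm_num)
  refine (mul_le_mul_of_nonneg_right hs (by positivity)).trans (le_of_eq ?_)
  rw [mul_comm r u, show 4 * √(u * r) * (2 * √(u * r) / (1 + 2 * Real.log u))
    = 8 * (√(u * r) * √(u * r)) / (1 + 2 * Real.log u) by ring, Real.mul_self_sqrt (by positivity)]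
  ring

/-- Contribution of the scales `v ≤ u r` of a penalty at scale `u`. -/
lemma sum_scales_penalty_le {n : ℕ} (hn : 1 ≤ n) {r : ℝ} (hr : 0 < r) (σ : ℕ → ℝ)
    (hσ : ∀ a, 0 ≤ σ a) (hσs : ∑ a ∈ scales (16 * n), 4 ^ a * σ a ≤ 16 * n) :
    ∑ a ∈ scales (16 * n), ∑ b ∈ scales (16 * n) with r < 2 ^ a * 2 ^ b ∧ (2 : ℝ) ^ b ≤ 2 ^ a * r,
      2 ^ a * 2 ^ b * (2 * scalePenalty n (2 ^ a) (σ a) / (1 + Real.log (2 ^ a * 2 ^ b / r))) ≤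
    6688 * n * r := by
  have hn' : (1 : ℝ) ≤ n := by exact_mod_cast hn
  have key : ∀ a ∈ scales (16 * n),
      ∑ b ∈ scales (16 * n) with r < 2 ^ a * 2 ^ b ∧ (2 : ℝ) ^ b ≤ 2 ^ a * r,
      2 ^ a * 2 ^ b * (2 * scalePenalty n (2 ^ a) (σ a) / (1 + Real.log (2 ^ a * 2 ^ b / r))) ≤
      16 * r * ((2 : ℝ) ^ a * 2 ^ a *
        scalePenalty n (2 ^ a) (σ a) / (1 + 2 * Real.log (2 ^ a))) := by
    intro a _
    have h := sum_div_one_add_log_le hr a (scales (16 * n))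
    have h0 : 0 ≤ 2 * (2 : ℝ) ^ a * scalePenalty n (2 ^ a) (σ a) :=
      mul_nonneg (by positivity) (scalePenalty_nonneg hn' (one_le_pow₀ (by norm_num)) (hσ a))
    have h2 := mul_le_mul_of_nonneg_left h h0
    rw [Finset.mul_sum] at h2
    refine (le_of_eq (Finset.sum_congr rfl fun b _ => ?_)).trans (h2.trans (le_of_eq ?_))
    · ring
    · ring
  refine (Finset.sum_le_sum key).trans ?_
  rw [← Finset.mul_sum]
  nlinarith [sum_penalty_le hn σ hσ hσs]

/-- Contribution of the pairs of scales that are so unbalanced that the degree bound suffices. -/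
lemma sum_scales_unbalanced_le {n : ℕ} {r D : ℝ} (hr : 0 < r) (hD : 0 ≤ D) (τ : ℕ → ℝ)
    (hτ : ∀ a, 0 ≤ τ a) (hτs : ∑ a ∈ scales (16 * n), 4 ^ a * τ a ≤ 16 * n) :
    ∑ b ∈ scales (16 * n), ∑ a ∈ scales (16 * n) with (2 : ℝ) ^ a * r < 2 ^ b,
      2 ^ a * 2 ^ b * (D * τ b) ≤ 64 * n * (D / r) := by
  have key : ∀ b ∈ scales (16 * n), ∑ a ∈ scales (16 * n) with (2 : ℝ) ^ a * r < 2 ^ b,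
      2 ^ a * 2 ^ b * (D * τ b) ≤ 4 * (D / r) * (4 ^ b * τ b) := by
    intro b _
    have h1 : ∑ a ∈ scales (16 * n) with (2 : ℝ) ^ a * r < 2 ^ b, (2 : ℝ) ^ a
        ≤ 4 * (2 ^ b / r) := by
      refine le_trans (Finset.sum_le_sum_of_subset_of_nonneg ?_ fun b _ _ => by positivity)
        (sum_pow_filter_le (ρ := 2) (by norm_num) (scales (16 * n))
          (show 0 ≤ (2 : ℝ) ^ b / r by positivity))
      intro a ha
      obtain ⟨h0, ha⟩ := Finset.mem_filter.1 ha
      exact Finset.mem_filter.2 ⟨h0, (le_div_iff₀ hr).2 ha.le⟩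
    have h2 := mul_le_mul_of_nonneg_right h1
      (show 0 ≤ 2 ^ b * (D * τ b) from mul_nonneg (by positivity) (mul_nonneg hD (hτ b)))
    rw [Finset.sum_mul] at h2
    refine (le_of_eq (Finset.sum_congr rfl fun a _ => by ring)).trans (h2.trans (le_of_eq ?_))
    rw [← two_pow_sq]; ring
  refine (Finset.sum_le_sum key).trans ?_
  rw [← Finset.mul_sum]
  have := mul_le_mul_of_nonneg_left hτs (show 0 ≤ 4 * (D / r) by positivity)
  linarith

/-- Summation of a two-parameter family of edge counts over all heavy pairs of dyadic scales. -/
lemma sum_scales_heavy_le {n : ℕ} (hn : 1 ≤ n) {r D : ℝ} (hr : 0 < r) (hD : 0 ≤ D)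
    (σ τ : ℕ → ℝ) (e : ℕ → ℕ → ℝ) (hσ : ∀ a, 0 ≤ σ a) (hτ : ∀ b, 0 ≤ τ b)
    (hσs : ∑ a ∈ scales (16 * n), 4 ^ a * σ a ≤ 16 * n)
    (hτs : ∑ a ∈ scales (16 * n), 4 ^ a * τ a ≤ 16 * n)
    (h1 : ∀ a b, e a b ≤ D * σ a) (h2 : ∀ a b, e a b ≤ D * τ b)
    (h3 : ∀ a ∈ scales (16 * n), ∀ b ∈ scales (16 * n), r < 2 ^ a * 2 ^ b →
      e a b * ((1 + Real.log (2 ^ a * 2 ^ b / r)) / 2) ≤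
        r ^ 2 / n * σ a * τ b * (Real.exp 1 * (2 ^ a * 2 ^ b / r)) / 2
        + scalePenalty n (2 ^ a) (σ a) + scalePenalty n (2 ^ b) (τ b)) :
    ∑ a ∈ scales (16 * n), ∑ b ∈ scales (16 * n),
      (if r < 2 ^ a * 2 ^ b then 2 ^ a * 2 ^ b * e a b else 0) ≤
      128 * n * (D / r) + 256 * Real.exp 1 * n * r + 13376 * n * r := by
  have hn' : (1 : ℝ) ≤ n := by exact_mod_cast hn
  -- A heavy pair is unbalanced one way, unbalanced the other way, or balanced. In the unbalanced
  -- cases the degree bound on the set of the larger scale suffices. In the balanced case the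
  -- discrepancy bound is divided by `(1 + log) / 2`, giving the mean term and one penalty for each
  -- set. All five majorants are nonnegative, so they may be added.
  have hpt : ∀ a ∈ scales (16 * n), ∀ b ∈ scales (16 * n),
      (if r < 2 ^ a * 2 ^ b then 2 ^ a * 2 ^ b * e a b else 0) ≤
      (if (2 : ℝ) ^ a * r < 2 ^ b then 2 ^ a * 2 ^ b * (D * τ b) else 0)
      + (if (2 : ℝ) ^ b * r < 2 ^ a then 2 ^ b * 2 ^ a * (D * σ a) else 0)
      + Real.exp 1 * (r / n) * ((4 ^ a * σ a) * (4 ^ b * τ b))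
      + (if r < 2 ^ a * 2 ^ b ∧ (2 : ℝ) ^ b ≤ 2 ^ a * r then
        2 ^ a * 2 ^ b * (2 * scalePenalty n (2 ^ a) (σ a) / (1 + Real.log (2 ^ a * 2 ^ b / r))) else 0)
      + (if r < 2 ^ b * 2 ^ a ∧ (2 : ℝ) ^ a ≤ 2 ^ b * r then
        2 ^ b * 2 ^ a * (2 * scalePenalty n (2 ^ b) (τ b) / (1 + Real.log (2 ^ b * 2 ^ a / r))) else 0) := by
    intro a ha b hb
    have hu1 : (1 : ℝ) ≤ 2 ^ a := one_le_pow₀ (by norm_num)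
    have hv1 : (1 : ℝ) ≤ 2 ^ b := one_le_pow₀ (by norm_num)
    have hσa := hσ a
    have hτb := hτ b
    have p1 : 0 ≤ (if (2 : ℝ) ^ a * r < 2 ^ b then 2 ^ a * 2 ^ b * (D * τ b) else 0) := by
      split_ifs <;> positivity
    have p2 : 0 ≤ (if (2 : ℝ) ^ b * r < 2 ^ a then 2 ^ b * 2 ^ a * (D * σ a) else 0) := by
      split_ifs <;> positivity
    have p3 : 0 ≤ Real.exp 1 * (r / n) * ((4 ^ a * σ a) * (4 ^ b * τ b)) := by positivity
    have q1 := scalePenalty_nonneg hn' hu1 hσa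
    have q2 := scalePenalty_nonneg hn' hv1 hτb
    by_cases hh : r < 2 ^ a * 2 ^ b
    swap
    · have hh' : ¬ r < 2 ^ b * 2 ^ a := by rwa [mul_comm]
      simp only [hh, hh', false_and, if_false]
      linarith
    have hlog : 0 ≤ Real.log (2 ^ a * 2 ^ b / r) := Real.log_nonneg ((one_le_div hr).2 hh.le)
    have hcomm : (2 : ℝ) ^ b * 2 ^ a = 2 ^ a * 2 ^ b := mul_comm _ _
    have p4 : 0 ≤ (if r < 2 ^ a * 2 ^ b ∧ (2 : ℝ) ^ b ≤ 2 ^ a * r then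
        2 ^ a * 2 ^ b * (2 * scalePenalty n (2 ^ a) (σ a) / (1 + Real.log (2 ^ a * 2 ^ b / r)))
        else 0) := by
      split_ifs <;> positivity
    have p5 : 0 ≤ (if r < 2 ^ b * 2 ^ a ∧ (2 : ℝ) ^ a ≤ 2 ^ b * r then
        2 ^ b * 2 ^ a * (2 * scalePenalty n (2 ^ b) (τ b) / (1 + Real.log (2 ^ b * 2 ^ a / r)))
        else 0) := by
      rw [hcomm]; split_ifs <;> positivity
    rw [if_pos hh]
    by_cases c1 : (2 : ℝ) ^ a * r < 2 ^ b
    · have : (2 : ℝ) ^ a * 2 ^ b * e a b ≤ 2 ^ a * 2 ^ b * (D * τ b) :=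
        mul_le_mul_of_nonneg_left (h2 a b) (by positivity)
      rw [if_pos c1] at p1 ⊢
      linarith
    by_cases c2 : (2 : ℝ) ^ b * r < 2 ^ a
    · have : (2 : ℝ) ^ a * 2 ^ b * e a b ≤ 2 ^ b * 2 ^ a * (D * σ a) := by
        rw [hcomm]
        exact mul_le_mul_of_nonneg_left (h1 a b) (by positivity)
      rw [if_pos c2] at p2 ⊢
      linarith
    have h := h3 a ha b hb hh
    rw [if_neg c1, if_neg c2, if_pos ⟨hh, not_lt.1 c1⟩, if_pos ⟨by rwa [mul_comm], not_lt.1 c2⟩,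
      hcomm]
    set L := 1 + Real.log (2 ^ a * 2 ^ b / r) with hLdef
    have hL1 : 1 ≤ L := by linarith
    have hL0 : 0 < L := by linarith
    have he : e a b ≤ (r ^ 2 / n * σ a * τ b * (Real.exp 1 * (2 ^ a * 2 ^ b / r)))
        + 2 * scalePenalty n (2 ^ a) (σ a) / L + 2 * scalePenalty n (2 ^ b) (τ b) / L := by
      have hX : 0 ≤ r ^ 2 / n * σ a * τ b * (Real.exp 1 * (2 ^ a * 2 ^ b / r)) := by positivity
      have h' : e a b ≤ (r ^ 2 / n * σ a * τ b * (Real.exp 1 * (2 ^ a * 2 ^ b / r))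
        + 2 * scalePenalty n (2 ^ a) (σ a) + 2 * scalePenalty n (2 ^ b) (τ b)) / L := by
        rw [le_div_iff₀ hL0]; linarith
      refine h'.trans ?_
      rw [add_div, add_div]
      gcongr
      exact div_le_self hX hL1
    have hm := mul_le_mul_of_nonneg_left he (show (0 : ℝ) ≤ 2 ^ a * 2 ^ b by positivity)
    have e1 : (2 : ℝ) ^ a * 2 ^ b * (r ^ 2 / n * σ a * τ b * (Real.exp 1 * (2 ^ a * 2 ^ b / r)))
        = Real.exp 1 * (r / n) * ((4 ^ a * σ a) * (4 ^ b * τ b)) := by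
      rw [← two_pow_sq a, ← two_pow_sq b]
      field_simp
    rw [mul_add, mul_add, e1] at hm
    linarith
  refine (Finset.sum_le_sum fun a ha => Finset.sum_le_sum fun b hb => hpt a ha b hb).trans ?_
  simp only [Finset.sum_add_distrib]
  have t1 : ∑ a ∈ scales (16 * n), ∑ b ∈ scales (16 * n),
      (if (2 : ℝ) ^ a * r < 2 ^ b then 2 ^ a * 2 ^ b * (D * τ b) else 0) ≤ 64 * n * (D / r) := by
    rw [Finset.sum_comm]
    simp_rw [← Finset.sum_filter]
    exact sum_scales_unbalanced_le hr hD τ hτ hτs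
  have t2 : ∑ a ∈ scales (16 * n), ∑ b ∈ scales (16 * n),
      (if (2 : ℝ) ^ b * r < 2 ^ a then 2 ^ b * 2 ^ a * (D * σ a) else 0) ≤ 64 * n * (D / r) := by
    simp_rw [← Finset.sum_filter]
    exact sum_scales_unbalanced_le hr hD σ hσ hσs
  have t3 : ∑ a ∈ scales (16 * n), ∑ b ∈ scales (16 * n),
      Real.exp 1 * (r / n) * ((4 ^ a * σ a) * (4 ^ b * τ b)) ≤ 256 * Real.exp 1 * n * r := by
    simp_rw [← Finset.mul_sum]
    rw [← Finset.sum_mul]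
    have hσ0 : 0 ≤ ∑ a ∈ scales (16 * n), (4 : ℝ) ^ a * σ a :=
      Finset.sum_nonneg fun a _ => mul_nonneg (by positivity) (hσ a)
    have hτ0 : 0 ≤ ∑ a ∈ scales (16 * n), (4 : ℝ) ^ a * τ a :=
      Finset.sum_nonneg fun a _ => mul_nonneg (by positivity) (hτ a)
    calc Real.exp 1 * (r / n) * ((∑ a ∈ scales (16 * n), (4 : ℝ) ^ a * σ a)
          * ∑ a ∈ scales (16 * n), (4 : ℝ) ^ a * τ a)
        ≤ Real.exp 1 * (r / n) * ((16 * n) * (16 * n)) := by gcongr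
      _ = 256 * Real.exp 1 * n * r := by field_simp; ring
  have t4 := sum_scales_penalty_le hn hr σ hσ hσs
  have t5 := sum_scales_penalty_le hn hr τ hτ hτs
  simp_rw [Finset.sum_filter] at t4 t5
  rw [Finset.sum_comm] at t5
  linarith

/-! ### Operator norm and bilinear forms -/

lemma vecNorm_eq_norm {n : ℕ} (v : Fin n → ℝ) : vecNorm v = ‖WithLp.toLp 2 v‖ := by
  rw [EuclideanSpace.norm_eq]; simp [vecNorm]

lemma vecNorm_nonneg {n : ℕ} (v : Fin n → ℝ) : 0 ≤ vecNorm v := Real.sqrt_nonneg _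

lemma vecNorm_sq {n : ℕ} (v : Fin n → ℝ) : vecNorm v ^ 2 = ∑ i, v i ^ 2 :=
  Real.sq_sqrt (Finset.sum_nonneg fun _ _ => sq_nonneg _)

lemma opNorm_nonneg {m n : ℕ} (W : Matrix (Fin m) (Fin n) ℝ) : 0 ≤ opNorm W :=
  letI := Matrix.instL2OpNormedAddCommGroup (𝕜 := ℝ) (m := Fin m) (n := Fin n)
  norm_nonneg W

lemma vecNorm_mulVec_le {m n : ℕ} (W : Matrix (Fin m) (Fin n) ℝ) (v : Fin n → ℝ) :
    vecNorm (W.mulVec v) ≤ opNorm W * vecNorm v := by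
  have h := Matrix.l2_opNorm_mulVec W (WithLp.toLp 2 v)
  rw [vecNorm_eq_norm, vecNorm_eq_norm]
  exact h

lemma dot_le_vecNorm {n : ℕ} (x y : Fin n → ℝ) : |∑ i, x i * y i| ≤ vecNorm x * vecNorm y := by
  refine abs_le_of_sq_le_sq ?_ (mul_nonneg (vecNorm_nonneg _) (vecNorm_nonneg _))
  rw [mul_pow, vecNorm_sq, vecNorm_sq]
  exact Finset.sum_mul_sq_le_sq_mul_sq _ _ _

lemma bilin_eq_dot {m n : ℕ} (W : Matrix (Fin m) (Fin n) ℝ) (x : Fin m → ℝ) (y : Fin n → ℝ) :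
    ∑ i, ∑ j, x i * y j * W i j = ∑ i, x i * W.mulVec y i := by
  refine Finset.sum_congr rfl fun i _ => ?_
  rw [Matrix.mulVec, dotProduct, Finset.mul_sum]
  exact Finset.sum_congr rfl fun j _ => by ring

lemma bilin_le_opNorm {m n : ℕ} (W : Matrix (Fin m) (Fin n) ℝ) (x : Fin m → ℝ) (y : Fin n → ℝ) :
    |∑ i, ∑ j, x i * y j * W i j| ≤ opNorm W * (vecNorm x * vecNorm y) := by
  rw [bilin_eq_dot]
  refine (dot_le_vecNorm _ _).trans ?_
  nlinarith [vecNorm_mulVec_le W y, vecNorm_nonneg x]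

lemma opNorm_le_of_mulVec {m n : ℕ} (W : Matrix (Fin m) (Fin n) ℝ) {c : ℝ} (hc : 0 ≤ c)
    (h : ∀ y, vecNorm (W.mulVec y) ≤ c * vecNorm y) : opNorm W ≤ c := by
  unfold opNorm
  rw [Matrix.l2_opNorm_def]
  refine ContinuousLinearMap.opNorm_le_bound _ hc fun y => ?_
  have := h y.ofLp
  rw [vecNorm_eq_norm, vecNorm_eq_norm] at this
  exact this

lemma vecNorm_smul {n : ℕ} (c : ℝ) (v : Fin n → ℝ) : vecNorm (c • v) = |c| * vecNorm v := by
  rw [vecNorm_eq_norm, vecNorm_eq_norm, WithLp.toLp_smul, norm_smul, Real.norm_eq_abs]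

lemma vecNorm_eq_zero {n : ℕ} {v : Fin n → ℝ} (h : vecNorm v = 0) : v = 0 := by
  rw [vecNorm_eq_norm, norm_eq_zero] at h
  simpa using congrArg WithLp.ofLp h

lemma opNorm_le_of_bilin {m n : ℕ} (W : Matrix (Fin m) (Fin n) ℝ) {c : ℝ} (hc : 0 ≤ c)
    (h : ∀ x y, vecNorm x ≤ 1 → vecNorm y ≤ 1 → ∑ i, ∑ j, x i * y j * W i j ≤ c) :
    opNorm W ≤ c := by
  refine opNorm_le_of_mulVec W hc fun y => ?_
  by_cases hy : vecNorm y = 0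
  · rw [vecNorm_eq_zero hy]; simp [vecNorm]
  have hy0 : 0 < vecNorm y := lt_of_le_of_ne (vecNorm_nonneg _) (Ne.symm hy)
  by_cases hz : vecNorm (W.mulVec y) = 0
  · rw [hz]; positivity
  have hz0 : 0 < vecNorm (W.mulVec y) := lt_of_le_of_ne (vecNorm_nonneg _) (Ne.symm hz)
  have h1 := h ((vecNorm (W.mulVec y))⁻¹ • W.mulVec y) ((vecNorm y)⁻¹ • y)
    (by rw [vecNorm_smul, abs_of_pos (inv_pos.2 hz0), inv_mul_cancel₀ hz])
    (by rw [vecNorm_smul, abs_of_pos (inv_pos.2 hy0), inv_mul_cancel₀ hy])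
  rw [bilin_eq_dot, Matrix.mulVec_smul] at h1
  have h2 : ∑ i, ((vecNorm (W.mulVec y))⁻¹ • W.mulVec y) i * ((vecNorm y)⁻¹ • W.mulVec y) i
      = (vecNorm (W.mulVec y))⁻¹ * (vecNorm y)⁻¹ * vecNorm (W.mulVec y) ^ 2 := by
    rw [vecNorm_sq, Finset.mul_sum]
    refine Finset.sum_congr rfl fun i _ => ?_
    simp only [Pi.smul_apply, smul_eq_mul]; ring
  rw [h2] at h1
  have h3 : (vecNorm (W.mulVec y))⁻¹ * (vecNorm y)⁻¹ * vecNorm (W.mulVec y) ^ 2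
      = vecNorm (W.mulVec y) / vecNorm y := by field_simp
  rw [h3, div_le_iff₀ hy0] at h1
  exact h1

/-! ### An integer net of the unit ball -/

/-- Rounding goes towards zero, so that rounding the coordinates of a vector never increases its
length. -/
lemma exists_int_trunc (y : ℝ) : ∃ m : ℤ, (m : ℝ) ^ 2 ≤ y ^ 2 ∧ (y - m) ^ 2 ≤ 1 := by
  rcases le_total 0 y with h | h
  · refine ⟨⌊y⌋, ?_, ?_⟩
    · have h1 : (0 : ℝ) ≤ ⌊y⌋ := by exact_mod_cast Int.floor_nonneg.2 h
      nlinarith [Int.floor_le y]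
    · nlinarith [Int.floor_le y, Int.lt_floor_add_one y]
  · refine ⟨⌈y⌉, ?_, ?_⟩
    · have h1 : (⌈y⌉ : ℝ) ≤ 0 := by exact_mod_cast Int.ceil_nonpos.2 h
      nlinarith [Int.le_ceil y]
    · nlinarith [Int.le_ceil y, Int.ceil_lt_add_one y]

/-- Round `4 * √n * x` coordinatewise: an error of at most 1 in each of `n` coordinates becomes `√n
/ (4 * √n) = 1 / 4` after rescaling. -/
lemma exists_int_approx {n : ℕ} (hn : 1 ≤ n) (x : Fin n → ℝ) (hx : vecNorm x ≤ 1) :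
    ∃ m : Fin n → ℤ, ∑ i, (m i : ℝ) ^ 2 ≤ 16 * n ∧
      vecNorm (fun i => x i - m i / (4 * √n)) ≤ 1 / 4 := by
  have hn' : (0 : ℝ) < n := by exact_mod_cast hn
  have hs : 0 < √(n : ℝ) := Real.sqrt_pos.2 hn'
  have hss : √(n : ℝ) ^ 2 = n := Real.sq_sqrt hn'.le
  choose m h1 h2 using fun i => exists_int_trunc (4 * √n * x i)
  have hx2 : ∑ i, x i ^ 2 ≤ 1 := by
    rw [← vecNorm_sq]; nlinarith [vecNorm_nonneg x]
  refine ⟨m, ?_, ?_⟩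
  · calc ∑ i, (m i : ℝ) ^ 2 ≤ ∑ i, (4 * √n * x i) ^ 2 := Finset.sum_le_sum fun i _ => h1 i
      _ = 16 * n * ∑ i, x i ^ 2 := by
        rw [Finset.mul_sum]
        refine Finset.sum_congr rfl fun i _ => ?_
        rw [mul_pow, mul_pow, hss]; ring
      _ ≤ 16 * n * 1 := by gcongr
      _ = 16 * n := by ring
  · refine abs_le_of_sq_le_sq' ?_ (by norm_num) |>.2
    rw [vecNorm_sq]
    calc ∑ i, (x i - m i / (4 * √n)) ^ 2 = ∑ i, (4 * √n * x i - m i) ^ 2 * (1 / (16 * n)) := by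
          refine Finset.sum_congr rfl fun i _ => ?_
          rw [show (1 : ℝ) / (16 * n) = (1 / (4 * √n)) ^ 2 by rw [div_pow, mul_pow, hss]; norm_num,
            ← mul_pow]
          congr 1
          field_simp
      _ ≤ ∑ _i : Fin n, 1 * (1 / (16 * (n : ℝ))) :=
          Finset.sum_le_sum fun i _ => mul_le_mul_of_nonneg_right (h2 i) (by positivity)
      _ = (1 / 4) ^ 2 := by
          simp; field_simp; norm_num

/-- Integer vectors of squared length at most `16 n`. -/
noncomputable def intNet (n : ℕ) : Finset (Fin n → ℤ) :=
  (Fintype.piFinset fun _ => Finset.Icc (-(16 * n : ℤ)) (16 * n)).filter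
    fun m => ∑ i, m i ^ 2 ≤ 16 * n

lemma mem_intNet {n : ℕ} {m : Fin n → ℤ} : m ∈ intNet n ↔ ∑ i, (m i : ℝ) ^ 2 ≤ 16 * n := by
  have hcast : (∑ i, (m i : ℝ) ^ 2 ≤ 16 * n) ↔ ∑ i, m i ^ 2 ≤ 16 * n := by
    exact_mod_cast Iff.rfl
  rw [hcast, intNet, Finset.mem_filter, Fintype.mem_piFinset]
  refine ⟨fun h => h.2, fun h => ⟨fun i => ?_, h⟩⟩
  have h1 : m i ^ 2 ≤ ∑ i, m i ^ 2 :=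
    Finset.single_le_sum (f := fun i => m i ^ 2) (fun i _ => sq_nonneg _) (Finset.mem_univ i)
  rw [Finset.mem_Icc]
  constructor <;> nlinarith [sq_nonneg (m i - 1), sq_nonneg (m i + 1)]

/-- Replacing both unit vectors by points of the `1 / 4`-net costs `opNorm W / 4` each; half of the
norm is absorbed on the left, hence the factor 2. -/
lemma opNorm_le_of_intNet {n : ℕ} (hn : 1 ≤ n) (W : Matrix (Fin n) (Fin n) ℝ) {B : ℝ}
    (hB : 0 ≤ B) (h : ∀ m ∈ intNet n, ∀ l ∈ intNet n,
      ∑ i, ∑ j, (m i : ℝ) * l j * W i j ≤ 16 * n * B) : opNorm W ≤ 2 * B := by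
  have hn' : (0 : ℝ) < n := by exact_mod_cast hn
  have hs : 0 < √(n : ℝ) := Real.sqrt_pos.2 hn'
  have hss : √(n : ℝ) ^ 2 = n := Real.sq_sqrt hn'.le
  have hS := opNorm_nonneg W
  suffices opNorm W ≤ B + opNorm W / 2 by linarith
  refine opNorm_le_of_bilin W (by positivity) fun x y hx hy => ?_
  obtain ⟨m, hm, hxm⟩ := exists_int_approx hn x hx
  obtain ⟨l, hl, hyl⟩ := exists_int_approx hn y hy
  set x' : Fin n → ℝ := fun i => m i / (4 * √n) with hx'
  set y' : Fin n → ℝ := fun i => l i / (4 * √n) with hy'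
  have hx'1 : vecNorm x' ≤ 1 := by
    refine abs_le_of_sq_le_sq' ?_ (by norm_num) |>.2
    rw [vecNorm_sq]
    calc ∑ i, (m i / (4 * √n)) ^ 2 = (∑ i, (m i : ℝ) ^ 2) / (16 * n) := by
          rw [Finset.sum_div]
          refine Finset.sum_congr rfl fun i _ => ?_
          rw [div_pow, mul_pow, hss]; norm_num
      _ ≤ 1 ^ 2 := by rw [div_le_iff₀ (by positivity)]; linarith
  have e1 : ∑ i, ∑ j, x i * y j * W i j = ∑ i, ∑ j, x' i * y' j * W i j
      + ∑ i, ∑ j, (x i - x' i) * y j * W i j + ∑ i, ∑ j, x' i * (y j - y' j) * W i j := by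
    simp_rw [← Finset.sum_add_distrib]
    exact Finset.sum_congr rfl fun i _ => Finset.sum_congr rfl fun j _ => by ring
  have e2 : ∑ i, ∑ j, x' i * y' j * W i j ≤ B := by
    have h1 := h m (mem_intNet.2 hm) l (mem_intNet.2 hl)
    have : ∑ i, ∑ j, x' i * y' j * W i j = (∑ i, ∑ j, (m i : ℝ) * l j * W i j) / (16 * n) := by
      rw [Finset.sum_div]
      refine Finset.sum_congr rfl fun i _ => ?_
      rw [Finset.sum_div]
      refine Finset.sum_congr rfl fun j _ => ?_
      calc (m i : ℝ) / (4 * √n) * (l j / (4 * √n)) * W i j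
          = m i * l j * W i j / (16 * √n ^ 2) := by field_simp; ring
        _ = m i * l j * W i j / (16 * n) := by rw [hss]
    rw [this, div_le_iff₀ (by positivity)]
    linarith
  have e3 := (le_abs_self _).trans (bilin_le_opNorm W (fun i => x i - x' i) y)
  have e4 := (le_abs_self _).trans (bilin_le_opNorm W x' (fun i => y i - y' i))
  have e5 : vecNorm (fun i => x i - x' i) * vecNorm y ≤ 1 / 4 * 1 :=
    mul_le_mul hxm hy (vecNorm_nonneg _) (by norm_num)
  have e6 : vecNorm x' * vecNorm (fun i => y i - y' i) ≤ 1 * (1 / 4) :=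
    mul_le_mul hx'1 hyl (vecNorm_nonneg _) (by norm_num)
  have e7 := mul_le_mul_of_nonneg_left e5 hS
  have e8 := mul_le_mul_of_nonneg_left e6 hS
  rw [e1]
  linarith

/-- Only the bound 3 is needed. The subtracted remainder makes the induction close: a step adds `2 *
exp (-(N + 1) ^ 2) ≤ 2 * (1 / 2) ^ (N + 1)`. -/
lemma sum_Icc_exp_neg_sq_le (N : ℕ) :
    ∑ z ∈ Finset.Icc (-(N : ℤ)) N, Real.exp (-(z : ℝ) ^ 2) ≤ 3 - 2 * (1 / 2) ^ N := by
  induction N with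
  | zero => norm_num
  | succ N ih =>
    have hset : Finset.Icc (-((N + 1 : ℕ) : ℤ)) ((N + 1 : ℕ) : ℤ)
        = insert (-((N : ℤ) + 1)) (insert ((N : ℤ) + 1) (Finset.Icc (-(N : ℤ)) N)) := by
      ext z
      simp only [Finset.mem_insert, Finset.mem_Icc]
      push_cast
      omega
    have he : Real.exp (-((N : ℝ) + 1) ^ 2) ≤ (1 / 2) ^ (N + 1) := by
      have h1 : Real.exp (-((N : ℝ) + 1) ^ 2) ≤ Real.exp (-(1 : ℝ)) ^ (N + 1) := by
        rw [← Real.exp_nat_mul]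
        apply Real.exp_le_exp.2
        push_cast
        nlinarith [(Nat.cast_nonneg N : (0 : ℝ) ≤ N)]
      refine h1.trans (pow_le_pow_left₀ (Real.exp_pos _).le ?_ _)
      rw [Real.exp_neg, one_div]
      exact inv_anti₀ (by norm_num) (by linarith [Real.add_one_le_exp (1 : ℝ)])
    rw [hset, Finset.sum_insert, Finset.sum_insert]
    · push_cast
      rw [show (-((N : ℝ) + 1)) ^ 2 = ((N : ℝ) + 1) ^ 2 by ring]
      have : (1 / 2 : ℝ) ^ N = 2 * (1 / 2) ^ (N + 1) := by rw [pow_succ]; ring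
      linarith
    · simp
    · simp only [Finset.mem_insert, Finset.mem_Icc]
      omega

/-- Each net point has Gaussian weight `exp (16 n - ∑ m i ^ 2) ≥ 1`, and the sum of these weights
over a box factorises into one-dimensional sums. -/
lemma card_intNet_le (n : ℕ) : ((intNet n).card : ℝ) ≤ Real.exp (16 * n) * 3 ^ n := by
  have h1 : ((intNet n).card : ℝ) ≤
      ∑ m ∈ intNet n, Real.exp (16 * n) * ∏ i, Real.exp (-(m i : ℝ) ^ 2) := by
    rw [Finset.card_eq_sum_ones, Nat.cast_sum]
    refine Finset.sum_le_sum fun m hm => ?_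
    rw [← Real.exp_sum, ← Real.exp_add, Nat.cast_one]
    refine Real.one_le_exp ?_
    rw [Finset.sum_neg_distrib]
    linarith [mem_intNet.1 hm]
  refine h1.trans ?_
  rw [← Finset.mul_sum]
  refine mul_le_mul_of_nonneg_left ?_ (Real.exp_pos _).le
  refine (Finset.sum_le_sum_of_subset_of_nonneg (Finset.filter_subset _ _)
    fun m _ _ => Finset.prod_nonneg fun i _ => (Real.exp_pos _).le).trans ?_
  rw [← Finset.prod_univ_sum (fun _ : Fin n => Finset.Icc (-(16 * n : ℤ)) (16 * n))
    (fun _ z => Real.exp (-(z : ℝ) ^ 2)), Finset.prod_const, Finset.card_univ, Fintype.card_fin]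
  refine pow_le_pow_left₀ (Finset.sum_nonneg fun _ _ => (Real.exp_pos _).le) ?_ n
  have h := sum_Icc_exp_neg_sq_le (16 * n)
  push_cast at h
  have : (0 : ℝ) ≤ 2 * (1 / 2) ^ (16 * n) := by positivity
  linarith

/-! ### Operator norm of a centered sparse adjacency matrix -/

/-- Total weight of the entries of `M` between two dyadic level sets of integer vectors. -/
noncomputable def levelWeight {n : ℕ} (M : Matrix (Fin n) (Fin n) ℝ) (S T : Finset (Fin n)) : ℝ :=
  ∑ i ∈ S, ∑ j ∈ T, M i j

/-- Indices at which an integer vector has absolute value in `[2 ^ a, 2 ^ (a + 1))`. -/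
def levelSet {n : ℕ} (m : Fin n → ℤ) (a : ℕ) : Finset (Fin n) :=
  Finset.univ.filter fun i => m i ≠ 0 ∧ Nat.log 2 (m i).natAbs = a

lemma mem_levelSet {n : ℕ} {m : Fin n → ℤ} {a : ℕ} {i : Fin n} :
    i ∈ levelSet m a ↔ m i ≠ 0 ∧ Nat.log 2 (m i).natAbs = a := by
  simp [levelSet]

lemma two_pow_le_abs_of_mem {n : ℕ} {m : Fin n → ℤ} {a : ℕ} {i : Fin n} (h : i ∈ levelSet m a) :
    (2 : ℝ) ^ a ≤ |(m i : ℝ)| := by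
  obtain ⟨h0, h1⟩ := mem_levelSet.1 h
  have := Nat.pow_log_le_self 2 (Int.natAbs_ne_zero.2 h0)
  rw [h1] at this
  rw [← Int.cast_abs, Int.abs_eq_natAbs]
  exact_mod_cast this

lemma abs_lt_two_pow_of_mem {n : ℕ} {m : Fin n → ℤ} {a : ℕ} {i : Fin n} (h : i ∈ levelSet m a) :
    |(m i : ℝ)| ≤ 2 * 2 ^ a := by
  obtain ⟨h0, h1⟩ := mem_levelSet.1 h
  have := (Nat.lt_pow_succ_log_self (b := 2) (by norm_num) (m i).natAbs).le
  rw [h1, pow_succ] at this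
  rw [← Int.cast_abs, Int.abs_eq_natAbs, mul_comm]
  exact_mod_cast this

lemma mem_scales_of_mem_levelSet {n : ℕ} {m : Fin n → ℤ} (hm : m ∈ intNet n) {a : ℕ} {i : Fin n}
    (h : i ∈ levelSet m a) : a ∈ scales (16 * n) := by
  have h1 := two_pow_le_abs_of_mem h
  have h2 : (m i : ℝ) ^ 2 ≤ 16 * n :=
    (Finset.single_le_sum (f := fun i => (m i : ℝ) ^ 2) (fun i _ => sq_nonneg _)
      (Finset.mem_univ i)).trans (mem_intNet.1 hm)
  rw [mem_scales]
  have h3 : (4 : ℝ) ^ a ≤ 16 * n := by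
    rw [← two_pow_sq]
    refine le_trans ?_ h2
    rw [← sq_abs (m i : ℝ)]
    exact pow_le_pow_left₀ (by positivity) h1 2
  exact_mod_cast h3

/-- An index lies in at most one level set, and there `4 ^ a ≤ m i ^ 2`. -/
lemma sum_card_levelSet_le {n : ℕ} {m : Fin n → ℤ} (hm : m ∈ intNet n) :
    ∑ a ∈ scales (16 * n), 4 ^ a * ((levelSet m a).card : ℝ) ≤ 16 * n := by
  refine le_trans ?_ (mem_intNet.1 hm)
  have h1 : ∀ a ∈ scales (16 * n), 4 ^ a * ((levelSet m a).card : ℝ) ≤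
      ∑ i, if i ∈ levelSet m a then (m i : ℝ) ^ 2 else 0 := by
    intro a _
    rw [← Finset.sum_filter, Finset.filter_mem_eq_inter, Finset.univ_inter, mul_comm,
      ← nsmul_eq_mul]
    refine Finset.card_nsmul_le_sum _ _ _ fun i hi => ?_
    rw [← two_pow_sq, ← sq_abs (m i : ℝ)]
    exact pow_le_pow_left₀ (by positivity) (two_pow_le_abs_of_mem hi) 2
  refine (Finset.sum_le_sum h1).trans ?_
  rw [Finset.sum_comm]
  refine Finset.sum_le_sum fun i _ => ?_
  have h2 : ∀ a, (if i ∈ levelSet m a then (m i : ℝ) ^ 2 else 0) ≤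
      if Nat.log 2 (m i).natAbs = a then (m i : ℝ) ^ 2 else 0 := by
    intro a
    by_cases h : i ∈ levelSet m a
    · rw [if_pos h, if_pos (mem_levelSet.1 h).2]
    · rw [if_neg h]; split_ifs <;> positivity
  refine (Finset.sum_le_sum fun a _ => h2 a).trans ?_
  rw [Finset.sum_ite_eq]
  split_ifs
  · exact le_rfl
  · positivity

/-- On a pair of level sets the product `|m i * l j|` is at most `4 * (2 ^ a * 2 ^ b)`. Hence a
heavy entry lies on a pair of scales with `r < 2 ^ a * 2 ^ b`, and `sum_scales_heavy_le` applies to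
the weights between level sets, with a loss of 4. -/
lemma heavy_sum_le {n : ℕ} (hn : 1 ≤ n) {r D : ℝ} (hr : 0 < r) (hD : 0 ≤ D)
    (M : Matrix (Fin n) (Fin n) ℝ) (hM : ∀ i j, 0 ≤ M i j) (hrow : ∀ i, ∑ j, M i j ≤ D)
    (hcol : ∀ j, ∑ i, M i j ≤ D)
    (hdisc : ∀ a ∈ scales (16 * n), ∀ b ∈ scales (16 * n), r < 2 ^ a * 2 ^ b →
      ∀ S T : Finset (Fin n),
      levelWeight M S T * ((1 + Real.log (2 ^ a * 2 ^ b / r)) / 2) ≤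
        r ^ 2 / n * S.card * T.card * (Real.exp 1 * (2 ^ a * 2 ^ b / r)) / 2
        + scalePenalty n (2 ^ a) S.card + scalePenalty n (2 ^ b) T.card)
    {m l : Fin n → ℤ} (hm : m ∈ intNet n) (hl : l ∈ intNet n) :
    ∑ i, ∑ j, (if 16 * r < |(m i : ℝ) * l j| then |(m i : ℝ) * l j| * M i j else 0) ≤
      4 * (128 * n * (D / r) + 256 * Real.exp 1 * n * r + 13376 * n * r) := by
  have hmain := sum_scales_heavy_le hn hr hD (fun a => ((levelSet m a).card : ℝ))
    (fun b => ((levelSet l b).card : ℝ)) (fun a b => levelWeight M (levelSet m a) (levelSet l b))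
    (fun a => Nat.cast_nonneg _) (fun b => Nat.cast_nonneg _) (sum_card_levelSet_le hm)
    (sum_card_levelSet_le hl) ?_ ?_ (fun a ha b hb hab => hdisc a ha b hb hab _ _)
  rotate_left
  · intro a b
    rw [mul_comm, ← nsmul_eq_mul]
    refine Finset.sum_le_card_nsmul _ _ _ fun i _ => ?_
    exact (Finset.sum_le_sum_of_subset_of_nonneg (Finset.subset_univ _)
      fun j _ _ => hM i j).trans (hrow i)
  · intro a b
    have hswap : levelWeight M (levelSet m a) (levelSet l b)
        = ∑ j ∈ levelSet l b, ∑ i ∈ levelSet m a, M i j := Finset.sum_comm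
    rw [hswap, mul_comm, ← nsmul_eq_mul]
    refine Finset.sum_le_card_nsmul _ _ _ fun j _ => ?_
    exact (Finset.sum_le_sum_of_subset_of_nonneg (Finset.subset_univ _)
      fun i _ _ => hM i j).trans (hcol j)
  have hpt : ∀ i j, (if 16 * r < |(m i : ℝ) * l j| then |(m i : ℝ) * l j| * M i j else 0) ≤
      4 * ∑ a ∈ scales (16 * n), ∑ b ∈ scales (16 * n), (if r < 2 ^ a * 2 ^ b then
        2 ^ a * 2 ^ b * (if i ∈ levelSet m a then if j ∈ levelSet l b then M i j else 0 else 0)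
        else 0) := by
    intro i j
    have hnn : ∀ a b : ℕ, 0 ≤ (if r < 2 ^ a * 2 ^ b then
        2 ^ a * 2 ^ b * (if i ∈ levelSet m a then if j ∈ levelSet l b then M i j else 0 else 0)
        else 0) := by
      intro a b
      have := hM i j
      split_ifs <;> positivity
    split_ifs with h
    swap
    · exact mul_nonneg (by norm_num) (Finset.sum_nonneg fun a _ => Finset.sum_nonneg fun b _ => hnn a b)
    -- Level sets exclude zero coordinates, which the default `Nat.log 2 0 = 0` would otherwise put
    -- at level 0; a heavy entry has no zero factor.
    have hmi : m i ≠ 0 := by rintro h0; rw [h0] at h; simp at h; linarith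
    have hlj : l j ≠ 0 := by rintro h0; rw [h0] at h; simp at h; linarith
    have hia : i ∈ levelSet m (Nat.log 2 (m i).natAbs) := mem_levelSet.2 ⟨hmi, rfl⟩
    have hjb : j ∈ levelSet l (Nat.log 2 (l j).natAbs) := mem_levelSet.2 ⟨hlj, rfl⟩
    set a := Nat.log 2 (m i).natAbs
    set b := Nat.log 2 (l j).natAbs
    have hprod : |(m i : ℝ) * l j| ≤ 4 * (2 ^ a * 2 ^ b) := by
      rw [abs_mul]
      have := mul_le_mul (abs_lt_two_pow_of_mem hia) (abs_lt_two_pow_of_mem hjb) (abs_nonneg _)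
        (by positivity)
      linarith
    have hab : r < 2 ^ a * 2 ^ b := by linarith
    have h1 := Finset.single_le_sum (f := fun b => (if r < 2 ^ a * 2 ^ b then
        2 ^ a * 2 ^ b * (if i ∈ levelSet m a then if j ∈ levelSet l b then M i j else 0 else 0)
        else 0)) (fun b _ => hnn a b) (mem_scales_of_mem_levelSet hl hjb)
    have h2 := Finset.single_le_sum (f := fun a => ∑ b ∈ scales (16 * n), (if r < 2 ^ a * 2 ^ b then
        2 ^ a * 2 ^ b * (if i ∈ levelSet m a then if j ∈ levelSet l b then M i j else 0 else 0)
        else 0)) (fun a _ => Finset.sum_nonneg fun b _ => hnn a b)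
        (mem_scales_of_mem_levelSet hm hia)
    simp only [hab, hia, hjb, if_true] at h1 h2
    have h3 := mul_le_mul_of_nonneg_right hprod (hM i j)
    linarith
  refine (Finset.sum_le_sum fun i _ => Finset.sum_le_sum fun j _ => hpt i j).trans ?_
  simp_rw [← Finset.mul_sum]
  refine mul_le_mul_of_nonneg_left (le_trans (le_of_eq ?_) hmain) (by norm_num)
  have e : ∀ i, ∑ j, ∑ a ∈ scales (16 * n), ∑ b ∈ scales (16 * n), (if r < 2 ^ a * 2 ^ b then
        2 ^ a * 2 ^ b * (if i ∈ levelSet m a then if j ∈ levelSet l b then M i j else 0 else 0)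
        else 0) = ∑ a ∈ scales (16 * n), ∑ b ∈ scales (16 * n), (if r < 2 ^ a * 2 ^ b then
        2 ^ a * 2 ^ b * (if i ∈ levelSet m a then ∑ j ∈ levelSet l b, M i j else 0)
        else 0) := by
    intro i
    rw [Finset.sum_comm]
    refine Finset.sum_congr rfl fun a _ => ?_
    rw [Finset.sum_comm]
    refine Finset.sum_congr rfl fun b _ => ?_
    split_ifs
    · rw [← Finset.mul_sum, ← Finset.sum_filter, Finset.filter_mem_eq_inter, Finset.univ_inter]
    all_goals simp
  simp_rw [e]
  rw [Finset.sum_comm]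
  refine Finset.sum_congr rfl fun a _ => ?_
  rw [Finset.sum_comm]
  refine Finset.sum_congr rfl fun b _ => ?_
  split_ifs
  · rw [← Finset.mul_sum, ← Finset.sum_filter, Finset.filter_mem_eq_inter, Finset.univ_inter]
    rfl
  · simp

/-- Truncation of `m lᵀ` to its light entries. -/
noncomputable def lightPart {n : ℕ} (r : ℝ) (m l : Fin n → ℤ) (i j : Fin n) : ℝ :=
  if 16 * r < |(m i : ℝ) * l j| then 0 else (m i : ℝ) * l j

lemma sum_sq_mul_sq_le {n : ℕ} {m l : Fin n → ℤ} (hm : m ∈ intNet n) (hl : l ∈ intNet n) :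
    ∑ i, ∑ j, ((m i : ℝ) * l j) ^ 2 ≤ 256 * n ^ 2 := by
  have h1 := mem_intNet.1 hm
  have h2 := mem_intNet.1 hl
  have : ∑ i, ∑ j, ((m i : ℝ) * l j) ^ 2 = (∑ i, (m i : ℝ) ^ 2) * ∑ j, (l j : ℝ) ^ 2 := by
    rw [Finset.sum_mul_sum]
    exact Finset.sum_congr rfl fun i _ => Finset.sum_congr rfl fun j _ => by ring
  rw [this]
  calc _ ≤ (16 * (n : ℝ)) * (16 * n) := by
        gcongr
    _ = _ := by ring

/-- Deterministic part of the norm bound: light pairs, bounded degrees and discrepancy suffice. -/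
lemma opNorm_sub_le_of_discrepancy {n : ℕ} (hn : 1 ≤ n) {r : ℝ} (hr : 1 / 2 ≤ r)
    (M P : Matrix (Fin n) (Fin n) ℝ) (hM : ∀ i j, 0 ≤ M i j) (hMs : ∀ i j, M i j = M j i)
    (hM0 : ∀ i, M i i = 0) (hP0 : ∀ i j, 0 ≤ P i j) (hP1 : ∀ i, P i i ≤ 1)
    (hP : ∀ i j, i ≠ j → P i j ≤ r ^ 2 / n)
    (hlight : ∀ m ∈ intNet n, ∀ l ∈ intNet n, ∑ i, ∑ j, (if i = j then 0 else
      lightPart r m l i j / (32 * r) * (M i j - P i j)) ≤ 39 * n)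
    (hrow : ∀ i, ∑ j, M i j ≤ 9 * r ^ 2)
    (hdisc : ∀ a ∈ scales (16 * n), ∀ b ∈ scales (16 * n), r < 2 ^ a * 2 ^ b →
      ∀ S T : Finset (Fin n),
      levelWeight M S T * ((1 + Real.log (2 ^ a * 2 ^ b / r)) / 2) ≤
        r ^ 2 / n * S.card * T.card * (Real.exp 1 * (2 ^ a * 2 ^ b / r)) / 2
        + scalePenalty n (2 ^ a) S.card + scalePenalty n (2 ^ b) T.card) :
    opNorm (M - P) ≤ 8000 * r := by
  have hr0 : 0 < r := by linarith
  have hn' : (0 : ℝ) < n := by exact_mod_cast hn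
  -- The net loses a factor 2, so `64000 * n * r` is available for each pair of net points. In units
  -- of `n * r`, the light entries use 1248, the heavy entries of `M` fewer than 60900, the heavy
  -- entries of `P` 16, and the diagonal 32.
  rw [show 8000 * r = 2 * (4000 * r) by ring]
  refine opNorm_le_of_intNet hn _ (by positivity) fun m hm l hl => ?_
  have hcol : ∀ j, ∑ i, M i j ≤ 9 * r ^ 2 := fun j => by
    simp_rw [fun i => hMs i j]; exact hrow j
  have h1 := heavy_sum_le hn hr0 (by positivity) M hM hrow hcol hdisc hm hl
  have h2 := mul_le_mul_of_nonneg_left (hlight m hm l hl) (show 0 ≤ 32 * r by positivity)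
  have h3 := sum_sq_mul_sq_le hm hl
  have h4 := mem_intNet.1 hm
  have h5 := mem_intNet.1 hl
  have hpt : ∀ i j, (m i : ℝ) * l j * (M - P) i j ≤
      32 * r * (if i = j then 0 else lightPart r m l i j / (32 * r) * (M i j - P i j))
      + (if 16 * r < |(m i : ℝ) * l j| then |(m i : ℝ) * l j| * M i j else 0)
      + r / (16 * n) * ((m i : ℝ) * l j) ^ 2
      + if i = j then ((m i : ℝ) ^ 2 + (l i : ℝ) ^ 2) / 2 else 0 := by
    intro i j
    rw [Matrix.sub_apply]
    have hq : 0 ≤ r / (16 * n) * ((m i : ℝ) * l j) ^ 2 := by positivity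
    -- The diagonal of `P` is only known to be at most 1. Its contribution is a multiple of `n`
    -- without the factor `r`, absorbed at the end by `1 / 2 ≤ r`.
    by_cases hij : i = j
    · subst hij
      rw [if_pos rfl, if_pos rfl, hM0]
      have hp0 := hP0 i i
      have hp1 := hP1 i
      split_ifs <;> nlinarith [sq_nonneg ((m i : ℝ) + l i), sq_nonneg ((m i : ℝ) - l i),
        sq_nonneg (m i : ℝ), sq_nonneg (l i : ℝ)]
    · rw [if_neg hij, if_neg hij]
      have hp0 := hP0 i j
      have hp := hP i j hij
      have hm0 := hM i j
      by_cases hh : 16 * r < |(m i : ℝ) * l j|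
      · rw [if_pos hh, lightPart, if_pos hh]
        set x := (m i : ℝ) * l j
        have e1 : x * (M i j - P i j) ≤ |x| * M i j + |x| * P i j := by
          have := mul_le_mul_of_nonneg_right (le_abs_self x) hm0
          have := mul_le_mul_of_nonneg_right (neg_abs_le x) hp0
          linarith
        -- On a heavy entry `16 * r < |x|`, so the linear term is dominated by the quadratic one,
        -- whose sum the net controls.
        have e2 : |x| * P i j ≤ r / (16 * n) * x ^ 2 := by
          calc |x| * P i j ≤ |x| * (r ^ 2 / n) := by gcongr
            _ = r / (16 * n) * (|x| * (16 * r)) := by field_simp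
            _ ≤ r / (16 * n) * (|x| * |x|) := by gcongr
            _ = r / (16 * n) * x ^ 2 := by rw [abs_mul_abs_self, sq]
        rw [zero_div, zero_mul, mul_zero]
        linarith
      · rw [if_neg hh, lightPart, if_neg hh]
        have : 32 * r * ((m i : ℝ) * l j / (32 * r) * (M i j - P i j))
          = (m i : ℝ) * l j * (M i j - P i j) := by field_simp
        linarith
  refine (Finset.sum_le_sum fun i _ => Finset.sum_le_sum fun j _ => hpt i j).trans ?_
  simp only [Finset.sum_add_distrib, ← Finset.mul_sum, Finset.sum_ite_eq, Finset.mem_univ, if_true]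
  rw [← Finset.sum_div, Finset.sum_add_distrib]
  have h6 : r / (16 * n) * ∑ i, ∑ j, ((m i : ℝ) * l j) ^ 2 ≤ r / (16 * n) * (256 * n ^ 2) := by
    gcongr
  have h7 : r / (16 * n) * (256 * (n : ℝ) ^ 2) = 16 * n * r := by field_simp; norm_num
  have h8 : 128 * (n : ℝ) * (9 * r ^ 2 / r) = 1152 * n * r := by field_simp; norm_num
  rw [h8] at h1
  have h9 : Real.exp 1 * (n * r) ≤ 2.72 * (n * r) := by
    gcongr
    linarith [Real.exp_one_lt_d9]
  have h10 : (n : ℝ) * (1 / 2) ≤ n * r := by gcongr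
  linarith

lemma measureReal_exists_le {Ω ι : Type*} [MeasurableSpace Ω] (μ : Measure Ω) [IsFiniteMeasure μ]
    (s : Finset ι) (p : ι → Ω → Prop) :
    μ.real {ω | ∃ x ∈ s, p x ω} ≤ ∑ x ∈ s, μ.real {ω | p x ω} := by
  have : {ω | ∃ x ∈ s, p x ω} = ⋃ x ∈ s, {ω | p x ω} := by ext; simp
  rw [this]
  exact measureReal_biUnion_finset_le _ _

/-- This explains the form of the penalty. Summing `exp (-s * (1 + 4 * log u))` over all subsets
gives `(1 + exp (-1) / u ^ 4) ^ n ≤ exp (n / u ^ 4)`, which the second summand cancels. The third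
summand leaves `n ^ (-3)`. -/
lemma sum_exp_neg_scalePenalty_le {n : ℕ} (hn : 1 ≤ n) {u : ℝ} (hu : 1 ≤ u) :
    ∑ S : Finset (Fin n), Real.exp (-scalePenalty n u S.card) ≤ 1 / (n : ℝ) ^ 3 := by
  have hn' : (0 : ℝ) < n := by exact_mod_cast hn
  have hu0 : 0 < u := by linarith
  set x := Real.exp (-(1 + 4 * Real.log u)) with hx
  have hx1 : x ≤ 1 / u ^ 4 := by
    have : 1 / u ^ 4 = Real.exp (-(4 * Real.log u)) := by
      rw [Real.exp_neg, show 4 * Real.log u = Real.log (u ^ 4) by rw [Real.log_pow]; norm_num,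
        Real.exp_log (by positivity), one_div]
    rw [this]
    exact Real.exp_le_exp.2 (by linarith)
  have e1 : ∀ S : Finset (Fin n), Real.exp (-scalePenalty n u S.card)
      = x ^ S.card * 1 ^ (Fintype.card (Fin n) - S.card) * (Real.exp (-(n / u ^ 4)) / n ^ 3) := by
    intro S
    rw [one_pow, mul_one, hx, ← Real.exp_nat_mul]
    have : Real.exp (-(n / u ^ 4)) / (n : ℝ) ^ 3 = Real.exp (-(n / u ^ 4) - 3 * Real.log n) := by
      rw [Real.exp_sub, show 3 * Real.log n = Real.log ((n : ℝ) ^ 3) by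
        rw [Real.log_pow]; norm_num, Real.exp_log (by positivity)]
    rw [this, ← Real.exp_add, scalePenalty]
    congr 1; ring
  simp_rw [e1]
  rw [← Finset.sum_mul, Fintype.sum_pow_mul_eq_add_pow, Fintype.card_fin]
  have h2 : (x + 1) ^ n ≤ Real.exp (n / u ^ 4) := by
    calc (x + 1) ^ n ≤ Real.exp (1 / u ^ 4) ^ n := by
          refine pow_le_pow_left₀ (by positivity) ?_ n
          linarith [Real.add_one_le_exp (1 / u ^ 4)]
      _ = Real.exp (n / u ^ 4) := by rw [← Real.exp_nat_mul]; congr 1; ring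
  calc (x + 1) ^ n * (Real.exp (-(n / u ^ 4)) / (n : ℝ) ^ 3)
      ≤ Real.exp (n / u ^ 4) * (Real.exp (-(n / u ^ 4)) / (n : ℝ) ^ 3) := by gcongr
    _ = 1 / (n : ℝ) ^ 3 := by rw [← mul_div_assoc, ← Real.exp_add]; simp

lemma card_scales_le {n : ℕ} (hn : 2 ≤ n) : (scales (16 * n)).card ≤ 2 * n := by
  have : scales (16 * n) ⊆ Finset.range (n + 2) := by
    intro a ha
    rw [mem_scales] at ha
    rw [Finset.mem_range]
    by_contra h
    push Not at h
    have h1 : 4 ^ (n + 2) ≤ 16 * n := (Nat.pow_le_pow_right (by norm_num) h).trans ha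
    have h2 : n < 4 ^ n := Nat.lt_pow_self (by norm_num)
    rw [pow_add] at h1
    omega
  have h := Finset.card_le_card this
  rw [Finset.card_range] at h
  omega

/-! ### Tail bounds for light entries, degrees and discrepancy -/

section

variable {Ω : Type*} [MeasurableSpace Ω] {μ : Measure Ω} [IsProbabilityMeasure μ] {n : ℕ}
  {Θ : Matrix (Fin n) (Fin n) ℝ} {A : Ω → Matrix (Fin n) (Fin n) ℝ}

/-- Union bound over pairs of net points. Dividing the light part by `32 * r` makes the weights
admissible in `centered_tail`. The variance term is at most `n / 2`, the net has at most `exp (17.2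
* n)` points because `3 ≤ exp 1.2`, and `2 * 17.2 + 1 / 2 - 39 = -4.1`. -/
lemma IsNetwork.light_tail (hA : IsNetwork μ Θ A) (hΘ : ∀ i j, Θ i j = Θ j i) (hn : 2 ≤ n)
    {r : ℝ} (hr : 0 < r) (hp : ∀ i j, i ≠ j → Real.sigmoid (Θ i j) ≤ r ^ 2 / n) :
    μ.real {ω | ∃ x ∈ intNet n ×ˢ intNet n, 39 * (n : ℝ) ≤ ∑ i, ∑ j, (if i = j then 0 else
      lightPart r x.1 x.2 i j / (32 * r) * (A ω i j - Real.sigmoid (Θ i j)))} ≤ 1 / (8 * n) := by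
  have hn' : (0 : ℝ) < n := by positivity
  have hn2 : (2 : ℝ) ≤ n := by exact_mod_cast hn
  refine (measureReal_exists_le μ _ _).trans ?_
  have hB : ∀ (m l : Fin n → ℤ) i j, |lightPart r m l i j| ≤ 16 * r := by
    intro m l i j
    unfold lightPart
    split_ifs with h
    · simp; positivity
    · exact not_lt.1 h
  have h1 : ∀ x ∈ intNet n ×ˢ intNet n, μ.real {ω | 39 * (n : ℝ) ≤ ∑ i, ∑ j, (if i = j then 0 else
      lightPart r x.1 x.2 i j / (32 * r) * (A ω i j - Real.sigmoid (Θ i j)))} ≤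
      Real.exp (n / 2 - 39 * n) := by
    rintro ⟨m, l⟩ hx
    obtain ⟨hm, hl⟩ := Finset.mem_product.1 hx
    refine (hA.centered_tail hΘ (fun i j => lightPart r m l i j / (32 * r)) ?_ _).trans
      (Real.exp_le_exp.2 ?_)
    · intro i j
      rw [show 2 * (lightPart r m l i j / (32 * r)) = lightPart r m l i j / (16 * r) by
        field_simp; ring, abs_div, abs_of_pos (show 0 < 16 * r by positivity)]
      exact (div_le_one (by positivity)).2 (hB m l i j)
    · have h2 : ∑ i, ∑ j, (if i = j then 0 else
          Real.sigmoid (Θ i j) * (lightPart r m l i j / (32 * r)) ^ 2) ≤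
          1 / (1024 * n) * ∑ i, ∑ j, ((m i : ℝ) * l j) ^ 2 := by
        rw [Finset.mul_sum]
        refine Finset.sum_le_sum fun i _ => ?_
        rw [Finset.mul_sum]
        refine Finset.sum_le_sum fun j _ => ?_
        split_ifs with hij
        · positivity
        · have h3 : lightPart r m l i j ^ 2 ≤ ((m i : ℝ) * l j) ^ 2 := by
            unfold lightPart
            split_ifs
            · simp; positivity
            · exact le_rfl
          calc Real.sigmoid (Θ i j) * (lightPart r m l i j / (32 * r)) ^ 2
              ≤ r ^ 2 / n * (((m i : ℝ) * l j) ^ 2 / (32 * r) ^ 2) := by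
                rw [div_pow]
                gcongr
                exact hp i j hij
            _ = 1 / (1024 * n) * ((m i : ℝ) * l j) ^ 2 := by field_simp; norm_num
      have h4 : 1 / (1024 * n) * ∑ i, ∑ j, ((m i : ℝ) * l j) ^ 2 ≤
          1 / (1024 * n) * (256 * n ^ 2) := by
        gcongr
        exact sum_sq_mul_sq_le hm hl
      have h5 : 1 / (1024 * n) * (256 * (n : ℝ) ^ 2) = n / 4 := by field_simp; norm_num
      linarith
  refine (Finset.sum_le_sum h1).trans ?_
  rw [Finset.sum_const, nsmul_eq_mul, Finset.card_product, Nat.cast_mul]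
  have hc := card_intNet_le n
  have h3 : (3 : ℝ) ^ n ≤ Real.exp (1.2 * n) := by
    rw [mul_comm, Real.exp_nat_mul]
    refine pow_le_pow_left₀ (by norm_num) ?_ n
    rw [show (1.2 : ℝ) = 1 + 0.2 by norm_num, Real.exp_add]
    nlinarith [Real.exp_one_gt_d9, Real.add_one_le_exp (0.2 : ℝ)]
  have hc2 : ((intNet n).card : ℝ) ≤ Real.exp (17.2 * n) := by
    refine hc.trans ((mul_le_mul_of_nonneg_left h3 (Real.exp_pos _).le).trans (le_of_eq ?_))
    rw [← Real.exp_add]; congr 1; ring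
  calc ((intNet n).card : ℝ) * (intNet n).card * Real.exp (n / 2 - 39 * n)
      ≤ Real.exp (17.2 * n) * Real.exp (17.2 * n) * Real.exp (n / 2 - 39 * n) := by gcongr
    _ = Real.exp (-(4.1 * n)) := by rw [← Real.exp_add, ← Real.exp_add]; congr 1; ring
    _ ≤ 1 / (8 * n) := by
      rw [Real.exp_neg, one_div]
      refine inv_anti₀ (by positivity) ?_
      have := Real.quadratic_le_exp_of_nonneg (show 0 ≤ 4.1 * (n : ℝ) by positivity)
      nlinarith

/-- Chernoff with weight 1 on one row has exponent at most `6.4 / 2 * r ^ 2 - 9 * r ^ 2 ≤ -5 * log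
n`. The union over the rows leaves `n ^ (-4) ≤ 1 / (8 * n)`. -/
lemma IsNetwork.degree_tail (hA : IsNetwork μ Θ A) (hΘ : ∀ i j, Θ i j = Θ j i) (hn : 2 ≤ n)
    {r : ℝ} (hr : Real.log n ≤ r ^ 2) (hp : ∀ i j, i ≠ j → Real.sigmoid (Θ i j) ≤ r ^ 2 / n) :
    μ.real {ω | ∃ i ∈ (Finset.univ : Finset (Fin n)), 9 * r ^ 2 ≤ ∑ j, A ω i j} ≤
      1 / (8 * n) := by
  have hn' : (0 : ℝ) < n := by positivity
  have hn2 : (2 : ℝ) ≤ n := by exact_mod_cast hn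
  refine (measureReal_exists_le μ _ _).trans ?_
  have h1 : ∀ k ∈ (Finset.univ : Finset (Fin n)), μ.real {ω | 9 * r ^ 2 ≤ ∑ j, A ω k j} ≤
      1 / (n : ℝ) ^ 5 := by
    intro k _
    have h := hA.tail hΘ (fun i _ => if i = k then 1 else 0) (9 * r ^ 2)
    have e1 : ∀ ω, ∑ i, ∑ j, (if i = k then (1 : ℝ) else 0) * A ω i j = ∑ j, A ω k j := by
      intro ω
      simp_rw [← Finset.mul_sum, ite_mul, one_mul, zero_mul]
      rw [Finset.sum_ite_eq' Finset.univ k]; simp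
    simp_rw [e1] at h
    refine h.trans ?_
    have e2 : 1 / (n : ℝ) ^ 5 = Real.exp (-(5 * Real.log n)) := by
      rw [Real.exp_neg, show 5 * Real.log n = Real.log ((n : ℝ) ^ 5) by
        rw [Real.log_pow]; norm_num, Real.exp_log (by positivity), one_div]
    rw [e2]
    refine Real.exp_le_exp.2 ?_
    have hexp : Real.exp (2 * 1) - 1 ≤ 6.4 := by
      rw [show (2 : ℝ) * 1 = 1 + 1 by norm_num, Real.exp_add]
      nlinarith [Real.exp_one_lt_d9, Real.exp_one_gt_d9]
    have h2 : ∑ i, ∑ j, (if i = j then 0 else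
        Real.sigmoid (Θ i j) * (Real.exp (2 * if i = k then 1 else 0) - 1)) ≤
        ∑ i, ∑ _j : Fin n, if i = k then r ^ 2 / n * 6.4 else 0 := by
      refine Finset.sum_le_sum fun i _ => Finset.sum_le_sum fun j _ => ?_
      by_cases hij : i = j
      · rw [if_pos hij]; split_ifs <;> positivity
      · rw [if_neg hij]
        by_cases hik : i = k
        · rw [if_pos hik, if_pos hik]
          exact mul_le_mul (hp i j hij) hexp
            (by linarith [Real.add_one_le_exp ((2 : ℝ) * 1)]) (by positivity)
        · rw [if_neg hik, if_neg hik]; simp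
    have h3 : ∑ i, ∑ _j : Fin n, (if i = k then r ^ 2 / n * 6.4 else 0) = r ^ 2 * 6.4 := by
      simp only [Finset.sum_const, Finset.card_univ, Fintype.card_fin, nsmul_eq_mul]
      rw [← Finset.mul_sum, Finset.sum_ite_eq' Finset.univ k]
      simp only [Finset.mem_univ, if_true]
      field_simp
    linarith [sq_nonneg r]
  refine (Finset.sum_le_sum h1).trans ?_
  rw [Finset.sum_const, nsmul_eq_mul, Finset.card_univ, Fintype.card_fin]
  rw [mul_one_div, div_le_div_iff₀ (by positivity) (by positivity)]
  have h8 : (8 : ℝ) ≤ n ^ 3 := by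
    calc (8 : ℝ) = 2 ^ 3 := by norm_num
      _ ≤ n ^ 3 := by gcongr
  nlinarith [mul_le_mul_of_nonneg_left h8 (show (0 : ℝ) ≤ n ^ 2 by positivity)]

/-- Chernoff with the weight `L / 2` on `S × T`, where `L = 1 + log w` and `w = 2 ^ a * 2 ^ b / r`.
Since `exp L = exp 1 * w`, the moment term is at most the first summand of the threshold, and the
probability is at most the exponential of minus the two penalties. Summing over `S` and `T` gives `n
^ (-6)` for each of at most `(2 * n) ^ 2` pairs of scales. -/
lemma IsNetwork.discrepancy_tail (hA : IsNetwork μ Θ A) (hΘ : ∀ i j, Θ i j = Θ j i) (hn : 2 ≤ n)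
    {r : ℝ} (hr : 0 < r) (hp : ∀ i j, i ≠ j → Real.sigmoid (Θ i j) ≤ r ^ 2 / n) :
    μ.real {ω | ∃ x ∈ scales (16 * n) ×ˢ scales (16 * n),
      ∃ y ∈ (Finset.univ : Finset (Finset (Fin n) × Finset (Fin n))), r < 2 ^ x.1 * 2 ^ x.2 ∧
      r ^ 2 / n * y.1.card * y.2.card * (Real.exp 1 * (2 ^ x.1 * 2 ^ x.2 / r)) / 2
        + scalePenalty n (2 ^ x.1) y.1.card + scalePenalty n (2 ^ x.2) y.2.card ≤
      levelWeight (A ω) y.1 y.2 * ((1 + Real.log (2 ^ x.1 * 2 ^ x.2 / r)) / 2)} ≤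
      1 / (2 * n) := by
  have hn' : (0 : ℝ) < n := by positivity
  have hn2 : (2 : ℝ) ≤ n := by exact_mod_cast hn
  refine (measureReal_exists_le μ _ _).trans ?_
  have h1 : ∀ x ∈ scales (16 * n) ×ˢ scales (16 * n),
      μ.real {ω | ∃ y ∈ (Finset.univ : Finset (Finset (Fin n) × Finset (Fin n))),
      r < 2 ^ x.1 * 2 ^ x.2 ∧
      r ^ 2 / n * y.1.card * y.2.card * (Real.exp 1 * (2 ^ x.1 * 2 ^ x.2 / r)) / 2
        + scalePenalty n (2 ^ x.1) y.1.card + scalePenalty n (2 ^ x.2) y.2.card ≤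
      levelWeight (A ω) y.1 y.2 * ((1 + Real.log (2 ^ x.1 * 2 ^ x.2 / r)) / 2)} ≤
      1 / (n : ℝ) ^ 6 := by
    rintro ⟨a, b⟩ -
    refine (measureReal_exists_le μ _ _).trans ?_
    have h2 : ∀ y ∈ (Finset.univ : Finset (Finset (Fin n) × Finset (Fin n))),
        μ.real {ω | r < 2 ^ a * 2 ^ b ∧
        r ^ 2 / n * y.1.card * y.2.card * (Real.exp 1 * (2 ^ a * 2 ^ b / r)) / 2
        + scalePenalty n (2 ^ a) y.1.card + scalePenalty n (2 ^ b) y.2.card ≤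
        levelWeight (A ω) y.1 y.2 * ((1 + Real.log (2 ^ a * 2 ^ b / r)) / 2)} ≤
        Real.exp (-scalePenalty n (2 ^ a) y.1.card) *
          Real.exp (-scalePenalty n (2 ^ b) y.2.card) := by
      rintro ⟨S, T⟩ -
      by_cases hab : r < 2 ^ a * 2 ^ b
      swap
      · simp only [hab, false_and, Set.ofPred_false, measureReal_empty]
        positivity
      set w : ℝ := 2 ^ a * 2 ^ b / r with hw
      have hw1 : 1 < w := (one_lt_div hr).2 hab
      have hw0 : 0 < w := by linarith
      set L := 1 + Real.log w with hL
      have hexpL : Real.exp L = Real.exp 1 * w := by rw [hL, Real.exp_add, Real.exp_log hw0]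
      have h := hA.tail hΘ (fun i j => if i ∈ S then if j ∈ T then L / 2 else 0 else 0)
        (r ^ 2 / n * S.card * T.card * (Real.exp 1 * w) / 2
        + scalePenalty n (2 ^ a) S.card + scalePenalty n (2 ^ b) T.card)
      have e1 : ∀ ω, ∑ i, ∑ j, (if i ∈ S then if j ∈ T then L / 2 else 0 else 0) * A ω i j
          = levelWeight (A ω) S T * (L / 2) := by
        intro ω
        simp_rw [levelWeight, Finset.sum_mul, ite_mul, zero_mul, mul_comm (A ω _ _)]
        rw [← Finset.sum_subset (Finset.subset_univ S)]
        · refine Finset.sum_congr rfl fun i hi => ?_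
          simp only [hi, if_true]
          rw [← Finset.sum_filter, Finset.filter_mem_eq_inter, Finset.univ_inter]
        · intro i _ hi; simp [hi]
      simp_rw [e1] at h
      simp only [hab, true_and]
      refine h.trans ?_
      rw [← Real.exp_add]
      refine Real.exp_le_exp.2 ?_
      have h3 : ∑ i, ∑ j, (if i = j then 0 else Real.sigmoid (Θ i j) *
          (Real.exp (2 * if i ∈ S then if j ∈ T then L / 2 else 0 else 0) - 1)) ≤
          ∑ i, ∑ j, if i ∈ S then if j ∈ T then r ^ 2 / n * (Real.exp 1 * w) else 0 else 0 := by
        refine Finset.sum_le_sum fun i _ => Finset.sum_le_sum fun j _ => ?_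
        by_cases hij : i = j
        · rw [if_pos hij]; split_ifs <;> positivity
        · rw [if_neg hij]
          split_ifs
          · rw [show 2 * (L / 2) = L by ring, hexpL]
            exact mul_le_mul (hp i j hij) (by linarith)
              (by nlinarith [Real.add_one_le_exp (1 : ℝ)]) (by positivity)
          · simp
          · simp
      have h4 : ∑ i, ∑ j, (if i ∈ S then if j ∈ T then r ^ 2 / n * (Real.exp 1 * w) else 0 else 0)
          = r ^ 2 / n * S.card * T.card * (Real.exp 1 * w) := by
        rw [← Finset.sum_subset (Finset.subset_univ S)]
        · rw [Finset.sum_congr rfl (g := fun _ => (T.card : ℝ) * (r ^ 2 / n * (Real.exp 1 * w)))]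
          · rw [Finset.sum_const, nsmul_eq_mul]; ring
          · intro i hi
            simp only [hi, if_true]
            rw [← Finset.sum_filter, Finset.filter_mem_eq_inter, Finset.univ_inter,
              Finset.sum_const, nsmul_eq_mul]
        · intro i _ hi; simp [hi]
      linarith
    refine (Finset.sum_le_sum h2).trans ?_
    rw [Fintype.sum_prod_type]
    simp only
    simp_rw [← Finset.mul_sum]
    rw [← Finset.sum_mul]
    have hu : ∀ c : ℕ, (1 : ℝ) ≤ 2 ^ c := fun c => one_le_pow₀ (by norm_num)
    have e6 : 1 / (n : ℝ) ^ 6 = 1 / (n : ℝ) ^ 3 * (1 / (n : ℝ) ^ 3) := by field_simp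
    rw [e6]
    exact mul_le_mul (sum_exp_neg_scalePenalty_le (by omega) (hu a))
      (sum_exp_neg_scalePenalty_le (by omega) (hu b))
      (Finset.sum_nonneg fun _ _ => (Real.exp_pos _).le) (by positivity)
  refine (Finset.sum_le_sum h1).trans ?_
  rw [Finset.sum_const, nsmul_eq_mul, Finset.card_product, Nat.cast_mul]
  have hc : ((scales (16 * n)).card : ℝ) ≤ 2 * n := by exact_mod_cast card_scales_le hn
  have h8 : (8 : ℝ) ≤ n ^ 3 := by
    calc (8 : ℝ) = 2 ^ 3 := by norm_num
      _ ≤ n ^ 3 := by gcongr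
  calc ((scales (16 * n)).card : ℝ) * (scales (16 * n)).card * (1 / (n : ℝ) ^ 6)
      ≤ (2 * (n : ℝ)) * (2 * n) * (1 / (n : ℝ) ^ 6) := by gcongr
    _ = 4 / (n : ℝ) ^ 4 := by field_simp; norm_num
    _ ≤ 1 / (2 * (n : ℝ)) := by
      rw [div_le_div_iff₀ (by positivity) (by positivity)]
      nlinarith [mul_le_mul_of_nonneg_left h8 hn'.le]

/-- Norm of a centered sparse Bernoulli matrix: `‖A - P‖ ≲ √d` with probability `1 - O(1 / n)`,
where `d` dominates both the expected degrees and `log n`. -/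
theorem IsNetwork.opNorm_tail (hA : IsNetwork μ Θ A) (hΘ : ∀ i j, Θ i j = Θ j i) (hn : 2 ≤ n)
    {r : ℝ} (hr0 : 1 / 2 ≤ r) (hr : Real.log n ≤ r ^ 2)
    (hp : ∀ i j, i ≠ j → Real.sigmoid (Θ i j) ≤ r ^ 2 / n) :
    μ.real {ω | ¬ opNorm (A ω - Θ.map Real.sigmoid) ≤ 8000 * r} ≤ 3 / (4 * n) := by
  have hn' : (0 : ℝ) < n := by positivity
  have hr1 : 0 < r := by linarith
  have h1 := hA.light_tail hΘ hn hr1 hp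
  have h2 := hA.degree_tail hΘ hn hr hp
  have h3 := hA.discrepancy_tail hΘ hn hr1 hp
  refine (measureReal_mono (h₂ := by finiteness) ?_).trans ((measureReal_union_le _ _).trans
    (add_le_add ((measureReal_union_le _ _).trans (add_le_add h1 h2)) h3) |>.trans (le_of_eq ?_))
  swap
  · field_simp; norm_num
  intro ω hω
  by_contra hgood
  simp only [Set.mem_union, Set.mem_ofPred_eq, not_or] at hgood
  obtain ⟨⟨g1, g2⟩, g3⟩ := hgood
  push Not at g1 g2 g3
  refine hω (opNorm_sub_le_of_discrepancy (by omega) hr0 (A ω) _ ?_ (hA.symm ω) (hA.diag ω) ?_ ?_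
    ?_ ?_ ?_ ?_)
  · intro i j
    rcases hA.zero_or_one ω i j with h | h <;> simp [h]
  · intro i j; exact Real.sigmoid_nonneg _
  · intro i; exact Real.sigmoid_le_one _
  · exact hp
  · intro m hm l hl
    exact (g1 (m, l) (Finset.mem_product.2 ⟨hm, hl⟩)).le
  · intro i
    exact (g2 i (Finset.mem_univ i)).le
  · intro a ha b hb hab S T
    exact (g3 (a, b) (Finset.mem_product.2 ⟨ha, hb⟩) (S, T) (Finset.mem_univ _) hab).le

end

/-! ### Frobenius inner product -/

section Frobenius

variable {m n k : ℕ}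

lemma frobInner_eq_trace (M N : Matrix (Fin m) (Fin n) ℝ) :
    frobInner M N = (M.transpose * N).trace := by
  simp only [frobInner, Matrix.trace, Matrix.diag, Matrix.mul_apply, Matrix.transpose_apply]
  exact Finset.sum_comm

lemma frobInner_comm (M N : Matrix (Fin m) (Fin n) ℝ) : frobInner M N = frobInner N M := by
  simp only [frobInner, mul_comm]

lemma frobInner_add_right (M N N' : Matrix (Fin m) (Fin n) ℝ) :
    frobInner M (N + N') = frobInner M N + frobInner M N' := by
  simp only [frobInner, Matrix.add_apply, mul_add, Finset.sum_add_distrib]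

lemma frobInner_sub_right (M N N' : Matrix (Fin m) (Fin n) ℝ) :
    frobInner M (N - N') = frobInner M N - frobInner M N' := by
  simp only [frobInner, Matrix.sub_apply, mul_sub, Finset.sum_sub_distrib]

lemma frobInner_smul_right (c : ℝ) (M N : Matrix (Fin m) (Fin n) ℝ) :
    frobInner M (c • N) = c * frobInner M N := by
  simp only [frobInner, Matrix.smul_apply, smul_eq_mul, Finset.mul_sum]
  exact Finset.sum_congr rfl fun i _ => Finset.sum_congr rfl fun j _ => by ring

lemma frobInner_add_left (M M' N : Matrix (Fin m) (Fin n) ℝ) :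
    frobInner (M + M') N = frobInner M N + frobInner M' N := by
  rw [frobInner_comm, frobInner_add_right, frobInner_comm N, frobInner_comm N]

lemma frobInner_sub_left (M M' N : Matrix (Fin m) (Fin n) ℝ) :
    frobInner (M - M') N = frobInner M N - frobInner M' N := by
  rw [frobInner_comm, frobInner_sub_right, frobInner_comm N, frobInner_comm N]

lemma frobInner_smul_left (c : ℝ) (M N : Matrix (Fin m) (Fin n) ℝ) :
    frobInner (c • M) N = c * frobInner M N := by
  rw [frobInner_comm, frobInner_smul_right, frobInner_comm]

lemma frobInner_transpose (M N : Matrix (Fin m) (Fin n) ℝ) :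
    frobInner M.transpose N.transpose = frobInner M N := by
  simp only [frobInner, Matrix.transpose_apply]
  exact Finset.sum_comm

lemma frobInner_mul_left (M : Matrix (Fin m) (Fin n) ℝ) (B : Matrix (Fin m) (Fin k) ℝ)
    (N : Matrix (Fin k) (Fin n) ℝ) : frobInner M (B * N) = frobInner (B.transpose * M) N := by
  rw [frobInner_eq_trace, frobInner_eq_trace, Matrix.transpose_mul, Matrix.transpose_transpose,
    Matrix.mul_assoc]

lemma frobInner_mul_right (M : Matrix (Fin m) (Fin n) ℝ) (N : Matrix (Fin m) (Fin k) ℝ)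
    (B : Matrix (Fin k) (Fin n) ℝ) : frobInner M (N * B) = frobInner (M * B.transpose) N := by
  rw [← frobInner_transpose, Matrix.transpose_mul, frobInner_mul_left, ← frobInner_transpose]
  simp only [Matrix.transpose_mul, Matrix.transpose_transpose]

lemma frob_nonneg (M : Matrix (Fin m) (Fin n) ℝ) : 0 ≤ frob M := Real.sqrt_nonneg _

lemma frob_sq_eq_sum (M : Matrix (Fin m) (Fin n) ℝ) : frob M ^ 2 = ∑ i, ∑ j, M i j ^ 2 :=
  Real.sq_sqrt (Finset.sum_nonneg fun _ _ => Finset.sum_nonneg fun _ _ => sq_nonneg _)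

lemma frob_sq (M : Matrix (Fin m) (Fin n) ℝ) : frob M ^ 2 = frobInner M M := by
  rw [frob_sq_eq_sum]
  simp only [frobInner, sq]

lemma frob_transpose (M : Matrix (Fin m) (Fin n) ℝ) : frob M.transpose = frob M := by
  rw [← sq_eq_sq₀ (frob_nonneg _) (frob_nonneg _), frob_sq, frob_sq, frobInner_transpose]

lemma abs_frobInner_le (M N : Matrix (Fin m) (Fin n) ℝ) :
    |frobInner M N| ≤ frob M * frob N := by
  refine abs_le_of_sq_le_sq ?_ (mul_nonneg (frob_nonneg _) (frob_nonneg _))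
  rw [mul_pow, frob_sq_eq_sum, frob_sq_eq_sum, frobInner]
  simp only [← Fintype.sum_prod_type']
  exact Finset.sum_mul_sq_le_sq_mul_sq _ _ _

lemma frobInner_le (M N : Matrix (Fin m) (Fin n) ℝ) : frobInner M N ≤ frob M * frob N :=
  (le_abs_self _).trans (abs_frobInner_le M N)

lemma frob_add_sq (M N : Matrix (Fin m) (Fin n) ℝ) :
    frob (M + N) ^ 2 = frob M ^ 2 + 2 * frobInner M N + frob N ^ 2 := by
  simp only [frob_sq, frobInner_add_left, frobInner_add_right, frobInner_comm N M]
  ring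

lemma frob_sub_sq (M N : Matrix (Fin m) (Fin n) ℝ) :
    frob (M - N) ^ 2 = frob M ^ 2 - 2 * frobInner M N + frob N ^ 2 := by
  simp only [frob_sq, frobInner_sub_left, frobInner_sub_right, frobInner_comm N M]
  ring

lemma frob_add_le (M N : Matrix (Fin m) (Fin n) ℝ) : frob (M + N) ≤ frob M + frob N := by
  refine abs_le_of_sq_le_sq' ?_ (add_nonneg (frob_nonneg _) (frob_nonneg _)) |>.2
  rw [frob_add_sq]
  nlinarith [frobInner_le M N]

lemma frob_smul (c : ℝ) (M : Matrix (Fin m) (Fin n) ℝ) : frob (c • M) = |c| * frob M := by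
  rw [← sq_eq_sq₀ (frob_nonneg _) (mul_nonneg (abs_nonneg _) (frob_nonneg _)), mul_pow, sq_abs,
    frob_sq, frob_sq, frobInner_smul_left, frobInner_smul_right]
  ring

lemma frob_neg (M : Matrix (Fin m) (Fin n) ℝ) : frob (-M) = frob M := by
  rw [← neg_one_smul ℝ M, frob_smul]; simp

lemma frob_sub_comm (M N : Matrix (Fin m) (Fin n) ℝ) : frob (M - N) = frob (N - M) := by
  rw [← neg_sub, frob_neg]

lemma frob_sub_le (M N : Matrix (Fin m) (Fin n) ℝ) : frob (M - N) ≤ frob M + frob N := by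
  rw [sub_eq_add_neg, ← frob_neg N]; exact frob_add_le _ _

lemma frob_eq_zero {M : Matrix (Fin m) (Fin n) ℝ} (h : frob M = 0) : M = 0 := by
  have h1 : ∑ i, ∑ j, M i j ^ 2 = 0 := by rw [← frob_sq_eq_sum, h]; norm_num
  ext i j
  have h2 := (Finset.sum_eq_zero_iff_of_nonneg
    (fun i _ => Finset.sum_nonneg fun j _ => sq_nonneg (M i j))).1 h1 i (Finset.mem_univ i)
  have h3 := (Finset.sum_eq_zero_iff_of_nonneg
    (fun j _ => sq_nonneg (M i j))).1 h2 j (Finset.mem_univ j)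
  simpa using h3

lemma opNorm_transpose (M : Matrix (Fin m) (Fin n) ℝ) : opNorm M.transpose = opNorm M := by
  have := Matrix.l2_opNorm_conjTranspose M
  rwa [Matrix.conjTranspose_eq_transpose_of_trivial] at this

lemma frob_sq_eq_sum_col (M : Matrix (Fin m) (Fin n) ℝ) :
    frob M ^ 2 = ∑ j, vecNorm (fun i => M i j) ^ 2 := by
  simp only [frob_sq_eq_sum, vecNorm_sq]
  exact Finset.sum_comm

lemma trace_eq_frob_sq (M : Matrix (Fin m) (Fin n) ℝ) :
    (M.transpose * M).trace = frob M ^ 2 := by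
  rw [frob_sq, frobInner_eq_trace]

end Frobenius

/-! ### Projections onto subspaces spanned by orthonormal columns -/

section Projection

variable {n k : ℕ} {V : Matrix (Fin n) (Fin k) ℝ}

lemma frob_transpose_mul_le (hV : V.transpose * V = 1) {l : ℕ} (M : Matrix (Fin n) (Fin l) ℝ) :
    frob (V.transpose * M) ≤ frob M ∧
      frob (M - V * V.transpose * M) ^ 2 = frob M ^ 2 - frob (V.transpose * M) ^ 2 := by
  have h1 : frobInner M (V * V.transpose * M) = frob (V.transpose * M) ^ 2 := by
    rw [Matrix.mul_assoc, frobInner_mul_left, frob_sq]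
  have h2 : frob (V * V.transpose * M) ^ 2 = frob (V.transpose * M) ^ 2 := by
    rw [frob_sq, Matrix.mul_assoc, frobInner_mul_left, ← Matrix.mul_assoc, hV, Matrix.one_mul,
      frob_sq]
  have h3 : frob (M - V * V.transpose * M) ^ 2 = frob M ^ 2 - frob (V.transpose * M) ^ 2 := by
    rw [frob_sub_sq, h1, h2]; ring
  refine ⟨?_, h3⟩
  refine abs_le_of_sq_le_sq' ?_ (frob_nonneg _) |>.2
  nlinarith [sq_nonneg (frob (M - V * V.transpose * M))]

lemma vecNorm_col_eq_one (hV : V.transpose * V = 1) (a : Fin k) :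
    vecNorm (fun i => V i a) = 1 := by
  have h := congrFun (congrFun hV a) a
  rw [Matrix.mul_apply, Matrix.one_apply_eq] at h
  rw [vecNorm, Real.sqrt_eq_one, ← h]
  exact Finset.sum_congr rfl fun i _ => by rw [Matrix.transpose_apply, sq]

lemma frob_mul_le_opNorm (hV : V.transpose * V = 1) {l : ℕ} (W : Matrix (Fin l) (Fin n) ℝ) :
    frob (W * V) ≤ √k * opNorm W := by
  refine abs_le_of_sq_le_sq' ?_ (mul_nonneg (Real.sqrt_nonneg _) (opNorm_nonneg _)) |>.2
  rw [mul_pow, Real.sq_sqrt (Nat.cast_nonneg _), frob_sq_eq_sum_col]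
  have h : ∀ a : Fin k, vecNorm (fun i => (W * V) i a) ^ 2 ≤ opNorm W ^ 2 := by
    intro a
    refine pow_le_pow_left₀ (vecNorm_nonneg _) ?_ 2
    have := vecNorm_mulVec_le W (fun i => V i a)
    rwa [vecNorm_col_eq_one hV, mul_one] at this
  refine (Finset.sum_le_sum fun a _ => h a).trans ?_
  simp

/-- Duality at rank `k`: compressing `W` by `V` gives Frobenius norm at most `√k * opNorm W`, so
Cauchy–Schwarz replaces the nuclear norm of the projected matrix. -/
lemma abs_frobInner_proj_mul_le (hV : V.transpose * V = 1) (W M : Matrix (Fin n) (Fin n) ℝ) :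
    |frobInner W (V * V.transpose * M)| ≤ √k * opNorm W * frob M := by
  rw [Matrix.mul_assoc, frobInner_mul_left]
  refine (abs_frobInner_le _ _).trans ?_
  refine mul_le_mul ?_ (frob_transpose_mul_le hV M).1 (frob_nonneg _)
    (mul_nonneg (Real.sqrt_nonneg _) (opNorm_nonneg _))
  rw [← frob_transpose, Matrix.transpose_mul, Matrix.transpose_transpose, ← opNorm_transpose]
  exact frob_mul_le_opNorm hV _

lemma abs_frobInner_mul_proj_le (hV : V.transpose * V = 1) (W M : Matrix (Fin n) (Fin n) ℝ) :
    |frobInner W (M * (V * V.transpose))| ≤ √k * opNorm W * frob M := by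
  rw [← frobInner_transpose, Matrix.transpose_mul, Matrix.transpose_mul,
    Matrix.transpose_transpose, ← opNorm_transpose W, ← frob_transpose M]
  exact abs_frobInner_proj_mul_le hV _ _

/-- Trace duality for positive semidefinite matrices. -/
lemma abs_frobInner_le_of_posSemidef (W : Matrix (Fin n) (Fin n) ℝ)
    {H : Matrix (Fin n) (Fin n) ℝ} (hH : H.PosSemidef) :
    |frobInner W H| ≤ opNorm W * H.trace := by
  obtain ⟨m, B, rfl⟩ : ∃ (m : ℕ) (B : Matrix (Fin m) (Fin n) ℝ), H = B.transpose * B := by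
    obtain ⟨m, v, hv⟩ := Matrix.posSemidef_iff_eq_sum_vecMulVec.1 hH
    refine ⟨m, Matrix.of v, ?_⟩
    rw [hv]
    ext i j
    simp [Matrix.sum_apply, Matrix.mul_apply, Matrix.vecMulVec_apply]
  have h1 : frobInner W (B.transpose * B) = ∑ b, ∑ i, ∑ j, B b i * B b j * W i j := by
    simp only [frobInner, Matrix.mul_apply, Matrix.transpose_apply, Finset.mul_sum]
    rw [Finset.sum_comm' (t' := Finset.univ) (s' := fun _ => Finset.univ) (by simp)]
    rw [Finset.sum_comm]
    rw [show (∑ b, ∑ i, ∑ j, B b i * B b j * W i j) = ∑ i, ∑ j, ∑ b, B b i * B b j * W i j by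
      rw [Finset.sum_comm]
      exact Finset.sum_congr rfl fun i _ => Finset.sum_comm]
    exact Finset.sum_congr rfl fun i _ => Finset.sum_congr rfl fun j _ =>
      Finset.sum_congr rfl fun b _ => by ring
  rw [h1, trace_eq_frob_sq, ← frob_transpose, frob_sq_eq_sum_col, Finset.mul_sum]
  refine (Finset.abs_sum_le_sum_abs _ _).trans (Finset.sum_le_sum fun b _ => ?_)
  refine (bilin_le_opNorm W (B b) (B b)).trans (le_of_eq ?_)
  rw [← sq]
  rfl

lemma proj_idem (hV : V.transpose * V = 1) :
    V * V.transpose * (V * V.transpose) = V * V.transpose := by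
  rw [Matrix.mul_assoc, ← Matrix.mul_assoc V.transpose, hV, Matrix.one_mul]

lemma proj_transpose : (V * V.transpose).transpose = V * V.transpose := by
  rw [Matrix.transpose_mul, Matrix.transpose_transpose]

/-- Compression of a matrix to the orthogonal complement of the column space of `V`. -/
def compress (V : Matrix (Fin n) (Fin k) ℝ) (M : Matrix (Fin n) (Fin n) ℝ) :
    Matrix (Fin n) (Fin n) ℝ :=
  (1 - V * V.transpose) * M * (1 - V * V.transpose)

lemma compress_posSemidef {M : Matrix (Fin n) (Fin n) ℝ} (hM : M.PosSemidef) :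
    (compress V M).PosSemidef := by
  have h := hM.mul_mul_conjTranspose_same (1 - V * V.transpose)
  rwa [Matrix.conjTranspose_eq_transpose_of_trivial, Matrix.transpose_sub, Matrix.transpose_one,
    proj_transpose] at h

lemma compress_sub (M N : Matrix (Fin n) (Fin n) ℝ) :
    compress V (M - N) = compress V M - compress V N := by
  simp only [compress, Matrix.mul_sub, Matrix.sub_mul]
  abel

lemma eq_proj_add_compress (M : Matrix (Fin n) (Fin n) ℝ) :
    M = V * V.transpose * M + (M - V * V.transpose * M) * (V * V.transpose) + compress V M := by
  simp only [compress, Matrix.mul_sub, Matrix.sub_mul, Matrix.one_mul, Matrix.mul_one]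
  abel

/-- Nuclear-norm type control of `⟨W, M⟩` through the rank of a subspace and the trace of a
compression that is a difference of positive semidefinite matrices. -/
lemma abs_frobInner_sub_le (hV : V.transpose * V = 1) (W : Matrix (Fin n) (Fin n) ℝ)
    {M N : Matrix (Fin n) (Fin n) ℝ} (hM : M.PosSemidef) (hN : N.PosSemidef) :
    |frobInner W (M - N)| ≤ opNorm W *
      (2 * √k * frob (M - N) + (compress V M).trace + (compress V N).trace) := by
  have h0 := eq_proj_add_compress (V := V) (M - N)
  have h1 := abs_frobInner_proj_mul_le hV W (M - N)
  have h2 := abs_frobInner_mul_proj_le hV W ((M - N) - V * V.transpose * (M - N))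
  have h3 : frob ((M - N) - V * V.transpose * (M - N)) ≤ frob (M - N) := by
    refine abs_le_of_sq_le_sq' ?_ (frob_nonneg _) |>.2
    rw [(frob_transpose_mul_le hV _).2]
    linarith [sq_nonneg (frob (V.transpose * (M - N)))]
  have h4 := mul_le_mul_of_nonneg_left h3
    (mul_nonneg (Real.sqrt_nonneg (k : ℝ)) (opNorm_nonneg W))
  have h5 := abs_frobInner_le_of_posSemidef W (compress_posSemidef (V := V) hM)
  have h6 := abs_frobInner_le_of_posSemidef W (compress_posSemidef (V := V) hN)
  have h7 : frobInner W (M - N) = frobInner W (V * V.transpose * (M - N))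
      + frobInner W (((M - N) - V * V.transpose * (M - N)) * (V * V.transpose))
      + (frobInner W (compress V M) - frobInner W (compress V N)) := by
    conv_lhs => rw [h0]
    rw [frobInner_add_right, frobInner_add_right, compress_sub, frobInner_sub_right]
  rw [h7]
  rw [abs_le] at *
  constructor <;> nlinarith

/-- In the decomposition `eq_proj_add_compress` the middle term has trace zero, by cyclicity and
idempotence of the projection. -/
lemma trace_eq_proj_add_compress (hV : V.transpose * V = 1) (M : Matrix (Fin n) (Fin n) ℝ) :
    M.trace = (V * V.transpose * M).trace + (compress V M).trace := by
  conv_lhs => rw [eq_proj_add_compress (V := V) M]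
  rw [Matrix.trace_add, Matrix.trace_add, Matrix.trace_mul_comm (M - _), Matrix.mul_sub,
    ← Matrix.mul_assoc (V * V.transpose) (V * V.transpose), proj_idem hV, sub_self,
    Matrix.trace_zero, add_zero]

lemma opNorm_one_le : opNorm (1 : Matrix (Fin n) (Fin n) ℝ) ≤ 1 :=
  opNorm_le_of_mulVec _ zero_le_one fun y => by rw [Matrix.one_mulVec, one_mul]

lemma frobInner_one (M : Matrix (Fin n) (Fin n) ℝ) : frobInner 1 M = M.trace := by
  rw [frobInner_eq_trace, Matrix.transpose_one, Matrix.one_mul]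

lemma abs_trace_proj_mul_le (hV : V.transpose * V = 1) (M : Matrix (Fin n) (Fin n) ℝ) :
    |(V * V.transpose * M).trace| ≤ √k * frob M := by
  rw [← frobInner_one]
  refine (abs_frobInner_proj_mul_le hV _ _).trans ?_
  have := mul_le_mul_of_nonneg_left (opNorm_one_le (n := n)) (Real.sqrt_nonneg (k : ℝ))
  nlinarith [frob_nonneg M]

end Projection

/-! ### Orthonormal bases as matrices -/

section Basis

variable {n k : ℕ}

/-- The matrix whose columns are the vectors of an orthonormal basis. -/
noncomputable def basisMatrix (u : OrthonormalBasis (Fin n) ℝ (EuclideanSpace ℝ (Fin n))) :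
    Matrix (Fin n) (Fin n) ℝ := Matrix.of fun i a => u a i

lemma basisMatrix_transpose_mul (u : OrthonormalBasis (Fin n) ℝ (EuclideanSpace ℝ (Fin n))) :
    (basisMatrix u).transpose * basisMatrix u = 1 := by
  ext a b
  have h := (orthonormal_iff_ite.1 u.orthonormal) a b
  rw [PiLp.inner_apply] at h
  simp only [RCLike.inner_apply, conj_trivial] at h
  rw [Matrix.mul_apply, Matrix.one_apply, ← h]
  exact Finset.sum_congr rfl fun i _ => by simp [basisMatrix, mul_comm]

lemma basisMatrix_mul_transpose (u : OrthonormalBasis (Fin n) ℝ (EuclideanSpace ℝ (Fin n))) :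
    basisMatrix u * (basisMatrix u).transpose = 1 :=
  mul_eq_one_comm.1 (basisMatrix_transpose_mul u)

lemma vecNorm_mulVec_of_transpose_mul {U : Matrix (Fin n) (Fin k) ℝ} (hU : U.transpose * U = 1)
    (v : Fin k → ℝ) : vecNorm (U.mulVec v) = vecNorm v := by
  rw [← sq_eq_sq₀ (vecNorm_nonneg _) (vecNorm_nonneg _)]
  have h : ∀ (l : ℕ) (w : Fin l → ℝ), vecNorm w ^ 2 = w ⬝ᵥ w := by
    intro l w; rw [vecNorm_sq, dotProduct]; exact Finset.sum_congr rfl fun i _ => sq _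
  rw [h, h, Matrix.dotProduct_mulVec, ← Matrix.mulVec_transpose, Matrix.mulVec_mulVec, hU,
    Matrix.one_mulVec]

/-- Spectral data of a positive semidefinite matrix relative to its leading `k` eigenvectors. -/
structure TopData (k : ℕ) (G : Matrix (Fin n) (Fin n) ℝ) (Z V : Matrix (Fin n) (Fin k) ℝ)
    (e : Fin k → ℝ) : Prop where
  nonneg : ∀ a, 0 ≤ e a
  ortho : V.transpose * V = 1
  eigen : G * V = V * Matrix.diagonal e
  factor : Z * Z.transpose = V * Matrix.diagonal e * V.transpose
  gram : ∀ v, vecNorm (Z.mulVec v) ^ 2 = ∑ a, e a * v a ^ 2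
  kyFan : ∀ V' : Matrix (Fin n) (Fin k) ℝ, V'.transpose * V' = 1 →
    frob (G * V') ^ 2 ≤ frob (G * V) ^ 2
  opNorm_le : ∀ a, (∀ b, e b ≤ e a) → opNorm G ≤ e a

lemma frob_diagonal_mul_sq {l : ℕ} (d : Fin n → ℝ) (C : Matrix (Fin n) (Fin l) ℝ) :
    frob (Matrix.diagonal d * C) ^ 2 = ∑ i, d i ^ 2 * ∑ b, C i b ^ 2 := by
  rw [frob_sq_eq_sum]
  refine Finset.sum_congr rfl fun i _ => ?_
  rw [Finset.mul_sum]
  exact Finset.sum_congr rfl fun b _ => by rw [Matrix.diagonal_mul, mul_pow]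

lemma frob_mul_of_transpose_mul {l : ℕ} {U : Matrix (Fin n) (Fin k) ℝ} (hU : U.transpose * U = 1)
    (C : Matrix (Fin k) (Fin l) ℝ) : frob (U * C) = frob C := by
  rw [← sq_eq_sq₀ (frob_nonneg _) (frob_nonneg _), frob_sq, frobInner_mul_left, ← Matrix.mul_assoc,
    hU, Matrix.one_mul, frob_sq]

/-- The row sum is a diagonal entry `p` of the projection `C * C.transpose`; idempotence and
symmetry give `p ^ 2 ≤ p`. -/
lemma sum_row_sq_le_one {C : Matrix (Fin n) (Fin k) ℝ} (hC : C.transpose * C = 1) (i : Fin n) :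
    ∑ b, C i b ^ 2 ≤ 1 := by
  have h1 : (C * C.transpose) i i = ∑ b, C i b ^ 2 := by
    rw [Matrix.mul_apply]; exact Finset.sum_congr rfl fun b _ => by rw [Matrix.transpose_apply, sq]
  have h2 : (C * C.transpose) i i = ∑ j, (C * C.transpose) i j ^ 2 := by
    conv_lhs => rw [← proj_idem hC, Matrix.mul_apply]
    refine Finset.sum_congr rfl fun j _ => ?_
    have : (C * C.transpose) j i = (C * C.transpose) i j := congrFun (congrFun proj_transpose i) j
    rw [this, sq]
  have h3 : (C * C.transpose) i i ^ 2 ≤ (C * C.transpose) i i := by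
    conv_rhs => rw [h2]
    exact Finset.single_le_sum (f := fun j => (C * C.transpose) i j ^ 2)
      (fun j _ => sq_nonneg _) (Finset.mem_univ i)
  rw [← h1]
  nlinarith

/-- In the eigenbasis of `G` all fields reduce to statements about the eigenvalues, which are
nonnegative by semidefiniteness. Only the Ky Fan inequality needs an argument: `frob (G * V') ^ 2`
is an average of the `d i ^ 2` with weights in `[0, 1]` of total mass `k`, hence largest when the
weights sit on the top `k` indices. -/
lemma IsTopFactor.topData {G : Matrix (Fin n) (Fin n) ℝ} {Z : Matrix (Fin n) (Fin k) ℝ}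
    (hk : 1 ≤ k) (hG : G.PosSemidef) (h : IsTopFactor k G Z) :
    ∃ V e, TopData k G Z V e ∧ Antitone e := by
  obtain ⟨hkn, u, d, hd, heig, hZ⟩ := h
  set U := basisMatrix u with hU
  have hUU := basisMatrix_transpose_mul u
  have hUU' := basisMatrix_mul_transpose u
  have hGU : G * U = U * Matrix.diagonal d := by
    ext i a
    have h1 := congrArg (fun v : EuclideanSpace ℝ (Fin n) => v i) (heig a)
    simp only [Matrix.toLpLin_apply, PiLp.smul_apply, smul_eq_mul] at h1
    rw [Matrix.mul_diagonal, mul_comm]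
    exact h1
  have hGe : G = U * Matrix.diagonal d * U.transpose := by
    rw [← hGU, Matrix.mul_assoc, hUU', Matrix.mul_one]
  have hd0 : ∀ a, 0 ≤ d a := by
    have h1 : (U.transpose * G * U).PosSemidef := by
      have := hG.conjTranspose_mul_mul_same U
      rwa [Matrix.conjTranspose_eq_transpose_of_trivial] at this
    rw [Matrix.mul_assoc, hGU, ← Matrix.mul_assoc, hUU, Matrix.one_mul] at h1
    exact Matrix.posSemidef_diagonal_iff.1 h1
  set c := Fin.castLE hkn with hc
  set V : Matrix (Fin n) (Fin k) ℝ := U.submatrix id c with hV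
  have hZV : Z = V * Matrix.diagonal fun a => √(d (c a)) := by
    ext i a
    rw [Matrix.mul_diagonal, hZ, mul_comm]
    rfl
  have hVV : V.transpose * V = 1 := by
    have : V.transpose * V = (U.transpose * U).submatrix c c := by
      ext a b; simp [hV, Matrix.mul_apply]
    rw [this, hUU]
    exact Matrix.submatrix_one c (Fin.castLE_injective hkn)
  have hGV : G * V = V * Matrix.diagonal fun a => d (c a) := by
    ext i a
    have h1 := congrFun (congrFun hGU i) (c a)
    rw [Matrix.mul_diagonal] at h1 ⊢
    exact h1
  have hfrobGV : frob (G * V) ^ 2 = ∑ a, d (c a) ^ 2 := by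
    have h1 := frob_diagonal_mul_sq (fun a => d (c a)) (1 : Matrix (Fin k) (Fin k) ℝ)
    rw [Matrix.mul_one] at h1
    rw [hGV, frob_mul_of_transpose_mul hVV, h1]
    refine Finset.sum_congr rfl fun a _ => ?_
    rw [Finset.sum_eq_single a]
    · simp
    · intro b _ hb; simp [Matrix.one_apply_ne hb.symm]
    · simp
  refine ⟨V, fun a => d (c a), ⟨fun a => hd0 _, hVV, hGV, ?_, ?_, ?_, ?_⟩, fun a b hab => hd ?_⟩
  · rw [hZV, Matrix.transpose_mul, Matrix.diagonal_transpose, Matrix.mul_assoc,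
      ← Matrix.mul_assoc (Matrix.diagonal _), Matrix.diagonal_mul_diagonal, ← Matrix.mul_assoc]
    simp only [Real.mul_self_sqrt (hd0 _)]
  · intro v
    rw [hZV, ← Matrix.mulVec_mulVec, vecNorm_mulVec_of_transpose_mul hVV, vecNorm_sq]
    refine Finset.sum_congr rfl fun a _ => ?_
    rw [Matrix.mulVec_diagonal, mul_pow, Real.sq_sqrt (hd0 _)]
  · intro V' hV'
    rw [hfrobGV]
    set C := U.transpose * V' with hC
    have hCC : C.transpose * C = 1 := by
      rw [hC, Matrix.transpose_mul, Matrix.transpose_transpose, Matrix.mul_assoc,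
        ← Matrix.mul_assoc U, hUU', Matrix.one_mul, hV']
    have h1 : frob (G * V') ^ 2 = ∑ i, d i ^ 2 * ∑ b, C i b ^ 2 := by
      rw [← frob_diagonal_mul_sq, hGe, Matrix.mul_assoc, Matrix.mul_assoc,
        frob_mul_of_transpose_mul hUU]
    have hsum : ∑ i, ∑ b, C i b ^ 2 = k := by
      rw [← frob_sq_eq_sum, ← trace_eq_frob_sq, hCC, Matrix.trace_one, Fintype.card_fin]
    rw [h1]
    -- Subtracting the `k`-th largest value makes the terms with index below `k` nonnegative and the
    -- others nonpositive; the inequality then holds term by term.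
    set t := d (c ⟨k - 1, by omega⟩) ^ 2 with ht
    have h2 : ∑ i, d i ^ 2 * ∑ b, C i b ^ 2 = ∑ i, (d i ^ 2 - t) * ∑ b, C i b ^ 2 + t * k := by
      rw [← hsum, Finset.mul_sum, ← Finset.sum_add_distrib]
      exact Finset.sum_congr rfl fun i _ => by ring
    have h3 : ∑ a, d (c a) ^ 2 = ∑ i, (if i.1 < k then d i ^ 2 - t else 0) + t * k := by
      have h4 : ∑ i : Fin n, (if i.1 < k then d i ^ 2 - t else 0) = ∑ a, (d (c a) ^ 2 - t) := by
        rw [← Finset.sum_filter]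
        refine (Finset.sum_nbij' (fun a => c a) (fun i => ⟨min i.1 (k - 1), by omega⟩)
          ?_ ?_ ?_ ?_ ?_).symm
        · intro a _; simp [hc]
        · intro i _; simp
        · intro a _; ext; simp [hc]; omega
        · intro i hi
          have := (Finset.mem_filter.1 hi).2
          ext; simp [hc]; omega
        · intro a _; rfl
      rw [h4, Finset.sum_sub_distrib]
      simp [mul_comm]
    rw [h2, h3]
    refine add_le_add_left (Finset.sum_le_sum fun i _ => ?_) _
    have hq0 : 0 ≤ ∑ b, C i b ^ 2 := Finset.sum_nonneg fun _ _ => sq_nonneg _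
    have hq1 := sum_row_sq_le_one hCC i
    split_ifs with hi
    · have h5 : t ≤ d i ^ 2 := by
        refine pow_le_pow_left₀ (hd0 _) (hd ?_) 2
        rw [Fin.le_def]; simp [hc]; omega
      nlinarith
    · have h5 : d i ^ 2 ≤ t := by
        refine pow_le_pow_left₀ (hd0 _) (hd ?_) 2
        rw [Fin.le_def]; simp [hc]; omega
      nlinarith
  · intro a ha
    refine opNorm_le_of_mulVec G (hd0 _) fun v => ?_
    have hdi : ∀ i, d i ≤ d (c a) := fun i => by
      refine (hd (Fin.le_def.2 (Nat.zero_le i.1))).trans (b := d (c ⟨0, by omega⟩)) (ha _)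
    have h1 : vecNorm (G.mulVec v)
        = vecNorm ((Matrix.diagonal d).mulVec (U.transpose.mulVec v)) := by
      rw [hGe, Matrix.mul_assoc, ← Matrix.mulVec_mulVec, vecNorm_mulVec_of_transpose_mul hUU,
        Matrix.mulVec_mulVec]
    have h2 : vecNorm (U.transpose.mulVec v) = vecNorm v :=
      vecNorm_mulVec_of_transpose_mul (by rw [Matrix.transpose_transpose, hUU']) v
    rw [h1, ← h2]
    refine abs_le_of_sq_le_sq' ?_ (mul_nonneg (hd0 _) (vecNorm_nonneg _)) |>.2
    rw [mul_pow, vecNorm_sq, vecNorm_sq, Finset.mul_sum]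
    refine Finset.sum_le_sum fun i _ => ?_
    rw [Matrix.mulVec_diagonal, mul_pow]
    exact mul_le_mul_of_nonneg_right (pow_le_pow_left₀ (hd0 i) (hdi i) 2) (sq_nonneg _)
  · rw [Fin.le_def] at hab ⊢; simpa [hc] using hab

end Basis

namespace TopData

variable {n k : ℕ} {G : Matrix (Fin n) (Fin n) ℝ} {Z V : Matrix (Fin n) (Fin k) ℝ} {e : Fin k → ℝ}

lemma proj_mul (h : TopData k G Z V e) (hG : G.transpose = G) :
    V * V.transpose * G = Z * Z.transpose := by
  have h1 : V.transpose * G = Matrix.diagonal e * V.transpose := by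
    rw [← hG, ← Matrix.transpose_mul, h.eigen, Matrix.transpose_mul, Matrix.diagonal_transpose]
  rw [Matrix.mul_assoc, h1, ← Matrix.mul_assoc, h.factor]

lemma mul_proj (h : TopData k G Z V e) : G * (V * V.transpose) = Z * Z.transpose := by
  rw [← Matrix.mul_assoc, h.eigen, h.factor]

lemma factor_mul_proj (h : TopData k G Z V e) :
    Z * Z.transpose * (V * V.transpose) = Z * Z.transpose := by
  rw [h.factor, Matrix.mul_assoc, ← Matrix.mul_assoc V.transpose, h.ortho, Matrix.one_mul]

lemma compress_eq (h : TopData k G Z V e) (hG : G.transpose = G) :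
    compress V G = G - Z * Z.transpose := by
  rw [compress, Matrix.sub_mul, Matrix.one_mul, h.proj_mul hG, Matrix.mul_sub, Matrix.mul_one,
    Matrix.sub_mul, h.mul_proj, h.factor_mul_proj, sub_self, sub_zero]

/-- Eckart–Young: the top factor is at least as close as the top factor of another matrix. -/
lemma frob_sub_factor_le (h : TopData k G Z V e) (hG : G.transpose = G)
    {G' : Matrix (Fin n) (Fin n) ℝ} {Z' V' : Matrix (Fin n) (Fin k) ℝ} {e' : Fin k → ℝ}
    (h' : TopData k G' Z' V' e') :
    frob (G - Z * Z.transpose) ≤ frob (G - Z' * Z'.transpose) := by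
  refine abs_le_of_sq_le_sq' ?_ (frob_nonneg _) |>.2
  have e1 : frob (G - Z * Z.transpose) ^ 2 = frob G ^ 2 - frob (G * V) ^ 2 := by
    rw [← h.proj_mul hG, (frob_transpose_mul_le h.ortho G).2, ← frob_transpose (G * V),
      Matrix.transpose_mul, hG]
  set H := G - Z' * Z'.transpose with hH
  have hHt : H.transpose = H := by
    rw [hH, Matrix.transpose_sub, hG, Matrix.transpose_mul, Matrix.transpose_transpose]
  -- The competitor's range lies in that of `V'`, so projecting it away leaves only the projected
  -- `G`. The competitor's error is therefore at least the part of `G` orthogonal to `V'`, which Ky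
  -- Fan bounds below.
  have e2 : H - V' * V'.transpose * H = G - V' * V'.transpose * G := by
    have h1 : V' * V'.transpose * (Z' * Z'.transpose) = Z' * Z'.transpose := by
      rw [h'.factor, ← Matrix.mul_assoc, ← Matrix.mul_assoc, Matrix.mul_assoc V', h'.ortho,
        Matrix.mul_one]
    rw [hH, Matrix.mul_sub, h1]; abel
  have e3 := (frob_transpose_mul_le h'.ortho H).2
  rw [e2, (frob_transpose_mul_le h'.ortho G).2, ← frob_transpose (V'.transpose * G),
    Matrix.transpose_mul, Matrix.transpose_transpose, hG] at e3
  have e4 := h.kyFan V' h'.ortho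
  rw [e1]
  nlinarith [sq_nonneg (frob (V'.transpose * H))]

end TopData

/-! ### Singular values -/

section SingularValues

variable {n k : ℕ}

lemma singVal_sq_mul_le (hk : 1 ≤ k) (Z : Matrix (Fin n) (Fin k) ℝ) (v : Fin k → ℝ) :
    singVal Z (k - 1) ^ 2 * vecNorm v ^ 2 ≤ vecNorm (Z.mulVec v) ^ 2 := by
  set T := Matrix.toEuclideanLin Z with hT
  have hfin : Module.finrank ℝ (EuclideanSpace ℝ (Fin k)) = k := finrank_euclideanSpace_fin
  set S := T.isSymmetric_adjoint_comp_self
  set b := S.eigenvectorBasis hfin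
  set x : EuclideanSpace ℝ (Fin k) := WithLp.toLp 2 v
  have h1 : vecNorm (Z.mulVec v) ^ 2 = ∑ i, S.eigenvalues hfin i * (inner ℝ (b i) x) ^ 2 := by
    have e1 : vecNorm (Z.mulVec v) ^ 2 = inner ℝ x ((LinearMap.adjoint T ∘ₗ T) x) := by
      rw [LinearMap.comp_apply, LinearMap.adjoint_inner_right, real_inner_self_eq_norm_sq,
        vecNorm_eq_norm]
      rfl
    rw [e1, ← b.sum_inner_mul_inner]
    refine Finset.sum_congr rfl fun i _ => ?_
    have h2 : inner ℝ (b i) ((LinearMap.adjoint T ∘ₗ T) x) = S.eigenvalues hfin i * inner ℝ (b i) x := by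
      rw [← S (b i) x, S.apply_eigenvectorBasis hfin i]
      exact real_inner_smul_left _ _ _
    rw [h2, real_inner_comm (b i) x]; ring
  have h3 : vecNorm v ^ 2 = ∑ i, (inner ℝ (b i) x) ^ 2 := by
    rw [vecNorm_eq_norm, ← b.sum_sq_norm_inner_right]
    exact Finset.sum_congr rfl fun i _ => by rw [Real.norm_eq_abs, sq_abs]
  rw [h1, h3, Finset.mul_sum]
  refine Finset.sum_le_sum fun i _ => mul_le_mul_of_nonneg_right ?_ (sq_nonneg _)
  rw [← LinearMap.sq_singularValues_fin T hfin i]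
  refine pow_le_pow_left₀ (T.singularValues_nonneg _) (T.singularValues_antitone ?_) 2
  omega

/-- Evaluate the trace in the basis of right singular vectors: each diagonal term is at most the
length of the image, which is the singular value. -/
lemma trace_le_nuclearNorm (M : Matrix (Fin n) (Fin n) ℝ) : M.trace ≤ nuclearNorm M := by
  set T := Matrix.toEuclideanLin M with hT
  have hfin : Module.finrank ℝ (EuclideanSpace ℝ (Fin n)) = n := finrank_euclideanSpace_fin
  set S := T.isSymmetric_adjoint_comp_self
  set b := S.eigenvectorBasis hfin
  have h1 : M.trace = ∑ i, inner ℝ (b i) (T (b i)) := by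
    rw [← LinearMap.trace_eq_sum_inner, hT]
    rw [Matrix.toEuclideanLin_eq_toLin_orthonormal, Matrix.trace_toLin_eq]
  rw [h1, nuclearNorm, ← Fin.sum_univ_eq_sum_range (fun i => singVal M i) n]
  refine Finset.sum_le_sum fun i _ => ?_
  refine (real_inner_le_norm _ _).trans ?_
  rw [b.norm_eq_one, one_mul]
  refine abs_le_of_sq_le_sq' ?_ (T.singularValues_nonneg _) |>.2
  have h2 : ‖T (b i)‖ ^ 2 = S.eigenvalues hfin i := by
    rw [← real_inner_self_eq_norm_sq, ← LinearMap.adjoint_inner_right]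
    have := S.apply_eigenvectorBasis hfin i
    rw [LinearMap.comp_apply] at this
    rw [this, real_inner_smul_right, real_inner_self_eq_norm_sq, b.norm_eq_one]
    simp
  rw [h2]
  exact (LinearMap.sq_singularValues_fin T hfin i).ge

end SingularValues

/-! ### Procrustes distance -/

section Procrustes

variable {n k : ℕ}

lemma mem_orthogonalGroup_of_transpose_mul {R : Matrix (Fin k) (Fin k) ℝ}
    (h : R.transpose * R = 1) : R ∈ Matrix.orthogonalGroup (Fin k) ℝ := by
  rw [Matrix.mem_orthogonalGroup_iff]
  exact mul_eq_one_comm.1 h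

/-- Polar decomposition of a square real matrix. -/
lemma exists_polar (M : Matrix (Fin k) (Fin k) ℝ) :
    ∃ R : Matrix (Fin k) (Fin k) ℝ, R.transpose * R = 1 ∧ (R.transpose * M).PosSemidef := by
  have hH : (M.transpose * M).IsHermitian := by
    have := Matrix.isHermitian_conjTranspose_mul_self M
    rwa [Matrix.conjTranspose_eq_transpose_of_trivial] at this
  set v := hH.eigenvectorBasis
  set s := hH.eigenvalues
  set V := basisMatrix v
  have hVV := basisMatrix_transpose_mul v
  have hVV' := basisMatrix_mul_transpose v
  have hMV : M.transpose * M * V = V * Matrix.diagonal s := by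
    ext i a
    have h1 := congrFun (hH.mulVec_eigenvectorBasis a) i
    rw [Matrix.mul_diagonal, mul_comm]
    exact h1
  set N := M * V with hN
  have hNN : N.transpose * N = Matrix.diagonal s := by
    rw [hN, Matrix.transpose_mul, Matrix.mul_assoc, ← Matrix.mul_assoc M.transpose, hMV,
      ← Matrix.mul_assoc, hVV, Matrix.one_mul]
  have hNij : ∀ a b, ∑ i, N i a * N i b = if a = b then s a else 0 := by
    intro a b
    have := congrFun (congrFun hNN a) b
    rwa [Matrix.mul_apply, Matrix.diagonal_apply] at this
  have hs0 : ∀ a, 0 ≤ s a := by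
    intro a
    have h1 := hNij a a
    rw [if_pos rfl] at h1
    rw [← h1]
    exact Finset.sum_nonneg fun i _ => mul_self_nonneg _
  -- The columns of `N` are orthogonal with squared lengths `s`. Those with `s a ≠ 0` are normalised
  -- and completed to an orthonormal basis `B`; columns with `s a = 0` vanish, so the completion
  -- there is immaterial. The polar factor is `B * V.transpose`.
  set w : Fin k → EuclideanSpace ℝ (Fin k) :=
    fun a => WithLp.toLp 2 fun i => (√(s a))⁻¹ * N i a with hw
  have hworth : Orthonormal ℝ (Set.domRestrict {a | s a ≠ 0} w) := by
    rw [orthonormal_iff_ite]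
    rintro ⟨a, ha⟩ ⟨b, hb⟩
    have ha' : s a ≠ 0 := ha
    have h1 : inner ℝ (w a) (w b) = (√(s a))⁻¹ * (√(s b))⁻¹ * ∑ i, N i a * N i b := by
      rw [PiLp.inner_apply, Finset.mul_sum]
      refine Finset.sum_congr rfl fun i _ => ?_
      simp only [hw, RCLike.inner_apply, conj_trivial]; ring
    change inner ℝ (w a) (w b) = _
    simp only [h1, hNij, Subtype.mk.injEq]
    by_cases hab : a = b
    · subst hab
      rw [if_pos rfl, if_pos rfl, ← mul_inv, Real.mul_self_sqrt (hs0 a), inv_mul_cancel₀ ha']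
    · rw [if_neg hab, if_neg hab, mul_zero]
  obtain ⟨b, hb⟩ := hworth.exists_orthonormalBasis_extension_of_card_eq
    (by rw [finrank_euclideanSpace])
  set B := basisMatrix b
  have hBB := basisMatrix_transpose_mul b
  have hNB : N = B * Matrix.diagonal fun a => √(s a) := by
    ext i a
    rw [Matrix.mul_diagonal]
    by_cases ha : s a = 0
    · have h1 := hNij a a
      rw [if_pos rfl, ha] at h1
      have h2 := (Finset.sum_eq_zero_iff_of_nonneg (fun i _ => mul_self_nonneg (N i a))).1 h1 i
        (Finset.mem_univ i)
      rw [ha, Real.sqrt_zero, mul_zero]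
      simpa using h2
    · have h1 : b a i = (√(s a))⁻¹ * N i a := by rw [hb a ha]
      have h2 : √(s a) ≠ 0 := (Real.sqrt_pos.2 (lt_of_le_of_ne (hs0 a) (Ne.symm ha))).ne'
      change N i a = b a i * √(s a)
      rw [h1]; field_simp
  refine ⟨B * V.transpose, ?_, ?_⟩
  · rw [Matrix.transpose_mul, Matrix.transpose_transpose, Matrix.mul_assoc,
      ← Matrix.mul_assoc B.transpose, hBB, Matrix.one_mul, hVV']
  · have hM : M = B * (Matrix.diagonal fun a => √(s a)) * V.transpose := by
      rw [← hNB, hN, Matrix.mul_assoc, hVV', Matrix.mul_one]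
    have h1 : (B * V.transpose).transpose * M
        = V * (Matrix.diagonal fun a => √(s a)) * V.transpose := by
      rw [hM, Matrix.transpose_mul, Matrix.transpose_transpose, Matrix.mul_assoc,
        ← Matrix.mul_assoc B.transpose, ← Matrix.mul_assoc B.transpose, hBB, Matrix.one_mul,
        Matrix.mul_assoc]
    rw [h1, ← Matrix.conjTranspose_eq_transpose_of_trivial]
    exact (Matrix.posSemidef_diagonal_iff.2 fun a => Real.sqrt_nonneg _).mul_mul_conjTranspose_same V

lemma frobInner_mul_transpose (A B C F : Matrix (Fin n) (Fin k) ℝ) :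
    frobInner (A * B.transpose) (C * F.transpose)
      = frobInner (C.transpose * A) (F.transpose * B) := by
  rw [frobInner_mul_left, ← Matrix.mul_assoc, frobInner_comm, frobInner_mul_right,
    Matrix.transpose_transpose, frobInner_comm]

lemma procrustes_nonneg (Z₁ Z₂ : Matrix (Fin n) (Fin k) ℝ) : 0 ≤ procrustes Z₁ Z₂ :=
  Real.iInf_nonneg fun _ => frob_nonneg _

lemma procrustes_le (Z₁ Z₂ : Matrix (Fin n) (Fin k) ℝ) {R : Matrix (Fin k) (Fin k) ℝ}
    (h : R.transpose * R = 1) : procrustes Z₁ Z₂ ≤ frob (Z₁ - Z₂ * R) :=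
  ciInf_le (f := fun R : Matrix.orthogonalGroup (Fin k) ℝ =>
    frob (Z₁ - Z₂ * (R : Matrix (Fin k) (Fin k) ℝ)))
    ⟨0, by rintro _ ⟨R, rfl⟩; exact frob_nonneg _⟩ ⟨R, mem_orthogonalGroup_of_transpose_mul h⟩

/-- The Procrustes distance of factors is controlled by the distance of the Gram matrices. -/
lemma procrustes_sq_le (Z₁ Z₂ : Matrix (Fin n) (Fin k) ℝ) {σ : ℝ}
    (hσ : ∀ v, σ ^ 2 * vecNorm v ^ 2 ≤ vecNorm (Z₂.mulVec v) ^ 2) :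
    2 / 3 * σ ^ 2 * procrustes Z₁ Z₂ ^ 2 ≤
      frob (Z₁ * Z₁.transpose - Z₂ * Z₂.transpose) ^ 2 := by
  obtain ⟨R, hR, hK⟩ := exists_polar (Z₂.transpose * Z₁)
  have hR' : R * R.transpose = 1 := mul_eq_one_comm.1 hR
  set Z' := Z₂ * R with hZ'
  set D := Z₁ - Z' with hD
  set K := Z'.transpose * Z₁ with hKdef
  have hK' : K.PosSemidef := by
    rw [hKdef, hZ', Matrix.transpose_mul, Matrix.mul_assoc]; exact hK
  have hKt : K.transpose = K := by
    have := hK'.1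
    rwa [Matrix.IsHermitian, Matrix.conjTranspose_eq_transpose_of_trivial] at this
  set E := D.transpose * D with hE
  set S := Z'.transpose * Z' with hS
  set H := Z'.transpose * D with hH
  have hHKS : H = K - S := by rw [hH, hD, Matrix.mul_sub]
  have hHt : D.transpose * Z' = H := by
    have : D.transpose * Z' = H.transpose := by
      rw [hH, Matrix.transpose_mul, Matrix.transpose_transpose]
    rw [this, hHKS, Matrix.transpose_sub, hKt, hS, Matrix.transpose_mul, Matrix.transpose_transpose]
  have hZZ : Z₂ * Z₂.transpose = Z' * Z'.transpose := by
    rw [hZ', Matrix.transpose_mul, Matrix.mul_assoc, ← Matrix.mul_assoc R, hR', Matrix.one_mul]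
  have hdiff : Z₁ * Z₁.transpose - Z₂ * Z₂.transpose
      = Z' * D.transpose + D * Z'.transpose + D * D.transpose := by
    have h1 : Z₁ = Z' + D := by rw [hD]; abel
    rw [hZZ, h1, Matrix.transpose_add, Matrix.add_mul, Matrix.mul_add, Matrix.mul_add]
    abel
  have hexp : frob (Z₁ * Z₁.transpose - Z₂ * Z₂.transpose) ^ 2
      = 2 * frobInner S E + 2 * frobInner H H + 4 * frobInner H E + frobInner E E := by
    rw [hdiff, frob_sq]
    simp only [frobInner_add_left, frobInner_add_right, frobInner_mul_transpose, hHt]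
    rw [← hE, ← hS, ← hH, frobInner_comm E S, frobInner_comm E H]
    ring
  have hKE : 0 ≤ frobInner K E := by
    have h1 : frobInner K E = (D * K * D.transpose).trace := by
      rw [hE, frobInner_eq_trace, hKt, ← Matrix.mul_assoc, Matrix.trace_mul_comm,
        ← Matrix.mul_assoc]
    rw [h1, ← Matrix.conjTranspose_eq_transpose_of_trivial]
    exact (hK'.mul_mul_conjTranspose_same D).trace_nonneg
  have hSE : σ ^ 2 * frob D ^ 2 ≤ frobInner S E := by
    have h1 : frobInner S E = frob (Z' * D.transpose) ^ 2 := by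
      rw [frob_sq, frobInner_mul_transpose]
    rw [h1, ← frob_transpose D, frob_sq_eq_sum_col D.transpose,
      frob_sq_eq_sum_col (Z' * D.transpose), Finset.mul_sum]
    refine Finset.sum_le_sum fun i _ => ?_
    have h2 := hσ (R.mulVec fun a => D.transpose a i)
    rw [vecNorm_mulVec_of_transpose_mul hR, Matrix.mulVec_mulVec] at h2
    exact h2
  -- Subtracting `frob (E + c • H) ^ 2` from the expansion leaves `2 ⟨S,E⟩ + (2 - c ^ 2) ⟨H,H⟩ + (4
  -- - 2 * c) ⟨H,E⟩`. With `⟨H,E⟩ = ⟨K,E⟩ - ⟨S,E⟩` this is at least `(2 * c - 2) ⟨S,E⟩` for `1 ≤ c ≤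
  -- √2`; `c = 4 / 3` gives the constant `2 / 3`.
  have hsq : 0 ≤ frobInner (E + (4 / 3 : ℝ) • H) (E + (4 / 3 : ℝ) • H) := by
    rw [← frob_sq]; positivity
  simp only [frobInner_add_left, frobInner_add_right, frobInner_smul_left,
    frobInner_smul_right] at hsq
  rw [frobInner_comm E H] at hsq
  have hHH : 0 ≤ frobInner H H := by rw [← frob_sq]; positivity
  have hHE : frobInner H E = frobInner K E - frobInner S E := by rw [hHKS, frobInner_sub_left]
  have hle : procrustes Z₁ Z₂ ^ 2 ≤ frob D ^ 2 :=
    pow_le_pow_left₀ (procrustes_nonneg _ _) (procrustes_le _ _ hR) 2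
  have hle' := mul_le_mul_of_nonneg_left hle (sq_nonneg σ)
  rw [hexp]
  nlinarith

end Procrustes

/-! ### Monotonicity of the sigmoid function -/

lemma sigmoid_sub_le {x y : ℝ} (h : y ≤ x) : 4 * (Real.sigmoid x - Real.sigmoid y) ≤ x - y := by
  have hmono : Monotone fun x : ℝ => x - 4 * Real.sigmoid x := by
    refine monotone_of_deriv_nonneg
      (differentiable_id.sub (differentiable_sigmoid.const_mul 4)) fun x => ?_
    have h1 : HasDerivAt (fun x : ℝ => x - 4 * Real.sigmoid x)
        (1 - 4 * (Real.sigmoid x * (1 - Real.sigmoid x))) x :=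
      (hasDerivAt_id x).sub ((Real.hasDerivAt_sigmoid x).const_mul 4)
    rw [h1.deriv]
    nlinarith [sq_nonneg (1 - 2 * Real.sigmoid x)]
  have := hmono h
  simp only at this
  linarith

/-- Co-coercivity, from monotonicity together with the Lipschitz constant 1/4. It lets the cross
term of a gradient step pay for the squared gradient. -/
lemma four_mul_sq_sigmoid_sub_le (x y : ℝ) :
    4 * (Real.sigmoid x - Real.sigmoid y) ^ 2 ≤ (Real.sigmoid x - Real.sigmoid y) * (x - y) := by
  rcases le_total y x with h | h
  · have h1 := sigmoid_sub_le h
    have h2 := Real.sigmoid_le h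
    nlinarith
  · have h1 := sigmoid_sub_le h
    have h2 := Real.sigmoid_le h
    nlinarith

lemma sigmoid_mul_one_sub_ge {M x : ℝ} (hx : |x| ≤ M) :
    Real.exp (-M) / 4 ≤ Real.sigmoid x * (1 - Real.sigmoid x) := by
  rw [← Real.sigmoid_neg, Real.sigmoid_def, Real.sigmoid_def, neg_neg, ← mul_inv, Real.exp_neg M,
    div_eq_mul_inv, ← mul_inv]
  obtain ⟨h1, h2⟩ := abs_le.1 hx
  have e1 : Real.exp x ≤ Real.exp M := Real.exp_le_exp.2 h2
  have e2 : Real.exp (-x) ≤ Real.exp M := Real.exp_le_exp.2 (by linarith)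
  have e3 : 1 ≤ Real.exp M := Real.one_le_exp ((abs_nonneg x).trans hx)
  have e4 : Real.exp (-x) * Real.exp x = 1 := by rw [← Real.exp_add]; simp
  refine inv_anti₀ (by positivity) ?_
  nlinarith

lemma sigmoid_strong_mono {M x y : ℝ} (hx : |x| ≤ M) (hy : |y| ≤ M) :
    Real.exp (-M) / 4 * (x - y) ^ 2 ≤ (Real.sigmoid x - Real.sigmoid y) * (x - y) := by
  obtain ⟨c, hc⟩ : ∃ c, c = Real.exp (-M) / 4 := ⟨_, rfl⟩
  rw [← hc]
  have hmono : MonotoneOn (fun x : ℝ => Real.sigmoid x - c * x) (Set.Icc (-M) M) := by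
    refine monotoneOn_of_deriv_nonneg (convex_Icc _ _)
      ((continuous_sigmoid.sub (continuous_const.mul continuous_id)).continuousOn)
      ((differentiable_sigmoid.sub (differentiable_id.const_mul c)).differentiableOn)
      fun x hx => ?_
    have h1 : HasDerivAt (fun x : ℝ => Real.sigmoid x - c * x)
        (Real.sigmoid x * (1 - Real.sigmoid x) - c * 1) x :=
      (Real.hasDerivAt_sigmoid x).sub ((hasDerivAt_id x).const_mul c)
    rw [h1.deriv]
    have := sigmoid_mul_one_sub_ge (abs_le.2 (show x ∈ Set.Icc (-M) M from interior_subset hx))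
    rw [← hc] at this
    linarith
  have hx' : x ∈ Set.Icc (-M) M := abs_le.1 hx
  have hy' : y ∈ Set.Icc (-M) M := abs_le.1 hy
  rcases le_total y x with h | h
  · have := hmono hy' hx' h
    simp only at this
    nlinarith
  · have := hmono hx' hy' h
    simp only at this
    nlinarith

/-! ### Projections onto compact convex sets -/

section NearestPoint

variable {V : Type*} [AddCommGroup V] [Module ℝ V] {N : V → ℝ} {B : V → V → ℝ} {C : Set V}

/-- The variational characterisation of the projection. The inner product enters only through the
expansion `hexp`, so the same proof serves matrices, vectors and scalars. -/
lemma nearestPoint_spec (hN : ∀ x, 0 ≤ N x)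
    (hexp : ∀ x z (t : ℝ), N (x + t • z) ^ 2 = N x ^ 2 + 2 * t * B x z + t ^ 2 * N z ^ 2)
    (hC : Convex ℝ C) {y : V} (hex : ∃ w ∈ C, ∀ v ∈ C, N (w - y) ≤ N (v - y)) :
    nearestPoint N C y ∈ C ∧
      ∀ v ∈ C, 0 ≤ B (nearestPoint N C y - y) (v - nearestPoint N C y) := by
  have hspec : nearestPoint N C y ∈ C ∧ ∀ v ∈ C, N (nearestPoint N C y - y) ≤ N (v - y) :=
    Classical.epsilon_spec (p := fun w => w ∈ C ∧ ∀ v ∈ C, N (w - y) ≤ N (v - y)) hex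
  set P := nearestPoint N C y
  refine ⟨hspec.1, fun v hv => ?_⟩
  by_contra hneg
  push Not at hneg
  set b := B (P - y) (v - P)
  have key : ∀ t : ℝ, 0 ≤ t → t ≤ 1 → 0 ≤ 2 * t * b + t ^ 2 * N (v - P) ^ 2 := by
    intro t h0 h1
    have hmem : P + t • (v - P) ∈ C := by
      have := hC hspec.1 hv (sub_nonneg.2 h1) h0 (by ring)
      convert this using 1
      rw [smul_sub, sub_smul, one_smul]; abel
    have h2 := pow_le_pow_left₀ (hN _) (hspec.2 _ hmem) 2
    rw [show P + t • (v - P) - y = (P - y) + t • (v - P) by abel, hexp] at h2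
    linarith
  have hq : 0 ≤ N (v - P) ^ 2 := sq_nonneg _
  -- The quadratic in `t` is smallest at `t = -b / N (v - P) ^ 2`; if this is not in the interior of
  -- the segment, `t = 1` already gives a negative value.
  by_cases hbig : N (v - P) ^ 2 ≤ -b
  · have := key 1 zero_le_one le_rfl
    linarith
  · push Not at hbig
    have hpos : 0 < N (v - P) ^ 2 := by linarith
    have := key (-b / N (v - P) ^ 2) (div_nonneg (by linarith) hq)
      ((div_le_one hpos).2 hbig.le)
    have e : 2 * (-b / N (v - P) ^ 2) * b + (-b / N (v - P) ^ 2) ^ 2 * N (v - P) ^ 2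
        = -(b ^ 2 / N (v - P) ^ 2) := by field_simp; ring
    rw [e] at this
    have hb : 0 < b ^ 2 / N (v - P) ^ 2 := div_pos (sq_pos_of_neg hneg) hpos
    linarith

/-- Adding the two variational inequalities bounds `N (P - P') ^ 2` by the inner product of `y - y'`
and `P - P'`; nonnegativity of `N (y - y' - (P - P')) ^ 2` finishes. -/
lemma nearestPoint_nonexpansive (hN : ∀ x, 0 ≤ N x)
    (hexp : ∀ x z (t : ℝ), N (x + t • z) ^ 2 = N x ^ 2 + 2 * t * B x z + t ^ 2 * N z ^ 2)
    (hneg : ∀ x z, B x (-z) = -B x z) (hsub : ∀ x y z, B (x - y) z = B x z - B y z)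
    (hself : ∀ x, B x x = N x ^ 2)
    (hC : Convex ℝ C) (hex : ∀ y, ∃ w ∈ C, ∀ v ∈ C, N (w - y) ≤ N (v - y)) (y y' : V) :
    N (nearestPoint N C y - nearestPoint N C y') ^ 2 ≤ N (y - y') ^ 2 := by
  obtain ⟨m1, v1⟩ := nearestPoint_spec hN hexp hC (hex y)
  obtain ⟨m2, v2⟩ := nearestPoint_spec hN hexp hC (hex y')
  set P := nearestPoint N C y
  set P' := nearestPoint N C y'
  have h1 := v1 _ m2
  have h2 := v2 _ m1
  rw [← neg_sub P P', hneg, hsub] at h1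
  rw [hsub] at h2
  have h3 := hself (P - P')
  rw [hsub] at h3
  have h4 := hexp (y - y') (P - P') (-1)
  have h5 := sq_nonneg (N (y - y' + (-1 : ℝ) • (P - P')))
  rw [h4, hsub y y'] at h5
  linarith

end NearestPoint

/-! ### The three constraint sets and their projections -/

section Sets

variable {n : ℕ}

lemma frob_add_smul_sq (x z : Matrix (Fin n) (Fin n) ℝ) (t : ℝ) :
    frob (x + t • z) ^ 2 = frob x ^ 2 + 2 * t * frobInner x z + t ^ 2 * frob z ^ 2 := by
  rw [frob_add_sq, frobInner_smul_right, frob_smul, mul_pow, sq_abs]; ring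

lemma vecNorm_add_smul_sq (x z : Fin n → ℝ) (t : ℝ) :
    vecNorm (x + t • z) ^ 2 = vecNorm x ^ 2 + 2 * t * (∑ i, x i * z i) + t ^ 2 * vecNorm z ^ 2 := by
  rw [vecNorm_sq, vecNorm_sq, vecNorm_sq, Finset.mul_sum, Finset.mul_sum, ← Finset.sum_add_distrib,
    ← Finset.sum_add_distrib]
  refine Finset.sum_congr rfl fun i _ => ?_
  simp only [Pi.add_apply, Pi.smul_apply, smul_eq_mul]; ring

lemma convex_setG (b : ℝ) : Convex ℝ (setG n b) := by
  rintro G ⟨h1, h2, h3⟩ G' ⟨h1', h2', h3'⟩ s t hs ht hst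
  refine ⟨(h1.smul hs).add (h1'.smul ht), ?_, fun i j => ?_⟩
  · rw [Matrix.mul_add, Matrix.mul_smul, Matrix.mul_smul, h2, h2']
  · rw [Matrix.add_apply, Matrix.smul_apply, Matrix.smul_apply, smul_eq_mul, smul_eq_mul]
    refine (abs_add_le _ _).trans ?_
    rw [abs_mul, abs_mul, abs_of_nonneg hs, abs_of_nonneg ht]
    have h4 := mul_le_mul_of_nonneg_left (h3 i j) hs
    have h5 := mul_le_mul_of_nonneg_left (h3' i j) ht
    have : b = s * b + t * b := by rw [← add_mul, hst, one_mul]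
    linarith

lemma isCompact_setG (b : ℝ) : IsCompact (setG n b) := by
  have hcl : IsClosed (setG n b) := by
    have h1 : setG n b = {G | G.transpose = G} ∩ (⋂ x : Fin n → ℝ, {G | 0 ≤ x ⬝ᵥ G.mulVec x}) ∩
        {G | centering n * G = G} ∩ (⋂ i, ⋂ j, {G | |G i j| ≤ b}) := by
      ext G
      simp only [setG, Set.mem_ofPred_eq, Set.mem_inter_iff, Set.mem_iInter,
        Matrix.posSemidef_iff_dotProduct_mulVec, Matrix.IsHermitian,
        Matrix.conjTranspose_eq_transpose_of_trivial, star_trivial]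
      tauto
    rw [h1]
    refine ((IsClosed.inter ?_ ?_).inter ?_).inter ?_
    · exact isClosed_eq (by fun_prop) continuous_id
    · refine isClosed_iInter fun x => isClosed_le continuous_const ?_
      exact continuous_const.dotProduct (continuous_id.matrix_mulVec continuous_const)
    · exact isClosed_eq (continuous_const.matrix_mul continuous_id) continuous_id
    · refine isClosed_iInter fun i => isClosed_iInter fun j => isClosed_le ?_ continuous_const
      exact (continuous_id.matrix_elem i j).abs
  have hcomp : IsCompact (Set.univ.pi fun _ : Fin n => Set.univ.pi fun _ : Fin n => Set.Icc (-b) b) :=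
    isCompact_univ_pi fun _ => isCompact_univ_pi fun _ => isCompact_Icc
  refine IsCompact.of_isClosed_subset (X := Matrix (Fin n) (Fin n) ℝ) hcomp hcl ?_
  intro G hG i _ j _
  exact abs_le.1 (hG.2.2 i j)

lemma continuous_frob_sub (y : Matrix (Fin n) (Fin n) ℝ) :
    Continuous fun w : Matrix (Fin n) (Fin n) ℝ => frob (w - y) := by
  refine Real.continuous_sqrt.comp ?_
  refine continuous_finsetSum _ fun i _ => continuous_finsetSum _ fun j _ => ?_
  exact ((continuous_id.matrix_elem i j).sub continuous_const).pow 2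

lemma zero_mem_setG {b : ℝ} (hb : 0 ≤ b) : (0 : Matrix (Fin n) (Fin n) ℝ) ∈ setG n b :=
  ⟨Matrix.PosSemidef.zero, Matrix.mul_zero _, fun i j => by simpa using hb⟩

lemma exists_nearest_setG {b : ℝ} (hb : 0 ≤ b) (y : Matrix (Fin n) (Fin n) ℝ) :
    ∃ w ∈ setG n b, ∀ v ∈ setG n b, frob (w - y) ≤ frob (v - y) :=
  (isCompact_setG b).exists_isMinOn ⟨0, zero_mem_setG hb⟩ (continuous_frob_sub y).continuousOn

lemma convex_setAlpha (b : ℝ) : Convex ℝ (setAlpha n b) := by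
  intro x hx y hy s t hs ht hst i
  rw [Pi.add_apply, Pi.smul_apply, Pi.smul_apply, smul_eq_mul, smul_eq_mul]
  refine (abs_add_le _ _).trans ?_
  rw [abs_mul, abs_mul, abs_of_nonneg hs, abs_of_nonneg ht]
  have h4 := mul_le_mul_of_nonneg_left (hx i) hs
  have h5 := mul_le_mul_of_nonneg_left (hy i) ht
  have : b = s * b + t * b := by rw [← add_mul, hst, one_mul]
  linarith

lemma exists_nearest_setAlpha {b : ℝ} (hb : 0 ≤ b) (y : Fin n → ℝ) :
    ∃ w ∈ setAlpha n b, ∀ v ∈ setAlpha n b, vecNorm (w - y) ≤ vecNorm (v - y) := by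
  have hcomp : IsCompact (setAlpha n b) := by
    have : setAlpha n b = Set.univ.pi fun _ : Fin n => Set.Icc (-b) b := by
      ext x
      simp only [setAlpha, Set.mem_ofPred_eq, Set.mem_univ_pi, Set.mem_Icc, abs_le]
    rw [this]
    exact isCompact_univ_pi fun _ => isCompact_Icc
  have hcont : Continuous fun w : Fin n → ℝ => vecNorm (w - y) := by
    refine Real.continuous_sqrt.comp ?_
    simp only [Pi.sub_apply]
    fun_prop
  exact hcomp.exists_isMinOn ⟨0, fun i => by simpa using hb⟩ hcont.continuousOn

lemma convex_setBeta (X : Matrix (Fin n) (Fin n) ℝ) (b : ℝ) : Convex ℝ (setBeta X b) := by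
  intro x hx y hy s t hs ht hst i j
  have h4 := mul_le_mul_of_nonneg_left (hx i j) hs
  have h5 := mul_le_mul_of_nonneg_left (hy i j) ht
  have h6 : b = s * b + t * b := by rw [← add_mul, hst, one_mul]
  have h7 : |s • x + t • y| ≤ s * |x| + t * |y| := by
    refine (abs_add_le _ _).trans ?_
    rw [smul_eq_mul, smul_eq_mul, abs_mul, abs_mul, abs_of_nonneg hs, abs_of_nonneg ht]
  have h8 := mul_le_mul_of_nonneg_right h7 (abs_nonneg (X i j))
  linarith

/-- A nonzero entry of `X` bounds `β` and makes the constraint set compact. -/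
lemma exists_nearest_setBeta {X : Matrix (Fin n) (Fin n) ℝ} (hX : X ≠ 0) {b : ℝ} (hb : 0 ≤ b)
    (y : ℝ) : ∃ w ∈ setBeta X b, ∀ v ∈ setBeta X b, |w - y| ≤ |v - y| := by
  obtain ⟨i, j, hij⟩ : ∃ i j, X i j ≠ 0 := by
    by_contra h
    push Not at h
    exact hX (Matrix.ext h)
  have hpos : 0 < |X i j| := abs_pos.2 hij
  have hcomp : IsCompact (setBeta X b) := by
    refine IsCompact.of_isClosed_subset (isCompact_Icc (a := -(b / |X i j|)) (b := b / |X i j|))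
      ?_ fun β hβ => ?_
    · have : setBeta X b = ⋂ i, ⋂ j, {β : ℝ | |β| * |X i j| ≤ b} := by
        ext; simp [setBeta]
      rw [this]
      exact isClosed_iInter fun i => isClosed_iInter fun j =>
        isClosed_le (continuous_abs.mul continuous_const) continuous_const
    · exact abs_le.1 ((le_div_iff₀ hpos).2 (hβ i j))
  exact hcomp.exists_isMinOn ⟨0, fun i j => by simpa using hb⟩
    (continuous_id.sub continuous_const).abs.continuousOn

lemma nearestPoint_setG {b : ℝ} (hb : 0 ≤ b) (y : Matrix (Fin n) (Fin n) ℝ) :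
    nearestPoint frob (setG n b) y ∈ setG n b ∧ ∀ v ∈ setG n b,
      0 ≤ frobInner (nearestPoint frob (setG n b) y - y) (v - nearestPoint frob (setG n b) y) :=
  nearestPoint_spec frob_nonneg frob_add_smul_sq (convex_setG b) (exists_nearest_setG hb y)

lemma nearestPoint_setAlpha {b : ℝ} (hb : 0 ≤ b) (y : Fin n → ℝ) :
    nearestPoint vecNorm (setAlpha n b) y ∈ setAlpha n b ∧ ∀ v ∈ setAlpha n b,
      0 ≤ ∑ i, (nearestPoint vecNorm (setAlpha n b) y - y) i *
        (v - nearestPoint vecNorm (setAlpha n b) y) i :=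
  nearestPoint_spec (B := fun x z => ∑ i, x i * z i) vecNorm_nonneg vecNorm_add_smul_sq
    (convex_setAlpha b) (exists_nearest_setAlpha hb y)

lemma abs_add_smul_sq (x z t : ℝ) : |x + t • z| ^ 2 = |x| ^ 2 + 2 * t * (x * z) + t ^ 2 * |z| ^ 2 := by
  rw [sq_abs, sq_abs, sq_abs, smul_eq_mul]; ring

lemma nearestPoint_setBeta {X : Matrix (Fin n) (Fin n) ℝ} (hX : X ≠ 0) {b : ℝ} (hb : 0 ≤ b)
    (y : ℝ) :
    nearestPoint (fun b : ℝ => |b|) (setBeta X b) y ∈ setBeta X b ∧ ∀ v ∈ setBeta X b,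
      0 ≤ (nearestPoint (fun b : ℝ => |b|) (setBeta X b) y - y) *
        (v - nearestPoint (fun b : ℝ => |b|) (setBeta X b) y) :=
  nearestPoint_spec (B := fun x z => x * z) (fun x => abs_nonneg x) abs_add_smul_sq
    (convex_setBeta X b) (exists_nearest_setBeta hX hb y)

lemma nearestPoint_setG_nonexpansive {b : ℝ} (hb : 0 ≤ b) (y y' : Matrix (Fin n) (Fin n) ℝ) :
    frob (nearestPoint frob (setG n b) y - nearestPoint frob (setG n b) y') ^ 2 ≤
      frob (y - y') ^ 2 :=
  nearestPoint_nonexpansive frob_nonneg frob_add_smul_sq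
    (fun x z => by rw [← neg_one_smul ℝ z, frobInner_smul_right, neg_one_mul])
    (fun x y z => frobInner_sub_left x y z) (fun x => (frob_sq x).symm)
    (convex_setG b) (exists_nearest_setG hb) y y'

lemma nearestPoint_setAlpha_nonexpansive {b : ℝ} (hb : 0 ≤ b) (y y' : Fin n → ℝ) :
    vecNorm (nearestPoint vecNorm (setAlpha n b) y - nearestPoint vecNorm (setAlpha n b) y') ^ 2 ≤
      vecNorm (y - y') ^ 2 :=
  nearestPoint_nonexpansive (B := fun x z => ∑ i, x i * z i) vecNorm_nonneg vecNorm_add_smul_sq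
    (fun x z => by simp) (fun x y z => by simp [sub_mul])
    (fun x => by rw [vecNorm_sq]; simp [sq])
    (convex_setAlpha b) (exists_nearest_setAlpha hb) y y'

lemma nearestPoint_setBeta_nonexpansive {X : Matrix (Fin n) (Fin n) ℝ} (hX : X ≠ 0) {b : ℝ}
    (hb : 0 ≤ b) (y y' : ℝ) :
    |nearestPoint (fun b : ℝ => |b|) (setBeta X b) y
      - nearestPoint (fun b : ℝ => |b|) (setBeta X b) y'| ^ 2 ≤ |y - y'| ^ 2 :=
  nearestPoint_nonexpansive (B := fun x z => x * z) (fun x => abs_nonneg x) abs_add_smul_sq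
    (fun x z => by ring) (fun x y z => by ring) (fun x => by rw [sq_abs, sq])
    (convex_setBeta X b) (exists_nearest_setBeta hX hb) y y'

end Sets

/-! ### Contraction of the projected gradient step -/

section Contraction

variable {n : ℕ}

/-- Squared weighted distance of two iterates in which a gradient step is a contraction. -/
noncomputable def sqDist (X : Matrix (Fin n) (Fin n) ℝ) (s : ℝ) (x y : Iterate n) : ℝ :=
  frob (x.G - y.G) ^ 2 + 2 * n / s * vecNorm (x.α - y.α) ^ 2 + frob X ^ 2 * (x.β - y.β) ^ 2

/-- The matrix `σ(Θ(x)) - σ(Θ(y))`. -/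
noncomputable def sigmoidDiff (X : Matrix (Fin n) (Fin n) ℝ) (x y : Iterate n) :
    Matrix (Fin n) (Fin n) ℝ :=
  (thetaMat X x.G x.α x.β).map Real.sigmoid - (thetaMat X y.G y.α y.β).map Real.sigmoid

lemma residual_sub (A X : Matrix (Fin n) (Fin n) ℝ) (x y : Iterate n) :
    residual A X x - residual A X y = -sigmoidDiff X x y := by
  simp only [residual, sigmoidDiff]; abel

lemma thetaMat_symm {X G : Matrix (Fin n) (Fin n) ℝ} (hX : X.transpose = X)
    (hG : G.transpose = G) (α : Fin n → ℝ) (β : ℝ) :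
    (thetaMat X G α β).transpose = thetaMat X G α β := by
  ext i j
  have h1 := congrFun (congrFun hX i) j
  have h2 := congrFun (congrFun hG i) j
  simp only [Matrix.transpose_apply] at h1 h2
  simp only [thetaMat, Matrix.transpose_apply, Matrix.of_apply, h1, h2]; ring

lemma sigmoidDiff_symm {X : Matrix (Fin n) (Fin n) ℝ} (hX : X.transpose = X) {x y : Iterate n}
    (hx : x.G.transpose = x.G) (hy : y.G.transpose = y.G) (i j : Fin n) :
    sigmoidDiff X x y i j = sigmoidDiff X x y j i := by
  have h1 := congrFun (congrFun (thetaMat_symm hX hx x.α x.β) i) j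
  have h2 := congrFun (congrFun (thetaMat_symm hX hy y.α y.β) i) j
  simp only [Matrix.transpose_apply] at h1 h2
  simp only [sigmoidDiff, Matrix.sub_apply, Matrix.map_apply, h1, h2]

lemma frobInner_thetaMat {X S G : Matrix (Fin n) (Fin n) ℝ} (hS : ∀ i j, S i j = S j i)
    (α : Fin n → ℝ) (β : ℝ) :
    frobInner S (thetaMat X G α β) =
      2 * (∑ i, α i * ∑ j, S i j) + β * frobInner S X + frobInner S G := by
  have h1 : ∑ i, ∑ j, S i j * α j = ∑ i, ∑ j, S i j * α i := by
    rw [Finset.sum_comm]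
    exact Finset.sum_congr rfl fun i _ => Finset.sum_congr rfl fun j _ => by rw [hS]
  have h2 : ∑ i, ∑ j, S i j * (β * X i j) = β * frobInner S X := by
    rw [frobInner, Finset.mul_sum]
    refine Finset.sum_congr rfl fun i _ => ?_
    rw [Finset.mul_sum]
    exact Finset.sum_congr rfl fun j _ => by ring
  have h3 : ∑ i, ∑ j, S i j * α i = ∑ i, α i * ∑ j, S i j := by
    refine Finset.sum_congr rfl fun i _ => ?_
    rw [Finset.mul_sum]
    exact Finset.sum_congr rfl fun j _ => by ring
  simp only [frobInner, thetaMat, Matrix.of_apply, mul_add, Finset.sum_add_distrib]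
  rw [h1, h2, h3, frobInner]; ring

lemma thetaMat_sub (X G G' : Matrix (Fin n) (Fin n) ℝ) (α α' : Fin n → ℝ) (β β' : ℝ) :
    thetaMat X G α β - thetaMat X G' α' β' = thetaMat X (G - G') (α - α') (β - β') := by
  ext i j
  simp only [thetaMat, Matrix.sub_apply, Matrix.of_apply, Pi.sub_apply]; ring

lemma four_mul_frob_sigmoidDiff_sq_le (X : Matrix (Fin n) (Fin n) ℝ) (x y : Iterate n) :
    4 * frob (sigmoidDiff X x y) ^ 2 ≤
      frobInner (sigmoidDiff X x y) (thetaMat X (x.G - y.G) (x.α - y.α) (x.β - y.β)) := by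
  rw [← thetaMat_sub, frob_sq_eq_sum, frobInner, Finset.mul_sum]
  refine Finset.sum_le_sum fun i _ => ?_
  rw [Finset.mul_sum]
  exact Finset.sum_le_sum fun j _ => four_mul_sq_sigmoid_sub_le _ _

lemma vecNorm_row_sum_sq_le (S : Matrix (Fin n) (Fin n) ℝ) :
    vecNorm (fun i => ∑ j, S i j) ^ 2 ≤ n * frob S ^ 2 := by
  rw [vecNorm_sq, frob_sq_eq_sum, Finset.mul_sum]
  refine Finset.sum_le_sum fun i _ => ?_
  have := sq_sum_le_card_mul_sum_sq (s := Finset.univ) (f := fun j => S i j)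
  simpa using this

/-- After weighting, the squared gradient is `2 * η ^ 2 * s * (q / N) ≤ 4 * η ^ 2 * Q`, as `s ≤ 2`.
For `r = 1` the shrinkage is the common factor `1 - h`. For `r = 2` it is `1 - 2 * h`: the identity
`(1 - 2 * h) ^ 2 = (1 - h) ^ 2 - h * (2 - 3 * h)` frees enough of `a` to absorb the change `4 * h *
η * t` of the cross term, up to the last summand. -/
lemma alpha_step_sq_le {h η s r t a q Q N : ℝ} (hη : 0 < η) (hh0 : 0 ≤ h) (hh : h ≤ 1 / 3)
    (hN : 0 < N) (ha : 0 ≤ a) (hQ : 0 ≤ Q) (hq : q ≤ N * Q) (ht : t ^ 2 ≤ a * q)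
    (hsr : (s, r) = ((1 : ℝ) / 2, (1 : ℝ)) ∨ (s, r) = (1, 1) ∨ (s, r) = (2, 2)) :
    2 * N / s * ((1 - h * r) ^ 2 * a - 2 * (1 - h * r) * (η * s / N) * t
      + (η * s / N) ^ 2 * q) ≤
      (1 - h) ^ 2 * (2 * N / s * a) - 4 * (1 - h) * η * t + 4 * η ^ 2 * Q + 4 * η ^ 2 * h * Q := by
  have hs : 0 < s ∧ s ≤ 2 := by
    rcases hsr with e | e | e <;> rw [Prod.mk.injEq] at e <;> rw [e.1] <;> norm_num
  have e : 2 * N / s * ((1 - h * r) ^ 2 * a - 2 * (1 - h * r) * (η * s / N) * t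
      + (η * s / N) ^ 2 * q) = (1 - h * r) ^ 2 * (2 * N / s * a) - 4 * (1 - h * r) * η * t
        + 2 * η ^ 2 * s * (q / N) := by
    have := hs.1.ne'
    field_simp
    ring
  have hqN : q / N ≤ Q := by rw [div_le_iff₀ hN]; linarith
  have h1 : 2 * η ^ 2 * s * (q / N) ≤ 4 * η ^ 2 * Q := by
    have h2 : 2 * η ^ 2 * s * (q / N) ≤ 2 * η ^ 2 * s * Q :=
      mul_le_mul_of_nonneg_left hqN (by have := hs.1; positivity)
    have h3 : η ^ 2 * Q * s ≤ η ^ 2 * Q * 2 := mul_le_mul_of_nonneg_left hs.2 (by positivity)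
    linarith
  rw [e]
  have h4 : 0 ≤ 4 * η ^ 2 * h * Q := by positivity
  have hr : r = 1 ∨ (s = 2 ∧ r = 2) := by
    rcases hsr with e | e | e <;> rw [Prod.mk.injEq] at e <;> tauto
  rcases hr with rfl | ⟨rfl, rfl⟩
  · rw [mul_one]; linarith
  · have h5 : t ^ 2 ≤ (a * N) * Q := by
      have := mul_le_mul_of_nonneg_left hq ha
      linarith
    have h6 : 4 * η * t ≤ a * N + 4 * η ^ 2 * Q := by
      have haN : 0 ≤ a * N := by positivity
      refine abs_le_of_sq_le_sq' ?_ (by positivity) |>.2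
      have : (4 * η * t) ^ 2 ≤ 16 * η ^ 2 * ((a * N) * Q) := by
        have := mul_le_mul_of_nonneg_left h5 (show 0 ≤ 16 * η ^ 2 by positivity)
        linarith
      nlinarith [sq_nonneg (a * N - 4 * η ^ 2 * Q)]
    have h7 : h * (4 * η * t) ≤ h * (a * N + 4 * η ^ 2 * Q) := mul_le_mul_of_nonneg_left h6 hh0
    have h8 : h * (a * N) * 1 ≤ h * (a * N) * (2 - 3 * h) :=
      mul_le_mul_of_nonneg_left (by linarith) (by positivity)
    have h9 : 2 * N / 2 * a = a * N := by ring
    rw [h9]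
    nlinarith

/-- The weights of `sqDist` make the cross terms of the three blocks add up to `-2 * (1 - gam * η) *
η` times the inner product of `S` with the difference of the two `Θ`. By co-coercivity that inner
product is at least `4 * Q`. The squared gradients cost at most `(6 + 4 * gam * η) * η ^ 2 * Q`,
which is less for the admitted step sizes, so only the shrinkage by the ridge remains. -/
lemma sqDist_step_le (hn : 1 ≤ n) {A X : Matrix (Fin n) (Fin n) ℝ} (hX : X.transpose = X)
    {bG bα bβ lam gam η s r : ℝ} (hbG : 0 ≤ bG) (hbα : 0 ≤ bα) (hbβ : 0 ≤ bβ)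
    (hgam : 0 < gam) (hη : 0 < η) (hη' : η ≤ 2 / 9) (hh : gam * η ≤ 1 / 3)
    (hsr : (s, r) = ((1 : ℝ) / 2, (1 : ℝ)) ∨ (s, r) = (1, 1) ∨ (s, r) = (2, 2))
    {x y : Iterate n} (hx : x.G.transpose = x.G) (hy : y.G.transpose = y.G) :
    sqDist X s (step A X bG bα bβ lam gam η s r x) (step A X bG bα bβ lam gam η s r y) ≤
      (1 - gam * η) ^ 2 * sqDist X s x y := by
  have hs : 0 < s := by
    rcases hsr with e | e | e <;> rw [Prod.mk.injEq] at e <;> rw [e.1] <;> norm_num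
  have hN : (0 : ℝ) < n := by exact_mod_cast hn
  have hh0 : 0 ≤ gam * η := by positivity
  set S := sigmoidDiff X x y with hS
  have hSs : ∀ i j, S i j = S j i := sigmoidDiff_symm hX hx hy
  have hres := residual_sub A X x y
  rw [← hS] at hres
  have hresij : ∀ i j, residual A X x i j - residual A X y i j = -S i j := fun i j => by
    rw [← Matrix.sub_apply, hres, Matrix.neg_apply]
  set a := vecNorm (x.α - y.α) ^ 2 with ha
  set Q := frob S ^ 2 with hQ
  set t := ∑ i, (x.α - y.α) i * ∑ j, S i j with ht
  have hkey := four_mul_frob_sigmoidDiff_sq_le X x y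
  rw [← hS, frobInner_thetaMat hSs, ← ht, ← hQ] at hkey
  -- the three blocks
  have hG : frob ((step A X bG bα bβ lam gam η s r x).G - (step A X bG bα bβ lam gam η s r y).G) ^ 2
      ≤ (1 - gam * η) ^ 2 * frob (x.G - y.G) ^ 2
        - 2 * (1 - gam * η) * η * frobInner S (x.G - y.G) + η ^ 2 * Q := by
    refine (nearestPoint_setG_nonexpansive hbG _ _).trans (le_of_eq ?_)
    have e : x.G + η • (residual A X x - lam • (1 : Matrix (Fin n) (Fin n) ℝ) - gam • x.G)
        - (y.G + η • (residual A X y - lam • (1 : Matrix (Fin n) (Fin n) ℝ) - gam • y.G))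
        = (1 - gam * η) • (x.G - y.G) - η • S := by
      ext i j
      have := hresij i j
      simp only [Matrix.sub_apply, Matrix.add_apply, Matrix.smul_apply, smul_eq_mul]
      linear_combination η * this
    rw [e, frob_sub_sq, frob_smul, frob_smul, frobInner_smul_left, frobInner_smul_right, mul_pow,
      mul_pow, sq_abs, sq_abs, frobInner_comm]
    ring
  have hα : 2 * n / s * vecNorm ((step A X bG bα bβ lam gam η s r x).α
        - (step A X bG bα bβ lam gam η s r y).α) ^ 2
      ≤ (1 - gam * η) ^ 2 * (2 * n / s * a) - 4 * (1 - gam * η) * η * t + 4 * η ^ 2 * Q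
        + 4 * η ^ 2 * (gam * η) * Q := by
    refine (mul_le_mul_of_nonneg_left (nearestPoint_setAlpha_nonexpansive hbα _ _)
      (by positivity)).trans ?_
    have htq : t ^ 2 ≤ a * vecNorm (fun i => ∑ j, S i j) ^ 2 := by
      have h1 := dot_le_vecNorm (x.α - y.α) (fun i => ∑ j, S i j)
      have h2 := pow_le_pow_left₀ (abs_nonneg _) h1 2
      rwa [sq_abs, mul_pow] at h2
    refine le_trans (le_of_eq ?_) (alpha_step_sq_le (s := s) (r := r) hη hh0 hh hN (sq_nonneg _)
      (sq_nonneg _) (vecNorm_row_sum_sq_le S) htq hsr)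
    congr 1
    rw [ha, vecNorm_sq, vecNorm_sq, vecNorm_sq, ht, Finset.mul_sum, Finset.mul_sum, Finset.mul_sum,
      ← Finset.sum_sub_distrib, ← Finset.sum_add_distrib]
    refine Finset.sum_congr rfl fun i _ => ?_
    have h3 : ∑ j, residual A X x i j - ∑ j, residual A X y i j = -∑ j, S i j := by
      rw [← Finset.sum_sub_distrib, ← Finset.sum_neg_distrib]
      exact Finset.sum_congr rfl fun j _ => hresij i j
    have h4 : x.α i + η * (s * (∑ j, residual A X x i j) / n - r * gam * x.α i)
        - (y.α i + η * (s * (∑ j, residual A X y i j) / n - r * gam * y.α i))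
        = (1 - gam * η * r) * (x.α i - y.α i) - η * s / n * ∑ j, S i j := by
      linear_combination η * s / n * h3
    simp only [Pi.sub_apply]
    rw [h4]; ring
  have hβ : frob X ^ 2 * ((step A X bG bα bβ lam gam η s r x).β
        - (step A X bG bα bβ lam gam η s r y).β) ^ 2
      ≤ (1 - gam * η) ^ 2 * (frob X ^ 2 * (x.β - y.β) ^ 2)
        - 2 * (1 - gam * η) * η * ((x.β - y.β) * frobInner S X) + η ^ 2 * Q := by
    by_cases hX0 : X = 0
    · have h1 : frob X ^ 2 = 0 := by rw [frob_sq, hX0]; simp [frobInner]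
      have h2 : frobInner S X = 0 := by rw [hX0]; simp [frobInner]
      rw [h1, h2]
      have : 0 ≤ η ^ 2 * Q := by positivity
      linarith
    · have hf : 0 < frob X := lt_of_le_of_ne (frob_nonneg _) fun h => hX0 (frob_eq_zero h.symm)
      simp only [step, if_neg hX0]
      rw [← sq_abs (_ - _)]
      refine (mul_le_mul_of_nonneg_left (nearestPoint_setBeta_nonexpansive hX0 hbβ _ _)
        (sq_nonneg _)).trans ?_
      rw [sq_abs]
      have h3 : frobInner (residual A X x) X - frobInner (residual A X y) X = -frobInner S X := by
        rw [← frobInner_sub_left, hres, ← neg_one_smul ℝ S, frobInner_smul_left, neg_one_mul]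
      have h4 : x.β + η * (frobInner (residual A X x) X / frob X ^ 2 - gam * x.β)
          - (y.β + η * (frobInner (residual A X y) X / frob X ^ 2 - gam * y.β))
          = (1 - gam * η) * (x.β - y.β) - η * (frobInner S X / frob X ^ 2) := by
        linear_combination η / frob X ^ 2 * h3
      rw [h4]
      have h5 : frobInner S X ^ 2 / frob X ^ 2 ≤ Q := by
        rw [div_le_iff₀ (by positivity), hQ, ← mul_pow, ← sq_abs (frobInner S X)]
        exact pow_le_pow_left₀ (abs_nonneg _) (abs_frobInner_le S X) 2
      have h6 : frob X ^ 2 * ((1 - gam * η) * (x.β - y.β) - η * (frobInner S X / frob X ^ 2)) ^ 2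
          = (1 - gam * η) ^ 2 * (frob X ^ 2 * (x.β - y.β) ^ 2)
            - 2 * (1 - gam * η) * η * ((x.β - y.β) * frobInner S X)
            + η ^ 2 * (frobInner S X ^ 2 / frob X ^ 2) := by
        field_simp
        ring
      rw [h6]
      have := mul_le_mul_of_nonneg_left h5 (sq_nonneg η)
      linarith
  have hfin : (6 * η ^ 2 + 4 * η ^ 2 * (gam * η)) * Q
      ≤ 2 * (1 - gam * η) * η * (2 * t + (x.β - y.β) * frobInner S X
        + frobInner S (x.G - y.G)) := by
    have h1 : 2 * (1 - gam * η) * η * (4 * Q) ≤ 2 * (1 - gam * η) * η * (2 * t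
        + (x.β - y.β) * frobInner S X + frobInner S (x.G - y.G)) :=
      mul_le_mul_of_nonneg_left hkey (mul_nonneg (by linarith) hη.le)
    have h2 : 6 * η + 4 * η * (gam * η) ≤ 8 * (1 - gam * η) := by
      have := mul_le_mul hη' hh hh0 (by norm_num : (0 : ℝ) ≤ 2 / 9)
      linarith
    have h3 := mul_le_mul_of_nonneg_left h2 (mul_nonneg hη.le (sq_nonneg (frob S)))
    rw [← hQ] at h3
    linarith
  simp only [sqDist]
  rw [← ha]
  linarith

lemma exists_tendsto_of_sq_sub_le {a : ℕ → ℝ} {C q : ℝ} (hq0 : 0 ≤ q)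
    (hq1 : q < 1) (h : ∀ t, (a (t + 1) - a t) ^ 2 ≤ C * (q ^ t) ^ 2) :
    ∃ L, Filter.Tendsto a Filter.atTop (nhds L) := by
  have hC : 0 ≤ C := by have := h 0; simp at this; exact (sq_nonneg _).trans this
  refine cauchySeq_tendsto_of_complete (cauchySeq_of_le_geometric q (√C) hq1 fun t => ?_)
  rw [dist_comm, Real.dist_eq]
  refine abs_le_of_sq_le_sq ?_ (by positivity)
  rw [mul_pow, Real.sq_sqrt hC]
  exact h t

lemma sq_apply_le_frob_sq (M : Matrix (Fin n) (Fin n) ℝ) (i j : Fin n) : M i j ^ 2 ≤ frob M ^ 2 := by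
  rw [frob_sq_eq_sum]
  have h1 := Finset.single_le_sum (f := fun j => M i j ^ 2) (fun j _ => sq_nonneg _)
    (Finset.mem_univ j)
  have h2 := Finset.single_le_sum (f := fun i => ∑ j, M i j ^ 2)
    (fun i _ => Finset.sum_nonneg fun j _ => sq_nonneg _) (Finset.mem_univ i)
  exact h1.trans h2

lemma sq_apply_le_vecNorm_sq (v : Fin n → ℝ) (i : Fin n) : v i ^ 2 ≤ vecNorm v ^ 2 := by
  rw [vecNorm_sq]
  exact Finset.single_le_sum (f := fun i => v i ^ 2) (fun j _ => sq_nonneg _) (Finset.mem_univ i)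

lemma sqDist_nonneg (X : Matrix (Fin n) (Fin n) ℝ) {s : ℝ} (hs : 0 < s) (x y : Iterate n) :
    0 ≤ sqDist X s x y := by unfold sqDist; positivity

lemma sqDist_comm (X : Matrix (Fin n) (Fin n) ℝ) (s : ℝ) (x y : Iterate n) :
    sqDist X s x y = sqDist X s y x := by
  unfold sqDist
  rw [frob_sub_comm, vecNorm_sq, vecNorm_sq]
  have : ∑ i, (x.α - y.α) i ^ 2 = ∑ i, (y.α - x.α) i ^ 2 :=
    Finset.sum_congr rfl fun i _ => by simp only [Pi.sub_apply]; ring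
  rw [this]; ring

lemma sqDist_triangle (X : Matrix (Fin n) (Fin n) ℝ) {s : ℝ} (hs : 0 < s) (x y z : Iterate n) :
    sqDist X s x z ≤ 2 * sqDist X s x y + 2 * sqDist X s y z := by
  have h1 : frob (x.G - z.G) ^ 2 ≤ 2 * frob (x.G - y.G) ^ 2 + 2 * frob (y.G - z.G) ^ 2 := by
    simp only [frob_sq_eq_sum, Finset.mul_sum, ← Finset.sum_add_distrib]
    refine Finset.sum_le_sum fun i _ => Finset.sum_le_sum fun j _ => ?_
    simp only [Matrix.sub_apply]
    nlinarith [sq_nonneg (x.G i j - y.G i j - (y.G i j - z.G i j))]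
  have h2 : vecNorm (x.α - z.α) ^ 2 ≤ 2 * vecNorm (x.α - y.α) ^ 2 + 2 * vecNorm (y.α - z.α) ^ 2 := by
    simp only [vecNorm_sq, Finset.mul_sum, ← Finset.sum_add_distrib]
    refine Finset.sum_le_sum fun i _ => ?_
    simp only [Pi.sub_apply]
    nlinarith [sq_nonneg (x.α i - y.α i - (y.α i - z.α i))]
  have h3 : (x.β - z.β) ^ 2 ≤ 2 * (x.β - y.β) ^ 2 + 2 * (y.β - z.β) ^ 2 := by
    nlinarith [sq_nonneg (x.β - y.β - (y.β - z.β))]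
  have h4 := mul_le_mul_of_nonneg_left h2 (show 0 ≤ 2 * n / s by positivity)
  have h5 := mul_le_mul_of_nonneg_left h3 (sq_nonneg (frob X))
  unfold sqDist
  linarith

lemma eq_of_sqDist_eq_zero (hn : 1 ≤ n) {X : Matrix (Fin n) (Fin n) ℝ} {s : ℝ} (hs : 0 < s)
    {x y : Iterate n} (h : sqDist X s x y ≤ 0) : x.G = y.G ∧ x.α = y.α ∧ (X ≠ 0 → x.β = y.β) := by
  have hN : (0 : ℝ) < n := by exact_mod_cast hn
  have h1 : 0 ≤ frob (x.G - y.G) ^ 2 := sq_nonneg _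
  have h2 : 0 ≤ 2 * n / s * vecNorm (x.α - y.α) ^ 2 := by positivity
  have h3 : 0 ≤ frob X ^ 2 * (x.β - y.β) ^ 2 := by positivity
  unfold sqDist at h
  refine ⟨sub_eq_zero.1 (frob_eq_zero (pow_eq_zero_iff two_ne_zero |>.1 (by linarith))),
    sub_eq_zero.1 (vecNorm_eq_zero (pow_eq_zero_iff two_ne_zero |>.1 ?_)), fun hX => ?_⟩
  · have : 2 * n / s * vecNorm (x.α - y.α) ^ 2 = 0 := by linarith
    exact (mul_eq_zero.1 this).resolve_left (by positivity)
  · have : frob X ^ 2 * (x.β - y.β) ^ 2 = 0 := by linarith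
    have h4 := (mul_eq_zero.1 this).resolve_left fun h => hX (frob_eq_zero (pow_eq_zero_iff two_ne_zero |>.1 h))
    exact sub_eq_zero.1 (pow_eq_zero_iff two_ne_zero |>.1 h4)

lemma setG_transpose {b : ℝ} {G : Matrix (Fin n) (Fin n) ℝ} (h : G ∈ setG n b) :
    G.transpose = G := by
  have := h.1.isHermitian
  rwa [Matrix.IsHermitian, Matrix.conjTranspose_eq_transpose_of_trivial] at this

/-- Iterates of a contraction for `sqDist` converge linearly to a fixed point. -/
lemma exists_fixedPoint_of_contraction (hn : 1 ≤ n) {X : Matrix (Fin n) (Fin n) ℝ} {s q : ℝ}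
    (hs : 0 < s) (hq0 : 0 ≤ q) (hq1 : q < 1) {f : Iterate n → Iterate n}
    (hcontr : ∀ {x y : Iterate n}, x.G.transpose = x.G → y.G.transpose = y.G →
      sqDist X s (f x) (f y) ≤ q ^ 2 * sqDist X s x y)
    (hfs : ∀ x, (f x).G.transpose = (f x).G) (hfβ : X = 0 → ∀ x, (f x).β = x.β)
    {u : ℕ → Iterate n} (hu0 : u 0 = ⟨0, 0, 0⟩) (hsucc : ∀ t, u (t + 1) = f (u t)) :
    ∃ x : Iterate n, f x = x ∧ (X = 0 → x.β = 0) ∧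
      ∀ T, sqDist X s (u T) x ≤ (q ^ 2) ^ T * sqDist X s ⟨0, 0, 0⟩ x := by
  have hN : (0 : ℝ) < n := by exact_mod_cast hn
  have hsym : ∀ t, (u t).G.transpose = (u t).G := fun t => by
    cases t with
    | zero => rw [hu0]; exact Matrix.transpose_zero
    | succ t => rw [hsucc]; exact hfs _
  -- If `X = 0` the distance does not see `β`; its convergence comes from the skipped update.
  have hβ0 : X = 0 → ∀ t, (u t).β = 0 := fun h t => by
    induction t with
    | zero => rw [hu0]
    | succ t ih => rw [hsucc, hfβ h, ih]
  set E := sqDist X s (u 1) (u 0) with hE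
  have hgeo : ∀ t, sqDist X s (u (t + 1)) (u t) ≤ E * (q ^ t) ^ 2 := fun t => by
    induction t with
    | zero => simp [hE]
    | succ t ih =>
      have h1 := hcontr (hsym (t + 1)) (hsym t)
      rw [← hsucc, ← hsucc] at h1
      have h2 := mul_le_mul_of_nonneg_left ih (sq_nonneg q)
      refine (h1.trans h2).trans (le_of_eq ?_)
      ring
  -- Every coordinate is a Cauchy sequence with geometric increments, so the limit is built entry by
  -- entry. It is symmetric, as required for the contraction estimate to apply to it.
  have hlimG : ∀ i j, ∃ L, Filter.Tendsto (fun t => (u t).G i j) Filter.atTop (nhds L) := fun i j => by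
    refine exists_tendsto_of_sq_sub_le (C := E) hq0 hq1 fun t => le_trans ?_ (hgeo t)
    rw [← Matrix.sub_apply]
    refine (sq_apply_le_frob_sq _ i j).trans ?_
    unfold sqDist
    have h2 : 0 ≤ 2 * n / s * vecNorm ((u (t + 1)).α - (u t).α) ^ 2 := by positivity
    have h3 : 0 ≤ frob X ^ 2 * ((u (t + 1)).β - (u t).β) ^ 2 := by positivity
    linarith
  have hlimα : ∀ i, ∃ L, Filter.Tendsto (fun t => (u t).α i) Filter.atTop (nhds L) := fun i => by
    refine exists_tendsto_of_sq_sub_le (C := E / (2 * n / s)) hq0 hq1 fun t => ?_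
    have hpos : 0 < 2 * n / s := by positivity
    rw [div_mul_eq_mul_div, le_div_iff₀ hpos]
    refine le_trans ?_ (hgeo t)
    have h0 := sq_apply_le_vecNorm_sq ((u (t + 1)).α - (u t).α) i
    rw [Pi.sub_apply] at h0
    have h1 := mul_le_mul_of_nonneg_left h0 hpos.le
    unfold sqDist
    have h2 : 0 ≤ frob ((u (t + 1)).G - (u t).G) ^ 2 := by positivity
    have h3 : 0 ≤ frob X ^ 2 * ((u (t + 1)).β - (u t).β) ^ 2 := by positivity
    linarith
  have hlimβ : ∃ L, Filter.Tendsto (fun t => (u t).β) Filter.atTop (nhds L) := by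
    by_cases hX0 : X = 0
    · exact ⟨0, by simp [hβ0 hX0]⟩
    · have hpos : 0 < frob X ^ 2 :=
        pow_pos (lt_of_le_of_ne (frob_nonneg _) fun h => hX0 (frob_eq_zero h.symm)) 2
      refine exists_tendsto_of_sq_sub_le (C := E / frob X ^ 2) hq0 hq1 fun t => ?_
      rw [div_mul_eq_mul_div, le_div_iff₀ hpos]
      refine le_trans ?_ (hgeo t)
      unfold sqDist
      have h2 : 0 ≤ frob ((u (t + 1)).G - (u t).G) ^ 2 := by positivity
      have h3 : 0 ≤ 2 * n / s * vecNorm ((u (t + 1)).α - (u t).α) ^ 2 := by positivity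
      linarith
  choose Gh hGh using hlimG
  choose αh hαh using hlimα
  obtain ⟨βh, hβh⟩ := hlimβ
  set x : Iterate n := ⟨Matrix.of Gh, αh, βh⟩ with hx
  have hβx : X = 0 → x.β = 0 := fun h => by
    have : Filter.Tendsto (fun t => (u t).β) Filter.atTop (nhds 0) := by simp [hβ0 h]
    exact tendsto_nhds_unique hβh this
  have hxsym : x.G.transpose = x.G := by
    ext i j
    refine tendsto_nhds_unique (hGh j i) ?_
    have : (fun t => (u t).G j i) = fun t => (u t).G i j := by
      funext t
      exact congrFun (congrFun (hsym t) i) j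
    rw [this]
    exact hGh i j
  have hconv : Filter.Tendsto (fun t => sqDist X s (u t) x) Filter.atTop (nhds 0) := by
    have h1 : Filter.Tendsto (fun t => ∑ i, ∑ j, ((u t).G i j - Gh i j) ^ 2) Filter.atTop
        (nhds (∑ i, ∑ j, (Gh i j - Gh i j) ^ 2)) :=
      tendsto_finsetSum _ fun i _ => tendsto_finsetSum _ fun j _ =>
        ((hGh i j).sub tendsto_const_nhds).pow 2
    have h2 : Filter.Tendsto (fun t => ∑ i, ((u t).α i - αh i) ^ 2) Filter.atTop
        (nhds (∑ i, (αh i - αh i) ^ 2)) :=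
      tendsto_finsetSum _ fun i _ => ((hαh i).sub tendsto_const_nhds).pow 2
    have h3 : Filter.Tendsto (fun t => ((u t).β - βh) ^ 2) Filter.atTop
        (nhds ((βh - βh) ^ 2)) := (hβh.sub tendsto_const_nhds).pow 2
    have h4 := (h1.add (h2.const_mul (2 * n / s))).add (h3.const_mul (frob X ^ 2))
    simp only [sub_self, ne_eq, OfNat.ofNat_ne_zero, not_false_eq_true, zero_pow,
      Finset.sum_const_zero, mul_zero, add_zero] at h4
    refine h4.congr fun t => ?_
    simp only [sqDist, frob_sq_eq_sum, vecNorm_sq]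
    rfl
  -- Insert `u (t + 1) = f (u t)` between `f x` and `x`. The contraction supplies all the continuity
  -- of `f` that is needed.
  have hfix : sqDist X s (f x) x ≤ 0 := by
    have h1 : Filter.Tendsto (fun t => 2 * sqDist X s (u t) x + 2 * sqDist X s (u (t + 1)) x)
        Filter.atTop (nhds (2 * 0 + 2 * 0)) :=
      (hconv.const_mul 2).add ((hconv.comp (Filter.tendsto_add_atTop_nat 1)).const_mul 2)
    rw [mul_zero, add_zero] at h1
    refine ge_of_tendsto' h1 fun t => ?_
    refine (sqDist_triangle X hs _ (u (t + 1)) _).trans ?_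
    have h2 := hcontr hxsym (hsym t)
    rw [← hsucc] at h2
    have h3 : q ^ 2 * sqDist X s x (u t) ≤ 1 * sqDist X s x (u t) :=
      mul_le_mul_of_nonneg_right (by nlinarith) (sqDist_nonneg X hs _ _)
    rw [sqDist_comm X s x (u t)] at h2 h3
    linarith
  obtain ⟨f1, f2, f3⟩ := eq_of_sqDist_eq_zero hn hs hfix
  have f3' : (f x).β = x.β := by
    by_cases hX0 : X = 0
    · exact hfβ hX0 x
    · exact f3 hX0
  have hfix' : f x = x := by
    cases hst : f x
    rw [hst] at f1 f2 f3'
    simp only at f1 f2 f3'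
    rw [f1, f2, f3']
  refine ⟨x, hfix', hβx, fun T => ?_⟩
  induction T with
  | zero => rw [hu0, pow_zero, one_mul]
  | succ T ih =>
    have h1 := hcontr (hsym T) hxsym
    rw [← hsucc, hfix'] at h1
    have h2 := mul_le_mul_of_nonneg_left ih (sq_nonneg q)
    refine (h1.trans h2).trans (le_of_eq ?_)
    ring

/-- The iterates converge linearly to a fixed point of the projected gradient step. -/
lemma exists_fixedPoint (hn : 1 ≤ n) {A X : Matrix (Fin n) (Fin n) ℝ} (hX : X.transpose = X)
    {bG bα bβ lam gam η s r : ℝ} (hbG : 0 ≤ bG) (hbα : 0 ≤ bα) (hbβ : 0 ≤ bβ)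
    (hgam : 0 < gam) (hη : 0 < η) (hη' : η ≤ 2 / 9) (hh : gam * η ≤ 1 / 3)
    (hsr : (s, r) = ((1 : ℝ) / 2, (1 : ℝ)) ∨ (s, r) = (1, 1) ∨ (s, r) = (2, 2)) :
    ∃ x : Iterate n, step A X bG bα bβ lam gam η s r x = x ∧ (X = 0 → x.β = 0) ∧
      ∀ T, sqDist X s (iter A X bG bα bβ lam gam η s r T) x ≤
        ((1 - gam * η) ^ 2) ^ T * sqDist X s ⟨0, 0, 0⟩ x := by
  have hs : 0 < s := by
    rcases hsr with e | e | e <;> rw [Prod.mk.injEq] at e <;> rw [e.1] <;> norm_num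
  refine exists_fixedPoint_of_contraction hn hs (by linarith) (by linarith [mul_pos hgam hη])
    (fun hx hy => sqDist_step_le hn hX hbG hbα hbβ hgam hη hη' hh hsr hx hy)
    (fun x => setG_transpose (nearestPoint_setG hbG _).1) (fun h x => ?_) rfl fun _ => rfl
  simp only [step, if_pos h]

end Contraction

/-! ### Statistical error of the fixed point -/

section FixedPointError

variable {n : ℕ}

lemma frob_outerOne_sq (v : Fin n → ℝ) : frob (outerOne v) ^ 2 = n * vecNorm v ^ 2 := by
  rw [frob_sq_eq_sum, vecNorm_sq, Finset.mul_sum]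
  refine Finset.sum_congr rfl fun i _ => ?_
  simp [outerOne, Matrix.vecMulVec_apply]

/-- The pairing of `W` with the rank-one matrix `v 1ᵀ`, so the operator norm acts without a factor
`√k`. -/
lemma abs_sum_mul_row_sum_le (W : Matrix (Fin n) (Fin n) ℝ) (v : Fin n → ℝ) :
    |∑ i, v i * ∑ j, W i j| ≤ opNorm W * frob (outerOne v) := by
  have h := bilin_le_opNorm W v (fun _ => 1)
  have h1 : frob (outerOne v) = vecNorm v * vecNorm (fun _ : Fin n => (1 : ℝ)) := by
    rw [← sq_eq_sq₀ (frob_nonneg _) (mul_nonneg (vecNorm_nonneg _) (vecNorm_nonneg _)),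
      frob_outerOne_sq, mul_pow, vecNorm_sq (fun _ : Fin n => (1 : ℝ))]
    simp; ring
  rw [h1]
  refine le_of_eq_of_le ?_ h
  congr 1
  refine Finset.sum_congr rfl fun i _ => ?_
  rw [Finset.mul_sum]
  exact Finset.sum_congr rfl fun j _ => by ring

lemma row_sum_eq_zero_of_centered (hn : 1 ≤ n) {G : Matrix (Fin n) (Fin n) ℝ}
    (hG : G.transpose = G) (h : centering n * G = G) (i : Fin n) : ∑ j, G i j = 0 := by
  have hN : (0 : ℝ) < n := by exact_mod_cast hn
  have h1 := congrFun (congrFun h i) i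
  rw [centering, Matrix.sub_mul, Matrix.one_mul, Matrix.sub_apply, Matrix.smul_mul,
    Matrix.smul_apply, Matrix.mul_apply] at h1
  simp only [Matrix.of_apply, one_mul, smul_eq_mul] at h1
  have h2 : 1 / (n : ℝ) * ∑ l, G l i = 0 := by linarith
  have h3 := (mul_eq_zero.1 h2).resolve_left (by positivity)
  rw [← h3]
  exact Finset.sum_congr rfl fun j _ => congrFun (congrFun hG j) i

/-- Centering of `G` makes it orthogonal to `α 1ᵀ` and `1 αᵀ`. The only cross terms of indefinite
sign left involve `X`. -/
lemma frob_thetaMat_sq {X G : Matrix (Fin n) (Fin n) ℝ} (hX : X.transpose = X)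
    (hG : G.transpose = G) (hrow : ∀ i, ∑ j, G i j = 0) (α : Fin n → ℝ) (β : ℝ) :
    frob (thetaMat X G α β) ^ 2 = 2 * frob (outerOne α) ^ 2 + 2 * (∑ i, α i) ^ 2
      + 4 * β * (∑ i, α i * ∑ j, X i j) + β ^ 2 * frob X ^ 2 + 2 * β * frobInner X G
      + frob G ^ 2 := by
  have hΘ : ∀ i j, thetaMat X G α β i j = thetaMat X G α β j i := fun i j =>
    congrFun (congrFun (thetaMat_symm hX hG α β) j) i
  have hX' : ∀ i j, X i j = X j i := fun i j => congrFun (congrFun hX j) i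
  have hG' : ∀ i j, G i j = G j i := fun i j => congrFun (congrFun hG j) i
  have hsum : ∑ i, α i * ∑ j, thetaMat X G α β i j
      = n * vecNorm α ^ 2 + (∑ i, α i) ^ 2 + β * ∑ i, α i * ∑ j, X i j := by
    have h1 : ∀ i, ∑ j, thetaMat X G α β i j = n * α i + ∑ j, α j + β * ∑ j, X i j := fun i => by
      simp only [thetaMat, Matrix.of_apply, Finset.sum_add_distrib, hrow, ← Finset.mul_sum]
      simp
    simp only [h1, mul_add, Finset.sum_add_distrib]
    rw [vecNorm_sq, Finset.mul_sum, Finset.mul_sum, sq (∑ i, α i), Finset.sum_mul]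
    congr 1
    · congr 1
      exact Finset.sum_congr rfl fun i _ => by ring
    · exact Finset.sum_congr rfl fun i _ => by ring
  rw [frob_sq, frobInner_thetaMat hΘ, frobInner_comm (thetaMat X G α β) X,
    frobInner_thetaMat hX', frobInner_comm (thetaMat X G α β) G, frobInner_thetaMat hG', hsum, ← frob_sq, ← frob_sq, frob_outerOne_sq,
    frobInner_comm G X]
  simp only [hrow, mul_zero, Finset.sum_const_zero]
  ring

/-- The variational inequality at a fixed point of the projected gradient step. -/
lemma variational_ineq (hn : 1 ≤ n) {A X : Matrix (Fin n) (Fin n) ℝ}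
    {bG bα bβ lam gam η s r : ℝ} (hbG : 0 ≤ bG) (hbα : 0 ≤ bα) (hbβ : 0 ≤ bβ) (hη : 0 < η)
    (hs : 0 < s) {x y : Iterate n} (hfix : step A X bG bα bβ lam gam η s r x = x)
    (hR : ∀ i j, residual A X x i j = residual A X x j i)
    (hyG : y.G ∈ setG n bG) (hyα : y.α ∈ setAlpha n bα) (hyβ : y.β ∈ setBeta X bβ) :
    0 ≤ frobInner (residual A X x) (thetaMat X (x.G - y.G) (x.α - y.α) (x.β - y.β))
      - lam * (x.G - y.G).trace - gam * (frobInner x.G (x.G - y.G)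
        + 2 * n * (r / s) * (∑ i, x.α i * (x.α - y.α) i) + frob X ^ 2 * (x.β * (x.β - y.β))) := by
  have hN : (0 : ℝ) < n := by exact_mod_cast hn
  set R := residual A X x with hRdef
  have fG : nearestPoint frob (setG n bG)
      (x.G + η • (R - lam • (1 : Matrix (Fin n) (Fin n) ℝ) - gam • x.G)) = x.G :=
    congrArg Iterate.G hfix
  have fα : nearestPoint vecNorm (setAlpha n bα) (fun i =>
      x.α i + η * (s * (∑ j, R i j) / n - r * gam * x.α i)) = x.α := congrArg Iterate.α hfix
  have vG := (nearestPoint_setG hbG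
    (x.G + η • (R - lam • (1 : Matrix (Fin n) (Fin n) ℝ) - gam • x.G))).2 _ hyG
  have vα := (nearestPoint_setAlpha hbα (fun i =>
      x.α i + η * (s * (∑ j, R i j) / n - r * gam * x.α i))).2 _ hyα
  rw [fG] at vG
  rw [fα] at vα
  -- The projection inequalities of the three blocks are divided by `η`, `η * s / (2 * n)` and `η /
  -- frob X ^ 2` respectively. With these normalisations the gradient terms add up to the pairing of
  -- `R` with the difference in `Θ`.
  have h1 : 0 ≤ frobInner R (x.G - y.G) - lam * (x.G - y.G).trace
      - gam * frobInner x.G (x.G - y.G) := by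
    rw [sub_add_cancel_left, ← neg_sub x.G y.G, ← neg_one_smul ℝ (η • _), ← neg_one_smul ℝ (x.G - y.G),
      frobInner_smul_left, frobInner_smul_right, frobInner_smul_left, frobInner_sub_left,
      frobInner_sub_left, frobInner_smul_left, frobInner_smul_left, frobInner_one] at vG
    refine nonneg_of_mul_nonneg_right ?_ hη
    linarith
  have h2 : 0 ≤ 2 * (∑ i, (x.α - y.α) i * ∑ j, R i j)
      - gam * (2 * n * (r / s) * (∑ i, x.α i * (x.α - y.α) i)) := by
    have e : ∑ i, (x.α - fun i => x.α i + η * (s * (∑ j, R i j) / n - r * gam * x.α i)) i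
          * (y.α - x.α) i
        = η * s / (2 * n) * (2 * (∑ i, (x.α - y.α) i * ∑ j, R i j)
          - gam * (2 * n * (r / s) * (∑ i, x.α i * (x.α - y.α) i))) := by
      obtain ⟨ρ, hρ⟩ : ∃ ρ : Fin n → ℝ, ∀ i, ∑ j, R i j = ρ i := ⟨_, fun _ => rfl⟩
      simp only [hρ, Finset.mul_sum, ← Finset.sum_sub_distrib, Pi.sub_apply]
      refine Finset.sum_congr rfl fun i _ => ?_
      field_simp
      ring
    rw [e] at vα
    exact nonneg_of_mul_nonneg_right vα (by positivity)
  have h3 : 0 ≤ (x.β - y.β) * frobInner R X - gam * (frob X ^ 2 * (x.β * (x.β - y.β))) := by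
    by_cases hX0 : X = 0
    · have e1 : frob X ^ 2 = 0 := by rw [frob_sq, hX0]; simp [frobInner]
      have e2 : frobInner R X = 0 := by rw [hX0]; simp [frobInner]
      rw [e1, e2]; simp
    · have hf : 0 < frob X := lt_of_le_of_ne (frob_nonneg _) fun h => hX0 (frob_eq_zero h.symm)
      have fβ : nearestPoint (fun b : ℝ => |b|) (setBeta X bβ)
          (x.β + η * (frobInner R X / frob X ^ 2 - gam * x.β)) = x.β := by
        have := congrArg Iterate.β hfix
        simpa only [step, if_neg hX0] using this
      have vβ := (nearestPoint_setBeta hX0 hbβ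
        (x.β + η * (frobInner R X / frob X ^ 2 - gam * x.β))).2 _ hyβ
      rw [fβ] at vβ
      have e : (x.β - (x.β + η * (frobInner R X / frob X ^ 2 - gam * x.β))) * (y.β - x.β)
          = η / frob X ^ 2 * ((x.β - y.β) * frobInner R X
            - gam * (frob X ^ 2 * (x.β * (x.β - y.β)))) := by
        field_simp
        ring
      rw [e] at vβ
      exact nonneg_of_mul_nonneg_right vβ (by positivity)
  rw [frobInner_thetaMat hR]
  linarith

lemma abs_thetaMat_le {X : Matrix (Fin n) (Fin n) ℝ} {bG bα bβ M : ℝ}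
    (hM : bG + 2 * bα + bβ ≤ M) {x : Iterate n} (hG : x.G ∈ setG n bG)
    (hα : x.α ∈ setAlpha n bα) (hβ : x.β ∈ setBeta X bβ) (i j : Fin n) :
    |thetaMat X x.G x.α x.β i j| ≤ M := by
  have h1 := hG.2.2 i j
  have h2 := hα i
  have h3 := hα j
  have h4 := hβ i j
  rw [← abs_mul] at h4
  simp only [thetaMat, Matrix.of_apply]
  rw [abs_le] at *
  constructor <;> linarith [h1.1, h1.2, h2.1, h2.2, h3.1, h3.2, h4.1, h4.2]

lemma strong_mono_sigmoidDiff {X : Matrix (Fin n) (Fin n) ℝ} {M : ℝ} {x y : Iterate n}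
    (hx : ∀ i j, |thetaMat X x.G x.α x.β i j| ≤ M) (hy : ∀ i j, |thetaMat X y.G y.α y.β i j| ≤ M) :
    Real.exp (-M) / 4 * frob (thetaMat X (x.G - y.G) (x.α - y.α) (x.β - y.β)) ^ 2 ≤
      frobInner (sigmoidDiff X x y) (thetaMat X (x.G - y.G) (x.α - y.α) (x.β - y.β)) := by
  rw [← thetaMat_sub, frob_sq_eq_sum, frobInner, Finset.mul_sum]
  refine Finset.sum_le_sum fun i _ => ?_
  rw [Finset.mul_sum]
  exact Finset.sum_le_sum fun j _ => sigmoid_strong_mono (hx i j) (hy i j)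

/-- The elementary inequality that turns the basic inequality into an error bound. -/
lemma error_bound_of_basic {E lam k sk g a b D F Tc τ : ℝ} (hE : 0 < E)
    (hsk : 0 < sk) (hk : sk ^ 2 = k) (hb : 0 ≤ b)
    (hD : D = g ^ 2 + 2 * a ^ 2 + b ^ 2) (hlam : 0 < lam)
    (hTc : 0 ≤ Tc) (hF0 : 0 ≤ F)
    (hF : D - 1 / 48 * (4 * a * b + 4 * b * g + 2 * b * (Tc + τ) / sk) ≤ F)
    (hbasic : 1 / (4 * E) * F + 3 / 4 * lam * Tc ≤ 3 * lam * sk * (g + a + b) + 2 * lam * τ) :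
    D ≤ 1800 * (E ^ 2 * lam ^ 2 * k + τ ^ 2 / k) := by
  have hk0 : 0 < k := by rw [← hk]; positivity
  -- The cone condition: dropping the nonnegative quadratic term bounds the trace outside the
  -- leading subspace by the errors themselves.
  have hTc1 : Tc ≤ 4 * sk * (g + a + b) + 8 / 3 * τ := by
    have h1 : 0 ≤ 1 / (4 * E) * F := by positivity
    have h2 : lam * (3 / 4 * Tc) ≤ lam * (3 * sk * (g + a + b) + 2 * τ) := by linarith
    have := le_of_mul_le_mul_left h2 hlam
    linarith
  obtain ⟨u, hu⟩ : ∃ u, u = τ / sk := ⟨_, rfl⟩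
  have hτ : τ = u * sk := by rw [hu]; field_simp
  have hu2 : τ ^ 2 / k = u ^ 2 := by rw [hu, div_pow, hk]
  have h3' : 2 * b * (Tc + τ) / sk ≤ 8 * b * (g + a + b) + 8 * (b * |u|) := by
    have hτ' : τ ≤ |u| * sk := by rw [hτ]; exact mul_le_mul_of_nonneg_right (le_abs_self u) hsk.le
    rw [div_le_iff₀ hsk]
    have h4 : 2 * b * (Tc + τ) ≤ 2 * b * (4 * sk * (g + a + b) + 8 / 3 * (|u| * sk) + |u| * sk) :=
      mul_le_mul_of_nonneg_left (by linarith) (by positivity)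
    have h5 : 0 ≤ b * |u| * sk := by positivity
    linarith
  -- With the cone condition the cross terms are at most `a * b / 4 + b * g / 4 + b ^ 2 / 6 + b *
  -- |u| / 6`. After Young's inequality the coefficient of `b ^ 2` is exactly `1 / 2`; this is where
  -- `1 / 48` comes from.
  have hFD : D / 2 - u ^ 2 / 12 ≤ F := by
    have h6 := sq_abs u
    nlinarith [sq_nonneg (a - b), sq_nonneg (b - g), sq_nonneg (b - |u|), sq_nonneg a, sq_nonneg g]
  have h7 : F ≤ 4 * E * (3 * lam * sk * (g + a + b) + 2 * lam * τ) := by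
    have h8 : 1 / (4 * E) * F ≤ 3 * lam * sk * (g + a + b) + 2 * lam * τ := by
      have : 0 ≤ 3 / 4 * lam * Tc := by positivity
      linarith
    rw [one_div, inv_mul_le_iff₀ (by positivity)] at h8
    exact h8
  obtain ⟨w, hw⟩ : ∃ w, w = E * lam * sk := ⟨_, rfl⟩
  have h9 : 4 * E * (3 * lam * sk * (g + a + b) + 2 * lam * τ) = 12 * w * (g + a + b) + 8 * (w * u) := by
    rw [hτ, hw]; ring
  rw [h9] at h7
  have h10 : E ^ 2 * lam ^ 2 * k = w ^ 2 := by rw [hw, ← hk]; ring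
  rw [h10, hu2]
  have h11 : 12 * w * (g + a + b) ≤ 1 / 4 * (g ^ 2 + a ^ 2 + b ^ 2) + 3 * 144 * w ^ 2 := by
    nlinarith [sq_nonneg (g - 24 * w), sq_nonneg (a - 24 * w), sq_nonneg (b - 24 * w)]
  nlinarith [sq_nonneg (w - u), sq_nonneg a]

/-- Write the residual at `x` as the noise `W` at the truth minus `sigmoidDiff`, and test the
variational inequality at `y`. Strong monotonicity bounds the squared error `F` of `Θ`. Outside the
range of `V` the noise uses `lam / 4 * Tc` of the penalty `lam * Tc`; on it both cost `√k` times the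
Frobenius error. The tail of the true matrix enters through its trace `τ`. -/
lemma fixedPoint_error {k : ℕ} (hn : 1 ≤ n) (hk : 1 ≤ k) {A X : Matrix (Fin n) (Fin n) ℝ}
    (hA : ∀ i j, A i j = A j i) (hX : X.transpose = X)
    (hXk : 2304 * k * opNorm X ^ 2 ≤ frob X ^ 2) {M K : ℝ} (hK : 0 ≤ K)
    {bG bα bβ lam gam η s r : ℝ} (hbG : 0 ≤ bG) (hbα : 0 ≤ bα) (hbβ : 0 ≤ bβ)
    (hM : bG + 2 * bα + bβ ≤ M) (hlam : 0 < lam) (hgam : 0 < gam) (hη : 0 < η)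
    (hsr : (s, r) = ((1 : ℝ) / 2, (1 : ℝ)) ∨ (s, r) = (1, 1) ∨ (s, r) = (2, 2))
    {x y : Iterate n} (hfix : step A X bG bα bβ lam gam η s r x = x) (hxβ : X = 0 → x.β = 0)
    (hyG : y.G ∈ setG n bG) (hyα : y.α ∈ setAlpha n bα) (hyβ : y.β ∈ setBeta X bβ)
    {Z V : Matrix (Fin n) (Fin k) ℝ} {e : Fin k → ℝ} (hT : TopData k y.G Z V e)
    (hW : opNorm (residual A X y) ≤ lam / 4)
    (hWX : |frobInner (residual A X y) X| ≤ lam / 4 * frob X)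
    (hreg : gam * frob y.G * (4 * K + 1) ≤ lam * √k)
    (hKα : frob (outerOne y.α) ≤ K * frob y.G) (hKβ : frob (y.β • X) ≤ K * frob y.G) :
    frob (x.G - y.G) ^ 2 + 2 * frob (outerOne (x.α - y.α)) ^ 2 + frob ((x.β - y.β) • X) ^ 2 ≤
      1800 * (Real.exp M ^ 2 * lam ^ 2 * k + (y.G - Z * Z.transpose).trace ^ 2 / k) := by
  have hs : 0 < s := by
    rcases hsr with e | e | e <;> rw [Prod.mk.injEq] at e <;> rw [e.1] <;> norm_num
  have hrs : 1 ≤ r / s ∧ r / s ≤ 2 := by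
    rcases hsr with e | e | e <;> rw [Prod.mk.injEq] at e <;> rw [e.1, e.2] <;> norm_num
  have hN : (0 : ℝ) < n := by exact_mod_cast hn
  have hk1 : (1 : ℝ) ≤ k := by exact_mod_cast hk
  have hsk1 : 1 ≤ √(k : ℝ) := Real.one_le_sqrt.2 hk1
  have hxG : x.G ∈ setG n bG := by
    rw [← hfix]; exact (nearestPoint_setG hbG _).1
  have hxα : x.α ∈ setAlpha n bα := by
    rw [← hfix]; exact (nearestPoint_setAlpha hbα _).1
  have hxβ' : x.β ∈ setBeta X bβ := by
    by_cases hX0 : X = 0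
    · intro i j; rw [hxβ hX0]; simpa using hbβ
    · rw [← hfix]; simp only [step, if_neg hX0]; exact (nearestPoint_setBeta hX0 hbβ _).1
  have hxs := setG_transpose hxG
  have hys := setG_transpose hyG
  have hsymres : ∀ z : Iterate n, z.G.transpose = z.G → ∀ i j,
      residual A X z i j = residual A X z j i := fun z hz i j => by
    have h := congrFun (congrFun (thetaMat_symm hX hz z.α z.β) i) j
    simp only [Matrix.transpose_apply] at h
    simp only [residual, Matrix.sub_apply, Matrix.map_apply, hA i j, h]
  have hvi := variational_ineq hn hbG hbα hbβ hη hs hfix (hsymres x hxs) hyG hyα hyβ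
  set W := residual A X y with hWdef
  have hres : residual A X x = W - sigmoidDiff X x y := by
    have := residual_sub A X x y
    rw [← hWdef] at this
    rw [sub_eq_add_neg, ← this]; abel
  rw [hres, frobInner_sub_left] at hvi
  have hmono := strong_mono_sigmoidDiff (abs_thetaMat_le hM hxG hxα hxβ')
    (abs_thetaMat_le hM hyG hyα hyβ)
  rw [frobInner_thetaMat (hsymres y hys)] at hvi
  have hΔs : (x.G - y.G).transpose = x.G - y.G := by rw [Matrix.transpose_sub, hxs, hys]
  have hΔrow : ∀ i, ∑ j, (x.G - y.G) i j = 0 :=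
    row_sum_eq_zero_of_centered hn hΔs (by rw [Matrix.mul_sub, hxG.2.1, hyG.2.1])
  have hFeq := frob_thetaMat_sq hX hΔs hΔrow (x.α - y.α) (x.β - y.β)
  set F := frob (thetaMat X (x.G - y.G) (x.α - y.α) (x.β - y.β)) ^ 2 with hFdef
  set g := frob (x.G - y.G) with hg
  set a := frob (outerOne (x.α - y.α)) with ha
  set b := frob ((x.β - y.β) • X) with hb
  have hg0 : 0 ≤ g := frob_nonneg _
  have ha0 : 0 ≤ a := frob_nonneg _
  have hb0 : 0 ≤ b := frob_nonneg _
  have hbX : b = |x.β - y.β| * frob X := frob_smul _ _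
  set τ := (y.G - Z * Z.transpose).trace with hτ
  have hcomp : compress V y.G = y.G - Z * Z.transpose := hT.compress_eq hys
  set Tc := (compress V x.G).trace with hTc
  have hTc0 : 0 ≤ Tc := (compress_posSemidef (V := V) hxG.1).trace_nonneg
  have htr : (x.G - y.G).trace = (V * V.transpose * (x.G - y.G)).trace + (Tc - τ) := by
    rw [trace_eq_proj_add_compress hT.ortho, compress_sub, Matrix.trace_sub, hcomp]
  have htr' := (abs_le.1 (abs_trace_proj_mul_le hT.ortho (x.G - y.G))).1
  have hWG : |frobInner W (x.G - y.G)| ≤ opNorm W * (2 * √k * g + Tc + τ) := by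
    have := abs_frobInner_sub_le hT.ortho W hxG.1 hyG.1
    rwa [hcomp] at this
  have hXG : |frobInner X (x.G - y.G)| ≤ opNorm X * (2 * √k * g + Tc + τ) := by
    have := abs_frobInner_sub_le hT.ortho X hxG.1 hyG.1
    rwa [hcomp] at this
  have hτ0 : 0 ≤ τ := by
    rw [hτ, ← hcomp]; exact (compress_posSemidef (V := V) hyG.1).trace_nonneg
  have hpos : 0 ≤ 2 * √k * g + Tc + τ := by positivity
  -- noise terms
  have n1 : frobInner W (x.G - y.G) ≤ lam / 4 * (2 * √k * g + Tc + τ) :=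
    (le_abs_self _).trans (hWG.trans (mul_le_mul_of_nonneg_right hW hpos))
  have n2 : ∑ i, (x.α - y.α) i * ∑ j, W i j ≤ lam / 4 * a :=
    (le_abs_self _).trans ((abs_sum_mul_row_sum_le W _).trans (mul_le_mul_of_nonneg_right hW ha0))
  have n3 : (x.β - y.β) * frobInner W X ≤ lam / 4 * b := by
    refine (le_abs_self _).trans ?_
    rw [abs_mul, hbX]
    have := mul_le_mul_of_nonneg_left hWX (abs_nonneg (x.β - y.β))
    linarith
  -- regularisation terms
  have r1 : -(frob y.G * g) ≤ frobInner x.G (x.G - y.G) := by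
    have h1 := frobInner_sub_left x.G y.G (x.G - y.G)
    rw [← frob_sq] at h1
    have h2 := (abs_le.1 (abs_frobInner_le y.G (x.G - y.G))).1
    linarith [sq_nonneg (frob (x.G - y.G))]
  have r2 : -(2 * 2 * (K * frob y.G) * a) ≤ 2 * n * (r / s) * (∑ i, x.α i * (x.α - y.α) i) := by
    have h1 : ∑ i, x.α i * (x.α - y.α) i
        = vecNorm (x.α - y.α) ^ 2 + ∑ i, y.α i * (x.α - y.α) i := by
      rw [vecNorm_sq, ← Finset.sum_add_distrib]
      exact Finset.sum_congr rfl fun i _ => by simp only [Pi.sub_apply]; ring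
    have h2 := (abs_le.1 (dot_le_vecNorm y.α (x.α - y.α))).1
    have h3 : (n : ℝ) * (vecNorm y.α * vecNorm (x.α - y.α)) = frob (outerOne y.α) * a := by
      have e1 : ∀ v : Fin n → ℝ, frob (outerOne v) = √n * vecNorm v := fun v => by
        rw [← sq_eq_sq₀ (frob_nonneg _) (mul_nonneg (Real.sqrt_nonneg _) (vecNorm_nonneg _)),
          frob_outerOne_sq, mul_pow, Real.sq_sqrt hN.le]
      rw [ha, e1, e1]
      have := Real.mul_self_sqrt hN.le
      linear_combination -(vecNorm y.α * vecNorm (x.α - y.α)) * this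
    have h4 : -(frob (outerOne y.α) * a) ≤ n * ∑ i, x.α i * (x.α - y.α) i := by
      rw [h1, ← h3, mul_add]
      have := mul_le_mul_of_nonneg_left h2 hN.le
      have : 0 ≤ (n : ℝ) * vecNorm (x.α - y.α) ^ 2 := by positivity
      linarith
    have h5 : frob (outerOne y.α) * a ≤ K * frob y.G * a := mul_le_mul_of_nonneg_right hKα ha0
    have h6 : 0 ≤ K * frob y.G * a := mul_nonneg (mul_nonneg hK (frob_nonneg _)) ha0
    have h7 := mul_le_mul_of_nonneg_left (h4.trans' (neg_le_neg h5))
      (show 0 ≤ 2 * (r / s) by linarith [hrs.1])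
    have h8 := mul_le_mul_of_nonneg_right hrs.2 h6
    linarith
  have r3 : -(K * frob y.G * b) ≤ frob X ^ 2 * (x.β * (x.β - y.β)) := by
    have h1 : |y.β| * frob X ≤ K * frob y.G := by rw [← frob_smul]; exact hKβ
    have h2 := mul_le_mul_of_nonneg_right h1 hb0
    have h3 : -(|y.β| * |x.β - y.β|) ≤ y.β * (x.β - y.β) := by
      rw [← abs_mul]; exact neg_abs_le _
    have h4 := mul_le_mul_of_nonneg_left h3 (sq_nonneg (frob X))
    have h5 : 0 ≤ frob X ^ 2 * (x.β - y.β) ^ 2 := by positivity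
    have h6 : K * frob y.G * b = K * frob y.G * |x.β - y.β| * frob X := by rw [hbX]; ring
    have h7 : |y.β| * frob X * b = frob X ^ 2 * (|y.β| * |x.β - y.β|) := by rw [hbX]; ring
    have h8 : frob X ^ 2 * (x.β * (x.β - y.β)) = frob X ^ 2 * (y.β * (x.β - y.β))
      + frob X ^ 2 * (x.β - y.β) ^ 2 := by ring
    linarith
  -- Up to nonnegative squares, the ridge only adds the bias of shrinking the true parameter to
  -- zero, with coefficients 1, `4 * K` and `K` times `frob y.G`; hence the factor `4 * K + 1` in
  -- `hreg`.
  have hregsum : -(gam * (frobInner x.G (x.G - y.G)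
        + 2 * n * (r / s) * (∑ i, x.α i * (x.α - y.α) i) + frob X ^ 2 * (x.β * (x.β - y.β))))
      ≤ lam * √k * (g + a + b) := by
    have hG0 : 0 ≤ frob y.G := frob_nonneg _
    have h1 : -(frobInner x.G (x.G - y.G)
        + 2 * n * (r / s) * (∑ i, x.α i * (x.α - y.α) i) + frob X ^ 2 * (x.β * (x.β - y.β)))
        ≤ frob y.G * (4 * K + 1) * (g + a + b) := by
      have p1 : 0 ≤ frob y.G * K * g := by positivity
      have p2 : 0 ≤ frob y.G * a := by positivity
      have p3 : 0 ≤ frob y.G * b := by positivity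
      have p4 : 0 ≤ frob y.G * K * b := by positivity
      linarith
    have h2 := mul_le_mul_of_nonneg_left h1 hgam.le
    have h3 := mul_le_mul_of_nonneg_right hreg (show 0 ≤ g + a + b by positivity)
    linarith
  have hbasic : 1 / (4 * Real.exp M) * F + 3 / 4 * lam * Tc
      ≤ 3 * lam * √k * (g + a + b) + 2 * lam * τ := by
    have h1 : Real.exp (-M) / 4 = 1 / (4 * Real.exp M) := by
      rw [Real.exp_neg]; field_simp
    rw [h1] at hmono
    have h2 := mul_le_mul_of_nonneg_left htr' hlam.le
    rw [htr] at hvi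
    have h3 : lam * a ≤ lam * √k * a := by
      have := mul_le_mul_of_nonneg_left hsk1 (mul_nonneg hlam.le ha0); linarith
    have h4 : lam * b ≤ lam * √k * b := by
      have := mul_le_mul_of_nonneg_left hsk1 (mul_nonneg hlam.le hb0); linarith
    have h5 : 0 ≤ lam * √k * a := by positivity
    have h6 : 0 ≤ lam * √k * b := by positivity
    have h7 : 0 ≤ lam * √k * g := by positivity
    have h8 : 0 ≤ lam * τ := by positivity
    linarith
  -- lower bound for `F`
  have hsk0 : 0 < √(k : ℝ) := by linarith
  -- The constant 2304 is `48 ^ 2`.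
  have hβX : |x.β - y.β| * opNorm X ≤ 1 / 48 * (b / √k) := by
    have h1 : 48 * √k * opNorm X ≤ frob X := by
      refine abs_le_of_sq_le_sq' ?_ (frob_nonneg _) |>.2
      rw [mul_pow, mul_pow, Real.sq_sqrt (by positivity)]
      linarith
    have h2 := mul_le_mul_of_nonneg_left h1 (abs_nonneg (x.β - y.β))
    rw [← hbX] at h2
    rw [← mul_div_assoc, le_div_iff₀ hsk0]
    linarith
  have hF : (g ^ 2 + 2 * a ^ 2 + b ^ 2) - 1 / 48 * (4 * a * b + 4 * b * g + 2 * b * (Tc + τ) / √k)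
      ≤ F := by
    have hb2 : b ^ 2 = (x.β - y.β) ^ 2 * frob X ^ 2 := by rw [hbX, mul_pow, sq_abs]
    have c1 : -(1 / 48 * (b * a)) ≤ (x.β - y.β) * ∑ i, (x.α - y.α) i * ∑ j, X i j := by
      refine le_trans ?_ (neg_abs_le _)
      rw [neg_le_neg_iff, abs_mul]
      refine (mul_le_mul_of_nonneg_left (abs_sum_mul_row_sum_le X _) (abs_nonneg _)).trans ?_
      rw [← mul_assoc]
      refine (mul_le_mul_of_nonneg_right hβX ha0).trans ?_
      have : b / √k ≤ b := div_le_self hb0 hsk1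
      have := mul_le_mul_of_nonneg_right this ha0
      linarith
    have c2 : -(1 / 48 * (2 * b * g + b * (Tc + τ) / √k)) ≤ (x.β - y.β) * frobInner X (x.G - y.G) := by
      refine le_trans ?_ (neg_abs_le _)
      rw [neg_le_neg_iff, abs_mul]
      refine (mul_le_mul_of_nonneg_left hXG (abs_nonneg _)).trans ?_
      rw [← mul_assoc]
      refine (mul_le_mul_of_nonneg_right hβX hpos).trans (le_of_eq ?_)
      field_simp
      ring
    have c3 : 2 * b * (Tc + τ) / √k = 2 * (b * (Tc + τ) / √k) := by ring
    rw [hFeq, c3, hb2]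
    linarith [sq_nonneg (∑ i, (x.α - y.α) i)]
  exact error_bound_of_basic (Real.exp_pos M) hsk0 (Real.sq_sqrt (by positivity)) hb0 rfl hlam hTc0
    (sq_nonneg _) hF hbasic

end FixedPointError

/-! ### Error of the iterates -/

section IterateError

variable {n k : ℕ}

/-- Test the quadratic form at `e i ± e j`. This places the true matrix, whose diagonal alone is
bounded, in the constraint set of the algorithm. -/
lemma abs_apply_le_of_posSemidef {G : Matrix (Fin n) (Fin n) ℝ} (hG : G.PosSemidef) {b : ℝ}
    (hb : ∀ i, G i i ≤ b) (i j : Fin n) : |G i j| ≤ b := by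
  have hs : G j i = G i j := by
    have := congrFun (congrFun hG.isHermitian i) j
    simpa using this
  have key : ∀ c : ℝ, c ^ 2 = 1 → 0 ≤ G i i + G j j + 2 * c * G i j := fun c hc => by
    have h := (Matrix.posSemidef_iff_dotProduct_mulVec.1 hG).2 (Pi.single i 1 + Pi.single j c)
    simp only [star_trivial, Matrix.mulVec_add, add_dotProduct, dotProduct_add,
      single_dotProduct, Matrix.mulVec_single, one_mul] at h
    simp [Matrix.col_apply, hs] at h
    have h' : c * (G j j * c) = G j j := by linear_combination G j j * hc
    linarith
  have h1 := key 1 (by norm_num)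
  have h2 := key (-1) (by norm_num)
  have h3 := hb i
  have h4 := hb j
  rw [abs_le]
  constructor <;> linarith

lemma vecNorm_single (a : Fin n) : vecNorm (Pi.single a (1 : ℝ)) = 1 := by
  rw [vecNorm, Real.sqrt_eq_one, Finset.sum_eq_single a]
  · simp
  · intro b _ hb; simp [hb]
  · simp

namespace TopData

variable {G : Matrix (Fin n) (Fin n) ℝ} {Z V : Matrix (Fin n) (Fin k) ℝ} {e : Fin k → ℝ}

lemma opNorm_eq_sq (h : TopData k G Z V e) (he : Antitone e) (hk : 1 ≤ k) :
    opNorm G = opNorm Z ^ 2 := by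
  set a : Fin k := ⟨0, hk⟩ with ha
  have hmax : ∀ b, e b ≤ e a := fun b => he (Fin.le_def.2 (Nat.zero_le _))
  have h1 : opNorm G ≤ e a := h.opNorm_le a hmax
  have h2 : e a ≤ opNorm Z ^ 2 := by
    have e1 := h.gram (Pi.single a 1)
    rw [Finset.sum_eq_single a (fun b _ hb => by simp [hb]) (by simp)] at e1
    have e2 := pow_le_pow_left₀ (vecNorm_nonneg _) (vecNorm_mulVec_le Z (Pi.single a 1)) 2
    rw [vecNorm_single, mul_one] at e2
    rw [e1] at e2
    simpa using e2
  have h3 : opNorm Z ^ 2 ≤ e a := by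
    have : opNorm Z ≤ √(e a) := by
      refine opNorm_le_of_mulVec Z (Real.sqrt_nonneg _) fun v => ?_
      refine abs_le_of_sq_le_sq' ?_ (mul_nonneg (Real.sqrt_nonneg _) (vecNorm_nonneg _)) |>.2
      rw [mul_pow, Real.sq_sqrt (h.nonneg a), h.gram, vecNorm_sq, Finset.mul_sum]
      exact Finset.sum_le_sum fun b _ => mul_le_mul_of_nonneg_right (hmax b) (sq_nonneg _)
    have := pow_le_pow_left₀ (opNorm_nonneg _) this 2
    rwa [Real.sq_sqrt (h.nonneg a)] at this
  have h4 : e a ≤ opNorm G := by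
    have e1 := vecNorm_mulVec_le G (fun i => V i a)
    rw [vecNorm_col_eq_one h.ortho, mul_one] at e1
    have e2 : G.mulVec (fun i => V i a) = e a • fun i => V i a := by
      funext i
      have := congrFun (congrFun h.eigen i) a
      rw [Matrix.mul_diagonal] at this
      rw [Pi.smul_apply, smul_eq_mul, mul_comm, ← this]
      rfl
    rwa [e2, vecNorm_smul, vecNorm_col_eq_one h.ortho, mul_one, abs_of_nonneg (h.nonneg a)] at e1
  linarith

lemma frob_factor_le (h : TopData k G Z V e) : frob (Z * Z.transpose) ≤ √k * opNorm G := by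
  have h1 := (abs_le.1 (abs_frobInner_mul_proj_le h.ortho G (Z * Z.transpose))).2
  have h2 : frobInner G (Z * Z.transpose * (V * V.transpose)) = frob (Z * Z.transpose) ^ 2 := by
    rw [frobInner_mul_right, proj_transpose, h.mul_proj, frob_sq]
  rw [h2] at h1
  by_contra hlt
  push Not at hlt
  have : 0 ≤ √k * opNorm G := mul_nonneg (Real.sqrt_nonneg _) (opNorm_nonneg _)
  nlinarith

end TopData

lemma singVal_le_opNorm (hk : 1 ≤ k) (Z : Matrix (Fin n) (Fin k) ℝ) :
    singVal Z (k - 1) ≤ opNorm Z := by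
  refine abs_le_of_sq_le_sq' ?_ (opNorm_nonneg _) |>.2
  have h1 := singVal_sq_mul_le hk Z (Pi.single ⟨0, hk⟩ 1)
  have h2 := pow_le_pow_left₀ (vecNorm_nonneg _)
    (vecNorm_mulVec_le Z (Pi.single (⟨0, hk⟩ : Fin k) 1)) 2
  rw [vecNorm_single] at h1 h2
  linarith

/-- Squared error of an iterate in the metric of the error bound. -/
noncomputable def sqErr (X : Matrix (Fin n) (Fin n) ℝ) (x y : Iterate n) : ℝ :=
  frob (x.G - y.G) ^ 2 + 2 * frob (outerOne (x.α - y.α)) ^ 2 + frob ((x.β - y.β) • X) ^ 2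

lemma sqErr_eq_sqDist (X : Matrix (Fin n) (Fin n) ℝ) (x y : Iterate n) :
    sqErr X x y = sqDist X 1 x y := by
  rw [sqErr, sqDist, frob_outerOne_sq, frob_smul, mul_pow, sq_abs]; ring

lemma sqErr_triangle (X : Matrix (Fin n) (Fin n) ℝ) (x y z : Iterate n) :
    sqErr X x z ≤ 2 * sqErr X x y + 2 * sqErr X y z := by
  simp only [sqErr_eq_sqDist]; exact sqDist_triangle X one_pos x y z

lemma sqErr_comm (X : Matrix (Fin n) (Fin n) ℝ) (x y : Iterate n) :
    sqErr X x y = sqErr X y x := by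
  simp only [sqErr_eq_sqDist]; exact sqDist_comm X 1 x y

lemma sqErr_le_sqDist (X : Matrix (Fin n) (Fin n) ℝ) {s : ℝ} (hs : 1 / 2 ≤ s) (hs2 : s ≤ 2)
    (x y : Iterate n) : sqErr X x y ≤ 2 * sqDist X s x y ∧ sqDist X s x y ≤ 2 * sqErr X x y := by
  rw [sqErr_eq_sqDist]
  have hs0 : 0 < s := by linarith
  have h1 : 0 ≤ n * vecNorm (x.α - y.α) ^ 2 := by positivity
  have h2 : 0 ≤ frob (x.G - y.G) ^ 2 := sq_nonneg _
  have h3 : 0 ≤ frob X ^ 2 * (x.β - y.β) ^ 2 := by positivity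
  have h4 : 1 / 2 ≤ 1 / s := one_div_le_one_div_of_le hs0 hs2
  have h5 : 1 / s ≤ 2 := by rw [div_le_iff₀ hs0]; linarith
  have h6 := mul_le_mul_of_nonneg_right h4 h1
  have h7 := mul_le_mul_of_nonneg_right h5 h1
  have e : 2 * n / s * vecNorm (x.α - y.α) ^ 2 = 2 * (1 / s * (n * vecNorm (x.α - y.α) ^ 2)) := by
    ring
  have e' : 2 * n / 1 * vecNorm (x.α - y.α) ^ 2 = 2 * (n * vecNorm (x.α - y.α) ^ 2) := by ring
  unfold sqDist
  rw [e, e']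
  constructor <;> linarith

lemma pow_le_one_div_of_log {q Y : ℝ} (hq0 : 0 < q) (hq1 : q < 1) (hY : 0 < Y) {T : ℕ}
    (hT : Real.log Y * (Real.log (1 / q))⁻¹ ≤ T) : q ^ T ≤ 1 / Y := by
  have hl : 0 < Real.log (1 / q) := Real.log_pos (by rw [lt_div_iff₀ hq0]; linarith)
  rw [← div_eq_mul_inv, div_le_iff₀ hl, one_div, Real.log_inv] at hT
  rw [← Real.log_le_log_iff (by positivity) (by positivity), Real.log_pow, one_div, Real.log_inv]
  linarith

/-- By Eckart–Young both `ZT * ZT.transpose` and `Z * Z.transpose` are within `frob (x.G - Z *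
Z.transpose)` of `x.G`, so no eigengap enters. In `procrustes_sq_le` the smallest singular value
cancels against `opNorm Z = condNum Z * singVal Z (k - 1)`, leaving `condNum Z ^ 2`; the constant is
`3 / 2 * 4 * 2 = 12`. -/
lemma errMetric_le (hk : 1 ≤ k) {X : Matrix (Fin n) (Fin n) ℝ} {x y : Iterate n}
    {Z ZT : Matrix (Fin n) (Fin k) ℝ} (hx : x.G.PosSemidef) (hy : y.G.PosSemidef)
    (hZ : IsTopFactor k y.G Z) (hZT : IsTopFactor k x.G ZT) (hσ : 0 < singVal Z (k - 1)) :
    errMetric X Z y.α y.β ZT x.α x.β ≤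
      12 * condNum Z ^ 2 * (sqErr X x y + frob (y.G - Z * Z.transpose) ^ 2) := by
  obtain ⟨V, e, hT, -⟩ := hZ.topData hk hy
  obtain ⟨V', e', hT', -⟩ := hZT.topData hk hx
  have hxs : x.G.transpose = x.G := by
    have := hx.isHermitian
    rwa [Matrix.IsHermitian, Matrix.conjTranspose_eq_transpose_of_trivial] at this
  have hκ1 : 1 ≤ condNum Z := (one_le_div hσ).2 (singVal_le_opNorm hk Z)
  have hz : opNorm Z = condNum Z * singVal Z (k - 1) := by
    rw [condNum, div_mul_cancel₀ _ hσ.ne']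
  have h1 := procrustes_sq_le ZT Z (σ := singVal Z (k - 1)) (singVal_sq_mul_le hk Z)
  have h2 : frob (ZT * ZT.transpose - Z * Z.transpose) ≤
      2 * (frob (x.G - y.G) + frob (y.G - Z * Z.transpose)) := by
    have e1 := hT'.frob_sub_factor_le hxs hT
    have e2 : x.G - Z * Z.transpose = (x.G - y.G) + (y.G - Z * Z.transpose) := by abel
    have e3 : ZT * ZT.transpose - Z * Z.transpose
        = (x.G - Z * Z.transpose) - (x.G - ZT * ZT.transpose) := by abel
    rw [e3]
    have e4 := frob_add_le (x.G - y.G) (y.G - Z * Z.transpose)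
    rw [← e2] at e4
    exact (frob_sub_le _ _).trans (by linarith)
  have h3 := pow_le_pow_left₀ (frob_nonneg _) h2 2
  set f := frob (x.G - y.G) with hf
  set g := frob (y.G - Z * Z.transpose) with hg
  have h4 : singVal Z (k - 1) ^ 2 * procrustes ZT Z ^ 2 ≤ 12 * (f ^ 2 + g ^ 2) := by
    nlinarith [sq_nonneg (f - g)]
  have h5 := mul_le_mul_of_nonneg_left h4 (sq_nonneg (condNum Z))
  have h6 : opNorm Z ^ 2 * procrustes ZT Z ^ 2 ≤ 12 * condNum Z ^ 2 * (f ^ 2 + g ^ 2) := by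
    rw [hz]; linarith
  have h7 : 1 ≤ condNum Z ^ 2 := one_le_pow₀ hκ1
  have h8 : 0 ≤ 2 * frob (outerOne (x.α - y.α)) ^ 2 + frob ((x.β - y.β) • X) ^ 2 := by positivity
  have h9 := mul_le_mul_of_nonneg_right h7 h8
  unfold errMetric sqErr
  linarith

/-- The squared distance decays like `q ^ (2 * T)`; one factor `q ^ T` is bounded by `1 / Y` and the
other by 1. Changing between `sqErr` and `sqDist` costs 2 each way, and so does each of the two
triangle inequalities, hence 16. -/
lemma sqErr_le_of_linear_convergence {X : Matrix (Fin n) (Fin n) ℝ} {x y xT : Iterate n}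
    {s q c ε D Y : ℝ} {T : ℕ} (hs : 1 / 2 ≤ s) (hs' : s ≤ 2)
    (hconv : sqDist X s xT x ≤ (q ^ 2) ^ T * sqDist X s ⟨0, 0, 0⟩ x)
    (hstat : sqErr X x y ≤ ε) (hinit : sqErr X ⟨0, 0, 0⟩ y ≤ (4 + c) * D) (hε : ε ≤ D)
    (hq0 : 0 < q) (hq1 : q < 1) (hY : 0 < Y)
    (hT : Real.log Y * (Real.log (1 / q))⁻¹ ≤ T) :
    sqErr X xT y ≤ 16 * ((5 + c) * D / Y) + 2 * ε := by
  have hdist0 : sqErr X ⟨0, 0, 0⟩ x ≤ 2 * ((5 + c) * D) := by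
    have h1 := sqErr_triangle X ⟨0, 0, 0⟩ y x
    rw [sqErr_comm X y x] at h1
    linarith
  have hqT : (q ^ 2) ^ T ≤ 1 / Y := by
    have h1 := pow_le_one_div_of_log hq0 hq1 hY hT
    have h2 : q ^ T ≤ 1 := pow_le_one₀ hq0.le hq1.le
    have h3 : (q ^ 2) ^ T = q ^ T * q ^ T := by rw [← pow_mul, mul_comm 2 T, pow_mul, sq]
    rw [h3]
    exact (mul_le_of_le_one_right (by positivity) h2).trans h1
  have h1 := (sqErr_le_sqDist X hs hs' xT x).1
  have h3 := (sqErr_le_sqDist X hs hs' ⟨0, 0, 0⟩ x).2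
  have h4 : (q ^ 2) ^ T * sqDist X s ⟨0, 0, 0⟩ x ≤ 1 / Y * (2 * (2 * ((5 + c) * D))) :=
    mul_le_mul hqT (by linarith) (sqDist_nonneg X (by linarith) _ _) (by positivity)
  have h5 : 1 / Y * (2 * (2 * ((5 + c) * D))) = 4 * ((5 + c) * D / Y) := by ring
  have h6 := sqErr_triangle X xT x y
  linarith

set_option maxHeartbeats 800000 in
/-- The error bound for the iterates on the event that the noise matrix is small. -/
lemma errMetric_iter_le (hn : 1 ≤ n) (hk : 1 ≤ k) {A X : Matrix (Fin n) (Fin n) ℝ}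
    (hA : ∀ i j, A i j = A j i) (hX : X.transpose = X)
    (hXk : 2304 * k * opNorm X ^ 2 ≤ frob X ^ 2) {M K c₀ c₁ : ℝ} (hM0 : 0 ≤ M) (hK : 0 ≤ K)
    (hc₁ : 0 < c₁) (hc₀ : 0 < c₀) (hc : c₀ ≤ 1 / 500) (hc' : c₀ ≤ c₁ / 500)
    {bG bα bβ lam gam η s r : ℝ} (hbG : 0 ≤ bG) (hbα : 0 ≤ bα) (hbβ : 0 ≤ bβ)
    (hM : bG + 2 * bα + bβ ≤ M) (hlam : 0 < lam) (hgam : 0 < gam) (hη : 0 < η) (hη' : η ≤ 2 / 9)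
    (hsr : (s, r) = ((1 : ℝ) / 2, (1 : ℝ)) ∨ (s, r) = (1, 1) ∨ (s, r) = (2, 2))
    {y : Iterate n} (hyG : y.G ∈ setG n bG) (hyα : y.α ∈ setAlpha n bα)
    (hyβ : y.β ∈ setBeta X bβ) {Z : Matrix (Fin n) (Fin k) ℝ} (hZ : IsTopFactor k y.G Z)
    (hσ : 0 < singVal Z (k - 1))
    (hW : opNorm (residual A X y) ≤ lam / 4)
    (hWX : |frobInner (residual A X y) X| ≤ lam / 4 * frob X)
    (hKα : frob (outerOne y.α) ≤ K * frob y.G) (hKβ : frob (y.β • X) ≤ K * frob y.G)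
    (hlam' : lam ≤ c₀ * opNorm y.G / (Real.exp (2 * M) * √k * condNum Z ^ 3))
    (hgam' : gam ≤ 1 / (2 * (4 * K + 1)) * lam / opNorm y.G)
    (hnuc : condNum Z ^ 6 * Real.exp (2 * M) * (nuclearNorm (y.G - Z * Z.transpose) ^ 2 / k) ≤
      c₀ ^ 2 * opNorm y.G ^ 2)
    (hfro : condNum Z ^ 6 * Real.exp (2 * M) * frob (y.G - Z * Z.transpose) ^ 2 ≤
      c₀ ^ 2 * opNorm y.G ^ 2)
    {T : ℕ} (hT : Real.log (384 * (5 + 12 * K ^ 2) * Real.exp (2 * M) * k * condNum Z ^ 6 / c₁ ^ 2) *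
      (Real.log (1 / (1 - gam * η)))⁻¹ ≤ T)
    {ZT : Matrix (Fin n) (Fin k) ℝ}
    (hZT : IsTopFactor k (iter A X bG bα bβ lam gam η s r T).G ZT) :
    errMetric X Z y.α y.β ZT (iter A X bG bα bβ lam gam η s r T).α
        (iter A X bG bα bβ lam gam η s r T).β ≤
      c₁ ^ 2 * Real.exp (-2 * M) * opNorm Z ^ 4 / condNum Z ^ 4 := by
  obtain ⟨V, e, hTD, hanti⟩ := hZ.topData hk hyG.1
  have hk1 : (1 : ℝ) ≤ k := by exact_mod_cast hk
  have hk0 : (0 : ℝ) < k := by linarith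
  have hsk1 : 1 ≤ √(k : ℝ) := Real.one_le_sqrt.2 hk1
  have hsk2 : √(k : ℝ) ^ 2 = k := Real.sq_sqrt hk0.le
  have hGz := hTD.opNorm_eq_sq hanti hk
  have hκ1 : 1 ≤ condNum Z := (one_le_div hσ).2 (singVal_le_opNorm hk Z)
  have hG0 : 0 < opNorm y.G := by
    rw [hGz]; exact pow_pos (hσ.trans_le (singVal_le_opNorm hk Z)) 2
  obtain ⟨p, hp⟩ : ∃ p, p = Real.exp (2 * M) := ⟨_, rfl⟩
  have hp1 : 1 ≤ p := by rw [hp]; exact Real.one_le_exp (by linarith)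
  have hpM : Real.exp M ^ 2 = p := by rw [hp, ← Real.exp_nat_mul]; norm_num
  have hpM' : Real.exp (-2 * M) = 1 / p := by
    rw [hp, one_div, ← Real.exp_neg]; congr 1; ring
  set κ := condNum Z with hκ
  set g := opNorm y.G with hg
  rw [← hp] at hlam' hnuc hfro hT
  rw [hpM', show opNorm Z ^ 4 = g ^ 2 by rw [hGz]; ring]
  -- `B` is the common unit of the squared errors: the contributions of the penalty level, the trace
  -- of the tail and its Frobenius norm are each at most `c₀ ^ 2 * B`. The target is `c₁ ^ 2 * κ ^ 2
  -- * B`, the factor `κ ^ 2` being the loss in `errMetric_le`.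
  obtain ⟨B, hB⟩ : ∃ B, B = g ^ 2 / (p * κ ^ 6) := ⟨_, rfl⟩
  have hκ0 : 0 < κ := by linarith
  have hp0 : 0 < p := by linarith
  have hB0 : 0 ≤ B := by rw [hB]; positivity
  have hκ6 : 1 ≤ κ ^ 6 := one_le_pow₀ hκ1
  have hpκ : 1 ≤ p * κ ^ 6 := one_le_mul_of_one_le_of_one_le hp1 hκ6
  have hBg : B ≤ g ^ 2 := by rw [hB]; exact div_le_self (sq_nonneg _) hpκ
  have hc2 : c₀ ^ 2 ≤ 1 / 250000 := by
    have := pow_le_pow_left₀ hc₀.le hc 2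
    linarith
  have hc2' : c₀ ^ 2 ≤ c₁ ^ 2 / 250000 := by
    have := pow_le_pow_left₀ hc₀.le hc' 2
    linarith
  -- the three small quantities
  have b1 : p * lam ^ 2 * k ≤ c₀ ^ 2 * B := by
    have h1 : lam * (p * √k * κ ^ 3) ≤ c₀ * g := by
      rwa [le_div_iff₀ (by positivity)] at hlam'
    have h2 := pow_le_pow_left₀ (by positivity) h1 2
    have h3 : (lam * (p * √k * κ ^ 3)) ^ 2 = p * lam ^ 2 * k * (p * κ ^ 6) := by
      linear_combination lam ^ 2 * p ^ 2 * κ ^ 6 * hsk2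
    rw [h3, ← le_div_iff₀ (by positivity), mul_pow, mul_div_assoc, ← hB] at h2
    exact h2
  have hdiv : ∀ t, κ ^ 6 * p * t ≤ c₀ ^ 2 * g ^ 2 → t ≤ c₀ ^ 2 * B := fun t ht => by
    rw [hB, ← mul_div_assoc, le_div_iff₀ (by positivity)]
    linarith
  have b3 := hdiv _ hfro
  have hτ0 : 0 ≤ (y.G - Z * Z.transpose).trace := by
    rw [← hTD.compress_eq (setG_transpose hyG)]
    exact (compress_posSemidef hyG.1).trace_nonneg
  have b2 : (y.G - Z * Z.transpose).trace ^ 2 / k ≤ c₀ ^ 2 * B := by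
    refine le_trans ?_ (hdiv _ hnuc)
    exact div_le_div_of_nonneg_right (pow_le_pow_left₀ hτ0 (trace_le_nuclearNorm _) 2) hk0.le
  -- size of the true parameter
  have hfG : frob y.G ≤ 2 * √k * g := by
    have h1 := frob_add_le (Z * Z.transpose) (y.G - Z * Z.transpose)
    rw [add_sub_cancel] at h1
    have h2 := hTD.frob_factor_le
    have h3 : frob (y.G - Z * Z.transpose) ≤ g := by
      refine abs_le_of_sq_le_sq' ?_ hG0.le |>.2
      have : c₀ ^ 2 * B ≤ 1 * g ^ 2 := mul_le_mul (by linarith) hBg hB0 (by norm_num)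
      linarith
    have h4 : g ≤ √k * g := le_mul_of_one_le_left hG0.le hsk1
    linarith
  have hgam2 : gam * (2 * (4 * K + 1)) * g ≤ lam := by
    rw [le_div_iff₀ hG0, one_div, ← div_eq_inv_mul, le_div_iff₀ (by positivity)] at hgam'
    linarith
  have hreg : gam * frob y.G * (4 * K + 1) ≤ lam * √k := by
    have h1 := mul_le_mul_of_nonneg_right hgam2 (Real.sqrt_nonneg (k : ℝ))
    have h2 := mul_le_mul_of_nonneg_left hfG (show 0 ≤ gam * (4 * K + 1) by positivity)
    linarith
  have hlamg : lam ≤ g := by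
    refine hlam'.trans ((div_le_self (by positivity) ?_).trans ?_)
    · exact one_le_mul_of_one_le_of_one_le (one_le_mul_of_one_le_of_one_le hp1 hsk1)
        (one_le_pow₀ hκ1)
    · exact mul_le_of_le_one_left hG0.le (by linarith)
  have hgam1 : gam ≤ 1 := by
    have h1 : gam * g * 1 ≤ gam * g * (2 * (4 * K + 1)) :=
      mul_le_mul_of_nonneg_left (by linarith) (by positivity)
    have h2 : gam * g ≤ 1 * g := by linarith
    exact le_of_mul_le_mul_right h2 hG0
  have hh : gam * η ≤ 1 / 3 := by
    have := mul_le_mul hgam1 hη' hη.le zero_le_one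
    linarith
  obtain ⟨x, hfix, hxβ, hconv⟩ := exists_fixedPoint (A := A) (lam := lam) hn hX hbG hbα hbβ hgam
    hη hη' hh hsr
  have hstat : sqErr X x y ≤ 3600 * (c₀ ^ 2 * B) := by
    have := fixedPoint_error hn hk hA hX hXk hK hbG hbα hbβ hM hlam hgam hη hsr hfix hxβ hyG hyα
      hyβ hTD hW hWX hreg hKα hKβ
    rw [hpM] at this
    refine this.trans ?_
    linarith
  have hs : 1 / 2 ≤ s ∧ s ≤ 2 := by
    rcases hsr with e | e | e <;> rw [Prod.mk.injEq] at e <;> rw [e.1] <;> norm_num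
  have hinit : sqErr X ⟨0, 0, 0⟩ y ≤ (4 + 12 * K ^ 2) * (k * g ^ 2) := by
    have e1 : sqErr X ⟨0, 0, 0⟩ y
        = frob y.G ^ 2 + 2 * frob (outerOne y.α) ^ 2 + frob (y.β • X) ^ 2 := by
      rw [sqErr_comm]
      simp only [sqErr, sub_zero]
    have h1 := pow_le_pow_left₀ (frob_nonneg _) hKα 2
    have h2 := pow_le_pow_left₀ (frob_nonneg _) hKβ 2
    have h3 := pow_le_pow_left₀ (frob_nonneg _) hfG 2
    have h4 : (2 * √k * g) ^ 2 = 4 * (k * g ^ 2) := by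
      linear_combination 4 * g ^ 2 * hsk2
    rw [h4] at h3
    have h5 := mul_le_mul_of_nonneg_left h3 (show 0 ≤ 1 + 3 * K ^ 2 by positivity)
    rw [e1]
    nlinarith
  have hsmall : 3600 * (c₀ ^ 2 * B) ≤ k * g ^ 2 := by
    have h3 : c₀ ^ 2 * B ≤ 1 / 250000 * g ^ 2 := mul_le_mul hc2 hBg hB0 (by norm_num)
    have h4 : 1 * g ^ 2 ≤ k * g ^ 2 := mul_le_mul_of_nonneg_right hk1 (sq_nonneg _)
    linarith [sq_nonneg g]
  have hgη : 0 < gam * η := mul_pos hgam hη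
  have hTy := sqErr_le_of_linear_convergence hs.1 hs.2 (hconv T) hstat hinit hsmall
    (by linarith) (by linarith) (by positivity) hT
  have hxTG : (iter A X bG bα bβ lam gam η s r T).G.PosSemidef := by
    cases T with
    | zero => exact Matrix.PosSemidef.zero
    | succ T => exact (nearestPoint_setG hbG _).1.1
  refine (errMetric_le hk hxTG hyG.1 hZ hZT hσ).trans ?_
  -- The budget is `c₁ ^ 2 * B / 12`. Optimisation takes half of it, since `384 = 16 * 24`. The
  -- statistical terms amount to `7201 * c₀ ^ 2 * B`, which is less than the other half because `c₀
  -- ≤ c₁ / 500`.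
  have hfin : sqErr X (iter A X bG bα bβ lam gam η s r T) y + frob (y.G - Z * Z.transpose) ^ 2
      ≤ c₁ ^ 2 * B / 12 := by
    have h1 : c₀ ^ 2 * B ≤ c₁ ^ 2 / 250000 * B := mul_le_mul_of_nonneg_right hc2' hB0
    have h2 : 0 ≤ c₁ ^ 2 * B := by positivity
    have h5 : 16 * ((5 + 12 * K ^ 2) * (k * g ^ 2)
        / (384 * (5 + 12 * K ^ 2) * p * k * κ ^ 6 / c₁ ^ 2)) = c₁ ^ 2 / 24 * B := by
      rw [hB]
      have : (0 : ℝ) < 5 + 12 * K ^ 2 := by positivity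
      field_simp
      norm_num
    rw [h5] at hTy
    linarith
  have h1 := mul_le_mul_of_nonneg_left hfin (show 0 ≤ 12 * κ ^ 2 by positivity)
  refine h1.trans (le_of_eq ?_)
  rw [hB]
  field_simp

end IterateError

/-! ### The noise -/

lemma sigmoid_le_exp (x : ℝ) : Real.sigmoid x ≤ Real.exp x := by
  rw [Real.sigmoid_def, inv_le_comm₀ (by positivity) (Real.exp_pos x), ← Real.exp_neg]
  linarith

/-- The failure probabilities are at most `3 / (4 * n)` for the operator norm and `1 / (4 * n)` for
the fixed direction `X`. Covering the whole space by `s` and the two bad events gives the lower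
bound without measurability of `s`. -/
lemma IsNetwork.noise_bound {Ω : Type*} [MeasurableSpace Ω] {μ : Measure Ω}
    [IsProbabilityMeasure μ] {n : ℕ} {Θ : Matrix (Fin n) (Fin n) ℝ}
    {A : Ω → Matrix (Fin n) (Fin n) ℝ} (hA : IsNetwork μ Θ A) (hΘ : ∀ i j, Θ i j = Θ j i)
    (hn : 2 ≤ n) {X : Matrix (Fin n) (Fin n) ℝ} (hX : X.IsSymm) (hX0 : ∀ i, X i i = 0) {r : ℝ}
    (hr0 : 1 / 2 ≤ r) (hr : Real.log n ≤ r ^ 2)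
    (hp : ∀ i j, i ≠ j → Real.sigmoid (Θ i j) ≤ r ^ 2 / n) {s : Set Ω}
    (hs : ∀ ω, opNorm (A ω - Θ.map Real.sigmoid) ≤ 8000 * r →
      |frobInner (A ω - Θ.map Real.sigmoid) X| ≤ 8000 * r * frob X → ω ∈ s) :
    1 - (n : ℝ) ^ (-1 : ℝ) ≤ μ.real s := by
  have hN : (0 : ℝ) < n := by positivity
  have h1 := hA.opNorm_tail hΘ hn hr0 hr hp
  have h2 : μ.real {ω | ¬ |frobInner (A ω - Θ.map Real.sigmoid) X| ≤ 8000 * r * frob X} ≤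
      1 / (4 * n) := by
    by_cases hX' : X = 0
    · have : {ω | ¬ |frobInner (A ω - Θ.map Real.sigmoid) X| ≤ 8000 * r * frob X} = ∅ := by
        refine Set.eq_empty_of_forall_notMem fun ω hω => hω ?_
        have : frobInner (A ω - Θ.map Real.sigmoid) X = 0 := by rw [hX']; simp [frobInner]
        rw [this, abs_zero]
        exact mul_nonneg (by linarith) (frob_nonneg _)
      rw [this, measureReal_empty]
      positivity
    · have hf : 0 < frob X := lt_of_le_of_ne (frob_nonneg _) fun h => hX' (frob_eq_zero h.symm)
      have hr1 : 0 < r := by linarith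
      have h3 := hA.chebyshev hp X hX hX0 hΘ (t := 8000 * r * frob X) (by positivity)
      refine le_trans (measureReal_mono fun ω hω => (not_le.1 hω).le) (h3.trans ?_)
      rw [← frob_sq_eq_sum]
      have e : 2 * (r ^ 2 / n) * frob X ^ 2 / (8000 * r * frob X) ^ 2 = 2 / (8000 ^ 2 * n) := by
        field_simp
      rw [e, div_le_div_iff₀ (by positivity) (by positivity)]
      linarith
  have h3 : (Set.univ : Set Ω) ⊆ s ∪ ({ω | ¬ opNorm (A ω - Θ.map Real.sigmoid) ≤ 8000 * r} ∪
      {ω | ¬ |frobInner (A ω - Θ.map Real.sigmoid) X| ≤ 8000 * r * frob X}) := by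
    intro ω _
    by_cases c1 : opNorm (A ω - Θ.map Real.sigmoid) ≤ 8000 * r
    · by_cases c2 : |frobInner (A ω - Θ.map Real.sigmoid) X| ≤ 8000 * r * frob X
      · exact Or.inl (hs ω c1 c2)
      · exact Or.inr (Or.inr c2)
    · exact Or.inr (Or.inl c1)
  have h4 := measureReal_mono (μ := μ) h3
  rw [probReal_univ] at h4
  have h5 := h4.trans ((measureReal_union_le _ _).trans
    (add_le_add_right (measureReal_union_le _ _) _))
  rw [Real.rpow_neg_one]
  have h6 : 3 / (4 * (n : ℝ)) + 1 / (4 * n) = (n : ℝ)⁻¹ := by field_simp; norm_num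
  linarith

end LatentSpace

/-! ### Choice of constants and assembly -/

theorem theorem4p5 :
    ∃ M₀ : ℝ, 0 < M₀ ∧
    ∀ K : ℝ, 0 < K →
    ∃ C₀ δ c C₁ : ℝ, 0 < C₀ ∧ 0 < δ ∧ 0 < c ∧ 0 < C₁ ∧
    ∀ c₁ : ℝ, 0 < c₁ →
    ∃ c₀ C : ℝ, 0 < c₀ ∧ 0 < C ∧
    ∀ (n k : ℕ), 1 ≤ k →
    ∀ (M₁ M₂ bG bα bβ : ℝ), 0 ≤ M₂ → M₂ ≤ M₁ →
      0 ≤ bG → 0 ≤ bα → 0 ≤ bβ → bG + 2 * bα + bβ ≤ M₁ →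
    ∀ X : Matrix (Fin n) (Fin n) ℝ, X.IsSymm → (∀ i, X i i = 0) →
      (X ≠ 0 → M₀ * k ≤ LatentSpace.frob X ^ 2 / LatentSpace.opNorm X ^ 2) →
    ∀ (Gs : Matrix (Fin n) (Fin n) ℝ) (αs : Fin n → ℝ) (βs : ℝ),
      LatentSpace.InParamSpace X bG bα bβ M₂ Gs αs βs →
      LatentSpace.frob (LatentSpace.outerOne αs) ≤ K * LatentSpace.frob Gs →
      LatentSpace.frob (βs • X) ≤ K * LatentSpace.frob Gs →
    ∀ Zs : Matrix (Fin n) (Fin k) ℝ, LatentSpace.IsTopFactor k Gs Zs →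
      0 < LatentSpace.singVal Zs (k - 1) →
    ∀ (lam gam η s r : ℝ),
      C₀ * √(max (n * Real.exp (-M₂)) (Real.log n)) ≤ lam →
      lam ≤ c₀ * LatentSpace.opNorm Gs /
        (Real.exp (2 * M₁) * √k * LatentSpace.condNum Zs ^ 3) →
      0 < gam → gam ≤ δ * lam / LatentSpace.opNorm Gs →
      0 < η → η ≤ 2 / 9 →
      ((s, r) = (1 / 2, 1) ∨ (s, r) = (1, 1) ∨ (s, r) = (2, 2)) →
      C * LatentSpace.condNum Zs ^ 6 * Real.exp (2 * M₁) *
          max (LatentSpace.rateSq n k M₁ M₂)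
            (max (LatentSpace.nuclearNorm (Gs - Zs * Zs.transpose) ^ 2 / k)
              (LatentSpace.frob (Gs - Zs * Zs.transpose) ^ 2)) ≤
        LatentSpace.opNorm Gs ^ 2 →
    ∀ {Ω : Type*} [MeasurableSpace Ω] (μ : MeasureTheory.Measure Ω)
      [MeasureTheory.IsProbabilityMeasure μ] (A : Ω → Matrix (Fin n) (Fin n) ℝ),
      LatentSpace.IsNetwork μ (LatentSpace.thetaMat X Gs αs βs) A →
      1 - (n : ℝ) ^ (-c) ≤
        μ.real {ω | ∀ T : ℕ,
          Real.log (C₁ * Real.exp (2 * M₁) * k * LatentSpace.condNum Zs ^ 6 / c₁ ^ 2) *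
              (Real.log (1 / (1 - gam * η)))⁻¹ ≤ (T : ℝ) →
          ∀ ZT : Matrix (Fin n) (Fin k) ℝ,
            LatentSpace.IsTopFactor k
              (LatentSpace.iter (A ω) X bG bα bβ lam gam η s r T).G ZT →
            LatentSpace.errMetric X Zs αs βs ZT
                (LatentSpace.iter (A ω) X bG bα bβ lam gam η s r T).α
                (LatentSpace.iter (A ω) X bG bα bβ lam gam η s r T).β ≤
              c₁ ^ 2 * Real.exp (-2 * M₁) * LatentSpace.opNorm Zs ^ 4 /
                LatentSpace.condNum Zs ^ 4} := by
  -- `32000 = 4 * 8000` turns the noise level `8000 * √d` into `lam / 4`, and `δ` makes the ridge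
  -- bias at most `lam * √k` times the error. `C₁` is the constant with which the optimisation error
  -- uses half of the budget in `errMetric_iter_le`.
  refine ⟨2304, by norm_num, fun K hK => ⟨32000, 1 / (2 * (4 * K + 1)), 1, 384 * (5 + 12 * K ^ 2),
    by norm_num, by positivity, by norm_num, by positivity, fun c₁ hc₁ => ?_⟩⟩
  obtain ⟨c₀, hc₀⟩ : ∃ c₀, c₀ = min 1 c₁ / 500 := ⟨_, rfl⟩
  have hc₀0 : 0 < c₀ := by rw [hc₀]; exact div_pos (lt_min one_pos hc₁) (by norm_num)
  have hc₀1 : c₀ ≤ 1 / 500 := by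
    rw [hc₀]; exact div_le_div_of_nonneg_right (min_le_left _ _) (by norm_num)
  have hc₀2 : c₀ ≤ c₁ / 500 := by
    rw [hc₀]; exact div_le_div_of_nonneg_right (min_le_right _ _) (by norm_num)
  refine ⟨c₀, 1 / c₀ ^ 2, hc₀0, by positivity, ?_⟩
  intro n k hk M₁ M₂ bG bα bβ hM₂ hM₁₂ hbG hbα hbβ hM X hX hX0 hXk Gs αs βs hs hKα hKβ Zs hZ hσ
    lam gam η s r hlam hlam' hgam hgam' hη hη' hsr hsig Ω _ μ _ A hA
  have hkn : k ≤ n := hZ.1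
  -- `1 ≤ k ≤ n` excludes `n = 0`, and for `n = 1` the claimed probability is `1 - 1 = 0`.
  rcases (show n = 1 ∨ 2 ≤ n by omega) with rfl | hn
  · simp only [Nat.cast_one, Real.one_rpow, sub_self]
    exact measureReal_nonneg
  have hN : (0 : ℝ) < n := by positivity
  have hk0 : (0 : ℝ) < k := by exact_mod_cast hk
  set y : LatentSpace.Iterate n := ⟨Gs, αs, βs⟩ with hy
  have hyG : y.G ∈ LatentSpace.setG n bG :=
    ⟨hs.psd, hs.centered, LatentSpace.abs_apply_le_of_posSemidef hs.psd hs.diag_le⟩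
  have hyβ : y.β ∈ LatentSpace.setBeta X bβ := fun i j => by
    rcases lt_trichotomy i j with h | h | h
    · exact hs.beta_le i j h
    · rw [h, hX0]; simpa using hbβ
    · rw [← hX.apply]; exact hs.beta_le j i h
  have hΘ : ∀ i j, LatentSpace.thetaMat X Gs αs βs i j = LatentSpace.thetaMat X Gs αs βs j i :=
    fun i j => congrFun (congrFun
      (LatentSpace.thetaMat_symm hX (LatentSpace.setG_transpose hyG) αs βs) j) i
  obtain ⟨d, hd⟩ : ∃ d, d = max (n * Real.exp (-M₂)) (Real.log n) := ⟨_, rfl⟩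
  rw [← hd] at hlam
  have hd1 : Real.log n ≤ d := by rw [hd]; exact le_max_right _ _
  have hd2 : n * Real.exp (-M₂) ≤ d := by rw [hd]; exact le_max_left _ _
  -- From `log 2 > 1 / 4`; it supplies the lower bound `1 / 2 ≤ √d` that absorbs the diagonal in the
  -- norm bound.
  have hd0 : 1 / 4 ≤ d := by
    have h1 : Real.log 2 ≤ Real.log n :=
      Real.log_le_log (by norm_num) (by exact_mod_cast hn)
    linarith [Real.log_two_gt_d9]
  have hr0 : 1 / 2 ≤ √d := by
    rw [show (1 : ℝ) / 2 = √(1 / 4) by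
      rw [show (1 : ℝ) / 4 = (1 / 2) ^ 2 by norm_num, Real.sqrt_sq (by norm_num)]]
    exact Real.sqrt_le_sqrt hd0
  have hr2 : √d ^ 2 = d := Real.sq_sqrt (by linarith)
  have hXk' : 2304 * k * LatentSpace.opNorm X ^ 2 ≤ LatentSpace.frob X ^ 2 := by
    rcases eq_or_lt_of_le (LatentSpace.opNorm_nonneg X) with h | h
    · rw [← h]; simpa using sq_nonneg (LatentSpace.frob X)
    · have hXne : X ≠ 0 := fun h0 => by
        have := LatentSpace.opNorm_le_of_mulVec X le_rfl fun v => by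
          rw [h0, Matrix.zero_mulVec, zero_mul, LatentSpace.vecNorm]; simp
        linarith
      exact (le_div_iff₀ (by positivity)).1 (hXk hXne)
  have hsmall : ∀ t, t ≤ max (LatentSpace.rateSq n k M₁ M₂)
      (max (LatentSpace.nuclearNorm (Gs - Zs * Zs.transpose) ^ 2 / k)
        (LatentSpace.frob (Gs - Zs * Zs.transpose) ^ 2)) →
      LatentSpace.condNum Zs ^ 6 * Real.exp (2 * M₁) * t ≤ c₀ ^ 2 * LatentSpace.opNorm Gs ^ 2 := by
    intro t ht
    have hκ : 0 ≤ LatentSpace.condNum Zs ^ 6 * Real.exp (2 * M₁) :=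
      mul_nonneg (pow_nonneg (div_nonneg (LatentSpace.opNorm_nonneg _) hσ.le) 6)
        (Real.exp_pos _).le
    refine (mul_le_mul_of_nonneg_left ht hκ).trans ?_
    rw [mul_assoc (1 / c₀ ^ 2), mul_assoc (1 / c₀ ^ 2), one_div,
      inv_mul_le_iff₀ (by positivity)] at hsig
    exact hsig
  refine hA.noise_bound hΘ hn hX hX0 hr0 (by rw [hr2]; exact hd1) (fun i j hij => ?_)
    fun ω hW hWX => ?_
  · rw [hr2, le_div_iff₀ hN]
    have h1 := (LatentSpace.sigmoid_le_exp _).trans (Real.exp_le_exp.2 (hs.theta_le i j hij))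
    have h2 := mul_le_mul_of_nonneg_right h1 hN.le
    linarith
  · intro T hT ZT hZT
    have hlam4 : 8000 * √d ≤ lam / 4 := by linarith
    exact LatentSpace.errMetric_iter_le (y := y) (by omega) hk (hA.symm ω) hX hXk' (by linarith)
      hK.le hc₁ hc₀0 hc₀1 hc₀2 hbG hbα hbβ hM (by linarith) hgam hη hη' hsr hyG hs.alpha_le hyβ hZ
      hσ (hW.trans hlam4)
      (hWX.trans (mul_le_mul_of_nonneg_right hlam4 (LatentSpace.frob_nonneg _))) hKα hKβ hlam'
      hgam' (hsmall _ ((le_max_left _ _).trans (le_max_right _ _)))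
      (hsmall _ ((le_max_right _ _).trans (le_max_right _ _))) hT hZT
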